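/- Conventions. For a bi-infinite sequence $P=(P_q)_{q\in\mathbb Z}$ of points of $\mathbb{RP}^2$, the pentagram map is $T(P)_q=(P_{q-3}P_{q-1})\cap(P_{q-2}P_q)$; it is defined on $P$ when all these diagonals are lines and consecutive ones are distinct. A seed of type $(n,k)$ consists of the vertices $A_1,\dots,A_n$, in cyclic order, of a strictly convex $n$-gon in some affine chart of $\mathbb{RP}^2$, and of a point $B_j$ in the interior of the edge $A_jA_{j+1}$ (indices mod $n$) for $j=n-k+1,\dots,n$. Let $n\ge 4$ and $1\le k\le n-1$. A (labeled) PLC (properly locally convex) pentagram spiral of type $(n,k)$ is a bi-infinite polygonal path with vertices $P_q$, $q\in\mathbb Z$, such that $T^k$ is defined on $P$, $T^k(P)_q=P_{q+n-k}$ for all $q$ (so $T^k(P)=P$ as unlabeled paths), and $P$ is generated by seeds: for every $q$, the points $$(A_1,\dots,A_n)=\bigl(P_q,P_{q+1},\dots,P_{q+n-k},T^{k-1}(P)_q,\dots,T^2(P)_q,T(P)_q\bigr),\qquad B_{n+1-j}=T^j(P)_{q+1}\quad(1\le j\le k)$$ form a seed of type $(n,k)$. The edge of $P$ from $P_q$ to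 $P_{q+1}$ is the edge $A_1A_2$ of this convex polygon. The triangulation associated to $P$ consists of the solid triangles (taken inside the convex polygon $A_1\cdots A_n$ at $q$) with vertices $Q_q,Q_{q+1},Q'_{q+2}$ and $Q_q,Q'_{q+1},Q'_{q+2}$, where $Q=T^{j-1}(P)$, $Q'=T^j(P)$, $1\le j\le k$, $q\in\mathbb Z$; its support is the union of these triangles. The $\omega$-limit set of $P$ is the set of points of $\mathbb{RP}^2$ at which the edges of $P$ accumulate as the label tends to $+\infty$ or to $-\infty$, that is $\bigcap_{N}\overline{\bigcup_{|q|\ge N}P_qP_{q+1}}$; one-sided limit sets are defined in the same way with $q\ge N$ or $q\le -N$. Theorem. Let $P$ be a PLC pentagram spiral of type $(n,k)$. Then there are a point $p\in\mathbb{RP}^2$ and a line $L\subset\mathbb{RP}^2$ with $p\notin L$ such that the $\omega$-limit set of $P$ is $\{p\}\cup L$; more precisely, the limit set as $q\to+\infty$ (the inward direction) is $\{p\}$ and the limit set as $q\to-\infty$ (the outward direction) is $L$. Equivalently, the support of the triangulation associated to $P$ is $\mathbb{RP}^2\setminus(\{p\}\cup L)$, and so it is projectively equivalent to a punctured Euclidean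 plane: some projective transformation maps it onto $\{[x:y:1] : (x,y)\ne(0,0)\}$. -/

import Mathlib

noncomputable section

namespace Pentagram

/-- Homogeneous coordinates. -/
abbrev Vec : Type := Fin 3 → ℝ

/-- The real projective plane: lines through the origin of `ℝ³`. -/
abbrev RP2 : Type := Projectivization ℝ Vec

/-- The usual topology of the projective plane: the quotient topology from `ℝ³ ∖ {0}`. -/
instance instTopologicalSpaceRP2 : TopologicalSpace RP2 :=
  TopologicalSpace.coinduced
    (fun v : {v : Vec // v ≠ 0} => Projectivization.mk ℝ v.1 v.2) inferInstance

/-- A line of the projective plane: the zero set of a nonzero linear functional. -/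
def IsLine (L : Set RP2) : Prop :=
  ∃ ℓ : Vec →ₗ[ℝ] ℝ, ℓ ≠ 0 ∧ L = {x | ℓ x.rep = 0}

/-- The point `[x : y : 1]`. -/
def affinePoint (x y : ℝ) : RP2 :=
  Projectivization.mk ℝ (![x, y, 1] : Vec) (fun h => one_ne_zero (α := ℝ) (congrFun h 2))

/-- The Euclidean plane `{[x : y : 1]}` with its origin removed. -/
def puncturedPlane : Set RP2 :=
  {z | ∃ x y : ℝ, (x, y) ≠ (0, 0) ∧ z = affinePoint x y}

/-- The projective transformation induced by an invertible linear map. -/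
def projTransformation (g : Vec ≃ₗ[ℝ] Vec) : RP2 → RP2 :=
  Projectivization.map g.toLinearMap g.injective

/-! ### Affine charts

A nonzero functional `φ` identifies the complement of the line `{φ = 0}` with the affine plane
`{v | φ v = 1}`. -/

/-- The representative `v` of `x` with `φ v = 1` (meaningful if `x` is not on the line
`{φ = 0}`). -/
def aff (φ : Vec →ₗ[ℝ] ℝ) (x : RP2) : Vec := (φ x.rep)⁻¹ • x.rep

/-- The convex hull of a set `s` of points off the line `{φ = 0}`, formed in the chart `φ`. -/
def hullIn (φ : Vec →ₗ[ℝ] ℝ) (s : Set RP2) : Set RP2 :=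
  {x | φ x.rep ≠ 0 ∧ aff φ x ∈ convexHull ℝ (aff φ '' s)}

/-! ### Seeds -/

/-- `A 1, …, A n` and `B (n-k+1), …, B n` form a seed of type `(n, k)` in the chart `φ`: the `A i`
are, in this cyclic order, the vertices of a strictly convex polygon of the affine plane
`{φ = 1}` (all triples `i < j < l` are positively oriented; replacing `φ` by `-φ` reverses the
orientation, so this covers both orientations), and `B j` is in the interior of the edge from `A j`
to `A (j+1)`, indices mod `n`. Other values of `A` and `B` are irrelevant.
For `n ≥ 4`, hulls of points of the polygon do not depend on the chart `φ` with this property. -/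
def IsSeedChart (φ : Vec →ₗ[ℝ] ℝ) (n k : ℕ) (A B : ℕ → RP2) : Prop :=
  (∀ i, 1 ≤ i → i ≤ n → φ (A i).rep ≠ 0) ∧
  (∀ i j l, 1 ≤ i → i < j → j < l → l ≤ n →
    0 < Matrix.det ![aff φ (A i), aff φ (A j), aff φ (A l)]) ∧
  (∀ j, n - k + 1 ≤ j → j ≤ n →
    φ (B j).rep ≠ 0 ∧
    aff φ (B j) ∈ openSegment ℝ (aff φ (A j)) (aff φ (A (if j = n then 1 else j + 1))))

/-- Seeds of type `(n, k)`: a strictly convex `n`-gon in the projective plane with a point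
chosen in the interior of each of its last `k` edges. -/
def IsSeed (n k : ℕ) (A B : ℕ → RP2) : Prop := ∃ φ, IsSeedChart φ n k A B

/-! ### The pentagram map on bi-infinite paths -/

/-- The line through two distinct points of the projective plane, and likewise the common point of
two distinct lines, in homogeneous coordinates, is the cross product. So this is
the path whose `q`-th vertex is the intersection
`(P_{q-3} P_{q-1}) (P_{q-2} P_q)` of two consecutive shortest diagonals of `P`. -/
def pentagramMap (P : ℤ → RP2) : ℤ → RP2 := fun q =>
  ((P (q - 3)).cross (P (q - 1))).cross ((P (q - 2)).cross (P q))

/-- The pentagram map is defined on `P`: the shortest diagonals are lines, and consecutive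
ones are distinct. -/
def PentagramDefined (P : ℤ → RP2) : Prop :=
  ∀ q, P (q - 2) ≠ P q ∧ (P (q - 3)).cross (P (q - 1)) ≠ (P (q - 2)).cross (P q)

/-- The `j`-th iterate `T^j(P)` of the pentagram map. -/
abbrev iter (P : ℤ → RP2) (j : ℕ) : ℤ → RP2 := pentagramMap^[j] P

/-- The polygon `A` of the seed at the vertex `P_q`. Its vertices `A 1, …, A n` are
`P_q, P_{q+1}, …, P_{q+n-k}` followed by `T^{k-1}(P)_q, …, T^2(P)_q, T(P)_q`. -/
def seedA (n k : ℕ) (P : ℤ → RP2) (q : ℤ) (i : ℕ) : RP2 :=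
  if i ≤ n - k + 1 then P (q + (i : ℤ) - 1) else iter P (n + 1 - i) q

/-- The points `B (n-k+1), …, B n` of the seed at the vertex `P_q`; they are
`T^k(P)_{q+1}, …, T(P)_{q+1}`, the next vertices on the spirals. -/
def seedB (n : ℕ) (P : ℤ → RP2) (q : ℤ) (j : ℕ) : RP2 := iter P (n + 1 - j) (q + 1)

/-- `P` is the sequence of vertices of a labeled properly locally convex (PLC) pentagram spiral of
type `(n, k)`: `T^k` is defined on `P`, `T^k(P) = P` as unlabeled paths, with the shift of labels
that belongs to the type `(n, k)`, and `P` is generated by seeds: the points of the spirals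
`P, T(P), …, T^{k-1}(P)` at `P_q` form a seed for every `q`. Passing from `q` to `q + 1` is the
seed map. -/
structure IsPLCSpiral (n k : ℕ) (P : ℤ → RP2) : Prop where
  four_le : 4 ≤ n
  one_le : 1 ≤ k
  lt : k < n
  defined : ∀ j < k, PentagramDefined (iter P j)
  periodic : iter P k = fun q => P (q + ((n : ℤ) - (k : ℤ)))
  seed : ∀ q, IsSeed n k (seedA n k P q) (seedB n P q)

/-- The edge of the spiral `P` from `P_q` to `P_{q+1}`, i.e. the edge `A 1 A 2` of the seed
at `P_q`. -/
def edge (n k : ℕ) (P : ℤ → RP2) (q : ℤ) : Set RP2 :=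
  {x | ∃ φ, IsSeedChart φ n k (seedA n k P q) (seedB n P q) ∧ x ∈ hullIn φ {P q, P (q + 1)}}

/-- The points at which the edges of the polygonal path `P` accumulate along a filter `f` on the
set of labels (the set `⋂_{u ∈ f} closure (⋃_{q ∈ u} edge q)`). -/
def limitSet (f : Filter ℤ) (n k : ℕ) (P : ℤ → RP2) : Set RP2 :=
  ⋂ u ∈ f, closure (⋃ q ∈ u, edge n k P q)

/-- The ω-limit set of the bi-infinite polygonal path `P`, as the label tends to `+∞` or `-∞`. -/
def omegaLimitSet (n k : ℕ) (P : ℤ → RP2) : Set RP2 := limitSet Filter.cofinite n k P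

/-- The support of the triangulation associated to `P`: the union of its solid triangles.
Its edges are the edges and shortest diagonals of the spirals `P, T(P), …, T^k(P) = P`, so that
with `Q = T^{j-1}(P)` and `Q' = T^j(P)` its triangles are `Q_q Q_{q+1} Q'_{q+2}` and
`Q_q Q'_{q+1} Q'_{q+2}`, for `1 ≤ j ≤ k` and all `q`. They lie in the polygon of the seed at
`P_q`. -/
def triangulationSupport (n k : ℕ) (P : ℤ → RP2) : Set RP2 :=
  {x | ∃ q φ, IsSeedChart φ n k (seedA n k P q) (seedB n P q) ∧
    ∃ j, 1 ≤ j ∧ j ≤ k ∧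
      (x ∈ hullIn φ {iter P (j - 1) q, iter P (j - 1) (q + 1), iter P j (q + 2)} ∨
       x ∈ hullIn φ {iter P (j - 1) q, iter P j (q + 1), iter P j (q + 2)})}

end Pentagram

end

/-! The vertices are lifted to ℝ³ with coherent signs, so that every seed polygon is positively
oriented and each new vertex is a nonnegative combination of two consecutive old ones
(`exists_spiralLift`). The cones over the polygons are then nested, and the dual cones of
functionals nonnegative on them grow with `q`. If passing to a later polygon contracts these cones
uniformly, as in the Birkhoff–Hopf argument, they shrink to a single ray `p` as `q → +∞`, and only
one functional `g`, up to scale, is nonnegative on all polygons. The point is `[p]` and the line is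
`g = 0`.

Uniformity is the heart of the matter. After rescaling, each path `T^j(P)` satisfies `v q = v (q-1)
- b q • v (q-2) + c q • v (q-3)`, and the pentagram map acts on `(b, c)` by a rational formula
(`exists_normalized`). With `x q = c q / (b q * b (q-1))`, `y = b` and `z = 1 - x y`, the numbers
`z` and `1 - z` are the weights with which the edges are cut. Since `T^k` only shifts `P`, a window
product of `x` times products of `z`, and a window product of `y` divided by products of `z`, do not
depend on the position of the window. Convexity gives `x, y ≤ 1` for `P` itself, so a conserved
product of factors at most `1` bounds each factor from below (`corner_invariants_bounded`). The cuts
therefore stay uniformly away from the vertices.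

These bounds give a Harnack inequality over `2n` steps (`harnack`), hence contraction of the
oscillation of ratios `f / g` (`ratioIn_contract`). Compactness gives the existence of `g`
(`exists_functional`), and contraction from the remote past gives its uniqueness (`exists_eq_smul`);
`exists_isLimitPair` collects the consequences.

Late polygons converge to `p`. Early polygons exhaust the complement of the line, so early edges can
accumulate only on it. Every point of the line is reached because the spiral winds around `p`
infinitely often (`exists_crossing`): otherwise a nonzero functional vanishing at `p` would be
nonnegative on a whole polygon. Finally, a point off `p` and the line is inside some polygon and
outside a later one, so it lies in a corner cut off in a single step, and two triangles of the
triangulation cover that corner. -/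

namespace Pentagram

/-! ### Determinants and Cramer's rule in ℝ³ -/

/-- The determinant of three vectors. -/
def tri (u v w : Vec) : ℝ :=
  u 0 * (v 1 * w 2 - v 2 * w 1) - u 1 * (v 0 * w 2 - v 2 * w 0) + u 2 * (v 0 * w 1 - v 1 * w 0)

theorem det_eq_tri (u v w : Vec) : Matrix.det ![u, v, w] = tri u v w :=
  (Matrix.det_fin_three (Matrix.of ![u, v, w])).trans (by simp [tri]; ring)

theorem tri_cycle (u v w : Vec) : tri v w u = tri u v w := by
  simp only [tri]; ring

theorem tri_swap (u v w : Vec) : tri v u w = -tri u v w := by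
  simp only [tri]; ring

theorem tri_swap_right (u v w : Vec) : tri u w v = -tri u v w := by
  simp only [tri]; ring

@[simp] theorem tri_self_left (u w : Vec) : tri u u w = 0 := by
  simp only [tri]; ring

@[simp] theorem tri_self_right (u w : Vec) : tri u w w = 0 := by
  simp only [tri]; ring

@[simp] theorem tri_self_outer (u w : Vec) : tri u w u = 0 := by
  simp only [tri]; ring

@[simp] theorem tri_add_left (u u' v w : Vec) : tri (u + u') v w = tri u v w + tri u' v w := by
  simp only [tri, Pi.add_apply]; ring

@[simp] theorem tri_add_mid (u v v' w : Vec) : tri u (v + v') w = tri u v w + tri u v' w := by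
  simp only [tri, Pi.add_apply]; ring

@[simp] theorem tri_add_right (u v w w' : Vec) : tri u v (w + w') = tri u v w + tri u v w' := by
  simp only [tri, Pi.add_apply]; ring

@[simp] theorem tri_sub_right (u v w w' : Vec) : tri u v (w - w') = tri u v w - tri u v w' := by
  simp only [tri, Pi.sub_apply]; ring

@[simp] theorem tri_smul_left (c : ℝ) (u v w : Vec) : tri (c • u) v w = c * tri u v w := by
  simp only [tri, Pi.smul_apply, smul_eq_mul]; ring

@[simp] theorem tri_smul_mid (c : ℝ) (u v w : Vec) : tri u (c • v) w = c * tri u v w := by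
  simp only [tri, Pi.smul_apply, smul_eq_mul]; ring

@[simp] theorem tri_smul_right (c : ℝ) (u v w : Vec) : tri u v (c • w) = c * tri u v w := by
  simp only [tri, Pi.smul_apply, smul_eq_mul]; ring

/-- The functional `tri u v`, which vanishes on the line through `u` and `v`. -/
def triL (u v : Vec) : Vec →ₗ[ℝ] ℝ where
  toFun := tri u v
  map_add' := tri_add_right u v
  map_smul' c w := tri_smul_right c u v w

@[simp] theorem triL_apply (u v w : Vec) : triL u v w = tri u v w := rfl

/-- Cramer's rule. -/
theorem tri_smul_eq (u v w x : Vec) :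
    tri u v w • x = tri x v w • u + tri u x w • v + tri u v x • w := by
  ext i
  simp only [Pi.add_apply, Pi.smul_apply, smul_eq_mul, tri]
  fin_cases i <;> simp <;> ring

theorem eq_of_tri_ne_zero {u v w : Vec} (h : tri u v w ≠ 0) (x : Vec) :
    x = (tri x v w / tri u v w) • u + (tri u x w / tri u v w) • v +
      (tri u v x / tri u v w) • w := by
  have := tri_smul_eq u v w x
  rw [div_eq_inv_mul, div_eq_inv_mul, div_eq_inv_mul, mul_smul, mul_smul, mul_smul, ← smul_add,
    ← smul_add, ← this, smul_smul, inv_mul_cancel₀ h, one_smul]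

theorem linearMap_ext_of_tri {u v w : Vec} (h : tri u v w ≠ 0) {f g : Vec →ₗ[ℝ] ℝ}
    (hu : f u = g u) (hv : f v = g v) (hw : f w = g w) : f = g := by
  refine LinearMap.ext fun x => ?_
  rw [eq_of_tri_ne_zero h x]
  simp only [map_add, map_smul, hu, hv, hw]

/-! ### Nested convex polygons in homogeneous coordinates -/

/-- The vertices `a q 0, …, a q (n-1)`, continued `n`-periodically, of a sequence of strictly convex
polygons in homogeneous coordinates, each inscribed in the previous one as in the
definition of pentagram spirals. -/
structure ConvexSpiral (n k : ℕ) (a : ℤ → ℕ → Vec) : Prop where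
  four_le : 4 ≤ n
  one_le : 1 ≤ k
  lt : k < n
  periodic : ∀ q i, a q (i + n) = a q i
  pos : ∀ q i j l, i < j → j < l → l < i + n → 0 < tri (a q i) (a q j) (a q l)
  step : ∀ q i, ∃ α β : ℝ, 0 ≤ α ∧ 0 < β ∧ a (q + 1) i = α • a q i + β • a q (i + 1)
  cut : ∀ q i, n - k ≤ i → i < n →
    ∃ α β : ℝ, 0 < α ∧ 0 < β ∧ a (q + 1) i = α • a q i + β • a q (i + 1)
  shift : ∀ q i, i < n - k → ∃ β : ℝ, 0 < β ∧ a (q + 1) i = β • a q (i + 1)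
  diag : ∀ q i, n - k ≤ i → i < n → tri (a q (i + 1)) (a (q + 2) (i + 1)) (a (q + 2) i) = 0

namespace ConvexSpiral

variable {n k : ℕ} {a : ℤ → ℕ → Vec}

theorem nonneg (h : ConvexSpiral n k a) (q : ℤ) {i j l : ℕ} (hij : i ≤ j) (hjl : j ≤ l)
    (hl : l ≤ i + n) : 0 ≤ tri (a q i) (a q j) (a q l) := by
  rcases hij.eq_or_lt with rfl | hij
  · simp
  rcases hjl.eq_or_lt with rfl | hjl
  · simp
  rcases hl.eq_or_lt with rfl | hl
  · simp [h.periodic]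
  exact (h.pos q i j l hij hjl hl).le

/-- Over two steps, the new vertex is strictly between two vertices of its parent spiral. -/
theorem diag_pos (h : ConvexSpiral n k a) (q : ℤ) {i : ℕ} (hi : n - k ≤ i) (hin : i < n) :
    0 < tri (a q (i + 1)) (a (q + 1) (i + 1)) (a (q + 2) (i + 1)) ∧
    ∃ γ δ : ℝ, 0 < γ ∧ 0 < δ ∧
      a (q + 2) i = γ • a (q + 2) (i + 1) + δ • a q (i + 1) := by
  have h4 := h.four_le
  obtain ⟨α, β, hα, hβ, e1⟩ := h.cut q i hi hin
  obtain ⟨α', β', hα', hβ', e2⟩ := h.cut (q + 1) i hi hin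
  obtain ⟨α₁, β₁, hα₁, hβ₁, e3⟩ := h.step q (i + 1)
  obtain ⟨α₁', β₁', hα₁', hβ₁', e4⟩ := h.step (q + 1) (i + 1)
  obtain ⟨α₂, β₂, hα₂, hβ₂, e5⟩ := h.step q (i + 2)
  have q2 : q + 1 + 1 = q + 2 := by ring
  rw [q2] at e2 e4
  have p012 := h.pos q i (i + 1) (i + 2) (by omega) (by omega) (by omega)
  have p123 := h.pos q (i + 1) (i + 2) (i + 3) (by omega) (by omega) (by omega)
  have b012 := h.pos (q + 1) i (i + 1) (i + 2) (by omega) (by omega) (by omega)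
  -- These three vectors serve as the basis for Cramer's rule. The middle coefficient of `a (q + 2)
  -- i` vanishes by `diag`, and `hγ`, `hδ` are the numerators of the other two.
  have hΔ : 0 < tri (a q (i + 1)) (a (q + 1) (i + 1)) (a (q + 2) (i + 1)) := by
    rw [e4]
    simp only [show i + 1 + 1 = i + 2 from rfl, tri_add_right, tri_smul_right, tri_self_right]
    rw [e5, e3]
    simp only [show i + 1 + 1 = i + 2 from rfl, show i + 2 + 1 = i + 3 from rfl, tri_add_right,
      tri_smul_right, tri_add_mid, tri_smul_mid, tri_self_right, tri_self_left]
    have : 0 < β₁' * (β₂ * (β₁ * tri (a q (i + 1)) (a q (i + 2)) (a q (i + 3)))) := by positivity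
    linarith
  refine ⟨hΔ, ?_⟩
  have hγ : 0 < tri (a q (i + 1)) (a (q + 1) (i + 1)) (a (q + 2) i) := by
    rw [e2]
    simp only [tri_add_right, tri_smul_right, tri_self_right]
    rw [e1, e3]
    simp only [show i + 1 + 1 = i + 2 from rfl, tri_add_right,
      tri_smul_right, tri_add_mid, tri_smul_mid, tri_self_left, tri_self_outer]
    rw [tri_cycle]
    have : 0 < α' * (α * (β₁ * tri (a q i) (a q (i + 1)) (a q (i + 2)))) := by positivity
    linarith
  have hδ : 0 < tri (a (q + 2) i) (a (q + 1) (i + 1)) (a (q + 2) (i + 1)) := by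
    rw [e2, e4]
    simp only [show i + 1 + 1 = i + 2 from rfl, tri_add_right, tri_add_left, tri_smul_left,
      tri_smul_right, tri_self_right, tri_self_left]
    have : 0 < β₁' * (α' * tri (a (q + 1) i) (a (q + 1) (i + 1)) (a (q + 1) (i + 2))) := by
      positivity
    linarith
  have hd := h.diag q i hi hin
  rw [tri_swap_right, neg_eq_zero] at hd
  have e := eq_of_tri_ne_zero hΔ.ne' (a (q + 2) i)
  rw [hd, zero_div, zero_smul, add_zero] at e
  exact ⟨_, _, div_pos hγ hΔ, div_pos hδ hΔ, e.trans (add_comm _ _)⟩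

/-- This is the nesting of the polygons, in dual form: later vertices are nonnegative combinations
of earlier ones. -/
theorem map_nonneg (h : ConvexSpiral n k a) {q : ℤ} {f : Vec →ₗ[ℝ] ℝ}
    (hf : ∀ i, 0 ≤ f (a q i)) (t : ℕ) : ∀ i, 0 ≤ f (a (q + t) i) := by
  induction t with
  | zero => simpa using hf
  | succ t ih =>
    intro i
    obtain ⟨α, β, hα, hβ, e⟩ := h.step (q + t) i
    rw [Nat.cast_succ, ← add_assoc, e]
    have h1 := ih i
    have h2 := ih (i + 1)
    simp only [map_add, map_smul, smul_eq_mul]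
    positivity

theorem map_nonneg_of_le (h : ConvexSpiral n k a) {q q' : ℤ} (hq : q ≤ q') {f : Vec →ₗ[ℝ] ℝ}
    (hf : ∀ i, 0 ≤ f (a q i)) : ∀ i, 0 ≤ f (a q' i) := by
  obtain ⟨t, rfl⟩ := Int.le.dest hq
  exact h.map_nonneg hf t

theorem apply_mod (h : ConvexSpiral n k a) (q : ℤ) (i : ℕ) : a q (i % n) = a q i :=
  Function.Periodic.map_mod_nat (f := a q) (h.periodic q) i

theorem mod_lt (h : ConvexSpiral n k a) (i : ℕ) : i % n < n :=
  Nat.mod_lt _ (by have := h.four_le; omega)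

theorem edge_nonneg (h : ConvexSpiral n k a) (q : ℤ) (i l : ℕ) :
    0 ≤ tri (a q i) (a q (i + 1)) (a q l) := by
  have h4 := h.four_le
  have key : ∀ l, l < n → ∀ i, i < n → 0 ≤ tri (a q i) (a q (i + 1)) (a q l) := by
    intro l hl i hi
    rcases lt_or_ge l i with hli | hli
    · rw [← h.periodic q l]
      exact h.nonneg q (by omega) (by omega) (by omega)
    · rcases hli.eq_or_lt with rfl | hli
      · simp
      exact h.nonneg q (by omega) (by omega) (by omega)
  have := key (l % n) (h.mod_lt l) (i % n) (h.mod_lt i)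
  rwa [h.apply_mod, h.apply_mod, ← h.apply_mod q (i % n + 1), Nat.mod_add_mod, h.apply_mod] at this

/-- Each step uses only a vertex and its successor. While `l + s ≤ n`, the vertices involved do not
pass `a q n = a q 0`, so their angular order as seen from `a q 0` is preserved. -/
theorem tri_advance_nonneg (h : ConvexSpiral n k a) (q : ℤ) (s : ℕ) :
    ∀ i l, i ≤ l → l + s ≤ n → 0 ≤ tri (a q 0) (a (q + s) i) (a (q + s) l) := by
  induction s with
  | zero =>
    intro i l hil hl
    simpa using h.nonneg q (Nat.zero_le i) hil (by omega)
  | succ s ih =>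
    intro i l hil hl
    rcases hil.eq_or_lt with rfl | hil
    · simp
    obtain ⟨α, β, hα, hβ, e⟩ := h.step (q + s) i
    obtain ⟨α', β', hα', hβ', e'⟩ := h.step (q + s) l
    rw [Nat.cast_succ, ← add_assoc, e, e']
    have h1 := ih i l (by omega) (by omega)
    have h2 := ih i (l + 1) (by omega) (by omega)
    have h3 := ih (i + 1) l (by omega) (by omega)
    have h4 := ih (i + 1) (l + 1) (by omega) (by omega)
    simp only [tri_add_mid, tri_add_right, tri_smul_mid, tri_smul_right]
    positivity

/-- The vertices `a q 1, …, a q (n-k)` are those that the spiral visits next. -/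
theorem shift_iter (h : ConvexSpiral n k a) (i : ℕ) :
    ∀ q : ℤ, i ≤ n - k → ∃ β : ℝ, 0 < β ∧ a (q + i) 0 = β • a q i := by
  induction i with
  | zero => exact fun q _ => ⟨1, one_pos, by simp⟩
  | succ i ih =>
    intro q hi
    obtain ⟨β, hβ, e⟩ := ih (q + 1) (by omega)
    obtain ⟨β', hβ', e'⟩ := h.shift q i (by omega)
    refine ⟨β * β', by positivity, ?_⟩
    rw [Nat.cast_succ, show q + ((i : ℤ) + 1) = q + 1 + i by ring, e, e', smul_smul]

/-- Later points stay on the inner side of the line of an edge. For `t = 4` this becomes the bound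
`b ≤ 1` in `cut_bounds`. -/
theorem tri_first_two_nonneg (h : ConvexSpiral n k a) (q : ℤ) (t : ℕ) :
    0 ≤ tri (a q 0) (a (q + 1) 0) (a (q + t) 0) := by
  have hk := h.lt
  obtain ⟨β, hβ, e⟩ := h.shift_iter 1 q (by omega)
  rw [Nat.cast_one] at e
  have := h.map_nonneg (f := triL (a q 0) (a q 1)) (q := q) (fun i => h.edge_nonneg q 0 i) t 0
  rw [triL_apply] at this
  rw [e, tri_smul_mid]
  positivity

/-- This becomes the bound `c q ≤ b q * b (q - 1)` in `cut_bounds`. The path vertex at `q + 3` is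
followed as vertex `i` of the polygon at `q + t` with `i + t = 3`; the condition of
`tri_advance_nonneg` is then exactly `4 ≤ n`. -/
theorem tri_last_two_nonneg (h : ConvexSpiral n k a) (q : ℤ) :
    0 ≤ tri (a q 0) (a (q + 3) 0) (a (q + 4) 0) := by
  have hk := h.lt
  have h4 := h.four_le
  have key : ∀ i t : ℕ, i ≤ n - k → i + t = 3 → 0 ≤ tri (a q 0) (a (q + t) i) (a (q + t + 1) i) →
      0 ≤ tri (a q 0) (a (q + 3) 0) (a (q + 4) 0) := by
    intro i t hi hit h0
    obtain ⟨β, hβ, e⟩ := h.shift_iter i (q + t) hi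
    obtain ⟨β', hβ', e'⟩ := h.shift_iter i (q + t + 1) hi
    rw [show q + t + i = q + 3 by omega] at e
    rw [show q + t + 1 + i = q + 4 by omega] at e'
    rw [e, e', tri_smul_mid, tri_smul_right]
    positivity
  have key2 : ∀ i t : ℕ, i + t = 3 → 0 ≤ tri (a q 0) (a (q + t) i) (a (q + t + 1) i) := by
    intro i t hit
    obtain ⟨α, β, hα, hβ, e⟩ := h.step (q + t) i
    have := h.tri_advance_nonneg q t i (i + 1) (by omega) (by omega)
    rw [e, tri_add_right, tri_smul_right, tri_smul_right, tri_self_right]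
    positivity
  rcases le_or_gt 3 (n - k) with hm | hm
  · exact key 3 0 hm rfl (key2 3 0 rfl)
  · exact key (n - k) (3 - (n - k)) le_rfl (by omega) (key2 _ _ (by omega))

end ConvexSpiral


/-! ### Recurrences along the paths and their normalization -/

theorem exists_int_prod (r : ℤ → ℝ) (hr : ∀ q, 0 < r q) :
    ∃ l : ℤ → ℝ, (∀ q, 0 < l q) ∧ ∀ q, l (q + 1) = r (q + 1) * l q := by
  refine ⟨fun q => (∏ t ∈ Finset.range q.toNat, r (t + 1)) /
    ∏ t ∈ Finset.range (-q).toNat, r (-t), fun q => ?_, fun q => ?_⟩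
  · exact div_pos (Finset.prod_pos fun _ _ => hr _) (Finset.prod_pos fun _ _ => hr _)
  · rcases le_or_gt 0 q with hq | hq
    · lift q to ℕ using hq
      have h1 : ((q : ℤ) + 1).toNat = q + 1 := by omega
      have h2 : (-(q : ℤ)).toNat = 0 := by omega
      have h3 : (-((q : ℤ) + 1)).toNat = 0 := by omega
      simp only [h1, h2, h3, Int.toNat_natCast, Finset.prod_range_succ, Finset.range_zero,
        Finset.prod_empty, div_one]
      ring
    · obtain ⟨p, rfl⟩ : ∃ p : ℕ, q = -(p + 1) := ⟨(-q - 1).toNat, by omega⟩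
      have h1 : (-((p : ℤ) + 1)).toNat = 0 := by omega
      have h2 : (-((p : ℤ) + 1) + 1).toNat = 0 := by omega
      have h3 : (-(-((p : ℤ) + 1))).toNat = p + 1 := by omega
      have h4 : (-(-((p : ℤ) + 1) + 1)).toNat = p := by omega
      simp only [h1, h2, h3, h4, Finset.prod_range_succ, Finset.range_zero, Finset.prod_empty]
      have e : -((p : ℤ) + 1) + 1 = -p := by ring
      rw [e]
      have := (hr (-p)).ne'
      have := (Finset.prod_pos (s := Finset.range p) fun t _ => hr (-(t : ℤ))).ne'
      field_simp

theorem eq_zero_of_int_succ {α : Type*} {f : ℤ → α} (h : ∀ q, f (q + 1) = f q) (q : ℤ) :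
    f q = f 0 := by
  induction q using Int.induction_on with
  | zero => rfl
  | succ i ih => rw [h, ih]
  | pred i ih => rw [← ih, ← h (-(i : ℤ) - 1), sub_add_cancel]

/-- The paths `v 0, …, v k` of a pentagram spiral and its images, in homogeneous coordinates with
coherent signs. -/
structure PathSystem (k : ℕ) (v : ℕ → ℤ → Vec) : Prop where
  cut : ∀ j < k, ∀ q, ∃ α β : ℝ, 0 < α ∧ 0 < β ∧
    v (j + 1) (q + 1) = α • v (j + 1) q + β • v j q
  diag : ∀ j < k, ∀ q, ∃ γ δ : ℝ, 0 < γ ∧ 0 < δ ∧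
    v (j + 1) q = γ • v j q + δ • v j (q - 2)
  indep : ∀ j < k, ∀ q, 0 < tri (v j (q - 2)) (v j (q - 1)) (v j q)

namespace PathSystem

variable {k : ℕ} {v : ℕ → ℤ → Vec}

/-- The cut relation moves the previous diagonal point to the present one along the line of the
preceding diagonal. With `diag`, this exhibits the vertex as the intersection of two diagonals. -/
theorem diag' (h : PathSystem k v) {j : ℕ} (hj : j < k) (q : ℤ) :
    ∃ γ δ : ℝ, 0 < γ ∧ 0 < δ ∧ v (j + 1) q = γ • v j (q - 1) + δ • v j (q - 3) := by
  obtain ⟨α, β, hα, hβ, e⟩ := h.cut j hj (q - 1)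
  obtain ⟨γ, δ, hγ, hδ, e'⟩ := h.diag j hj (q - 1)
  rw [sub_add_cancel] at e
  refine ⟨α * γ + β, α * δ, by positivity, by positivity, ?_⟩
  rw [e, e', show q - 1 - 2 = q - 3 by ring]
  module

/-- Equate the two expressions, `diag` and `diag'`, for the same diagonal point; the signs of the
coefficients come from there. -/
theorem recurrence (h : PathSystem k v) {j : ℕ} (hj : j < k) (q : ℤ) :
    ∃ a b c : ℝ, 0 < a ∧ 0 < b ∧ 0 < c ∧
      v j q = a • v j (q - 1) - b • v j (q - 2) + c • v j (q - 3) := by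
  obtain ⟨γ, δ, hγ, hδ, e⟩ := h.diag j hj q
  obtain ⟨γ', δ', hγ', hδ', e'⟩ := h.diag' hj q
  refine ⟨γ' / γ, δ / γ, δ' / γ, by positivity, by positivity, by positivity, ?_⟩
  have : γ • v j q = γ' • v j (q - 1) + δ' • v j (q - 3) - δ • v j (q - 2) := by
    rw [← e', e]; abel
  rw [← inv_smul_smul₀ hγ.ne' (v j q), this]
  simp only [div_eq_inv_mul, mul_smul, smul_add, smul_sub]
  abel

end PathSystem

/-- The coefficients `(b, c)` of the recurrence
`v q = v (q-1) - b q • v (q-2) + c q • v (q-3)` for the successive images of a path under the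
pentagram map. -/
noncomputable def coef (b c : ℤ → ℝ) : ℕ → (ℤ → ℝ) × (ℤ → ℝ)
  | 0 => (b, c)
  | j + 1 =>
    let D : ℤ → ℝ := fun q => (coef b c j).1 (q - 1) - (coef b c j).2 q
    (fun q => D q / D (q - 2) * (coef b c j).1 (q - 3),
      fun q => D q / D (q - 2) * (coef b c j).2 (q - 2))

/-- The successive images under the pentagram map of a path which satisfies the recurrence
`v q = v (q-1) - b q • v (q-2) + c q • v (q-3)`. -/
noncomputable def lev (v : ℤ → Vec) (b c : ℤ → ℝ) : ℕ → ℤ → Vec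
  | 0 => v
  | j + 1 => fun q => lev v b c j q + (coef b c j).1 q • lev v b c j (q - 2)

/-- Homogeneous coordinates of a path system in which the first coefficient of all
recurrences is `1`. -/
structure NormalizedSystem (k m : ℕ) (v : ℕ → ℤ → Vec) (b c : ℕ → ℤ → ℝ) (μ : ℝ) : Prop where
  recur : ∀ j ≤ k, ∀ q, v j q = v j (q - 1) - b j q • v j (q - 2) + c j q • v j (q - 3)
  next : ∀ j < k, ∀ q, v (j + 1) q = v j q + b j q • v j (q - 2)
  b_pos : ∀ j ≤ k, ∀ q, 0 < b j q
  c_pos : ∀ j ≤ k, ∀ q, 0 < c j q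
  c_lt : ∀ j < k, ∀ q, c j q < b j (q - 1)
  b_next : ∀ j < k, ∀ q, b (j + 1) q =
    (b j (q - 1) - c j q) / (b j (q - 3) - c j (q - 2)) * b j (q - 3)
  c_next : ∀ j < k, ∀ q, c (j + 1) q =
    (b j (q - 1) - c j q) / (b j (q - 3) - c j (q - 2)) * c j (q - 2)
  μ_pos : 0 < μ
  return_eq : ∀ q, v k q = μ • v 0 (q + m)
  b_return : ∀ q, b k q = b 0 (q + m)
  c_return : ∀ q, c k q = c 0 (q + m)

theorem recurrence_unique {u v w : Vec} (h : tri u v w ≠ 0) {a b c a' b' c' : ℝ}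
    (e : a • w - b • v + c • u = a' • w - b' • v + c' • u) : a = a' ∧ b = b' ∧ c = c' := by
  have e0 := congrArg (fun x => tri u v x) e
  have e1 := congrArg (fun x => tri u w x) e
  have e2 := congrArg (fun x => tri v w x) e
  simp only [tri_add_right, tri_sub_right, tri_smul_right, tri_self_outer, tri_self_right,
    tri_swap_right u v w, tri_cycle u v w, mul_zero, sub_zero, add_zero, zero_sub, zero_add,
    mul_neg, neg_neg] at e0 e1 e2
  exact ⟨mul_right_cancel₀ h e0, mul_right_cancel₀ h e1, mul_right_cancel₀ h e2⟩

namespace PathSystem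

variable {k : ℕ} {v : ℕ → ℤ → Vec}

/-- One step of the normalization: if level `j` is normalized, then so is level `j + 1`. -/
theorem normalize_succ (h : PathSystem k v) {j : ℕ} (hj : j < k) {w : ℤ → Vec} {b c : ℤ → ℝ}
    (hw : ∀ q, ∃ t : ℝ, 0 < t ∧ w q = t • v j q)
    (hb : ∀ q, 0 < b q)
    (hrec : ∀ q, w q = w (q - 1) - b q • w (q - 2) + c q • w (q - 3)) :
    (∀ q, ∃ t : ℝ, 0 < t ∧ w q + b q • w (q - 2) = t • v (j + 1) q) ∧
    ∀ q, c q < b (q - 1) := by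
  choose t ht e using hw
  have hΔ : ∀ q, 0 < tri (w (q - 2)) (w (q - 1)) (w q) := by
    intro q
    have h1 := ht q
    have h2 := ht (q - 1)
    have h3 := ht (q - 2)
    have h4 := h.indep j hj q
    rw [e q, e (q - 1), e (q - 2)]
    simp only [tri_smul_left, tri_smul_mid, tri_smul_right]
    positivity
  have hv : ∀ q, v j q = (t q)⁻¹ • w q := fun q => by rw [e, inv_smul_smul₀ (ht q).ne']
  have key : ∀ q, ∃ s : ℝ, 0 < s ∧ w q + b q • w (q - 2) = s • v (j + 1) q := by
    intro q
    obtain ⟨γ, δ, hγ, hδ, e1⟩ := h.diag j hj q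
    obtain ⟨γ', δ', hγ', hδ', e2⟩ := h.diag' hj q
    have h1 := ht q
    refine ⟨t q / γ, by positivity, ?_⟩
    have e3 : b q • w (q - 2) - (t q / γ * δ * (t (q - 2))⁻¹) • w (q - 2) =
        (1 - t q / γ * γ' * (t (q - 1))⁻¹) • w (q - 1) +
        (c q - t q / γ * δ' * (t (q - 3))⁻¹) • w (q - 3) := by
      have e4 : w q + b q • w (q - 2) = w (q - 1) + c q • w (q - 3) := by
        rw [hrec q]; abel
      have e5 : (t q / γ) • v (j + 1) q = w q + (t q / γ * δ * (t (q - 2))⁻¹) • w (q - 2) := by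
        rw [e1, hv q, hv (q - 2)]
        simp only [smul_add, smul_smul]
        congr 2
        · have : t q / γ * (γ * (t q)⁻¹) = 1 := by field_simp
          rw [this, one_smul]
        · ring
      have e6 : (t q / γ) • v (j + 1) q = (t q / γ * γ' * (t (q - 1))⁻¹) • w (q - 1) +
          (t q / γ * δ' * (t (q - 3))⁻¹) • w (q - 3) := by
        rw [e2, hv (q - 1), hv (q - 3)]
        simp only [smul_add, smul_smul]
        congr 2 <;> ring
      calc _ = (w q + b q • w (q - 2)) - (t q / γ) • v (j + 1) q := by rw [e5]; abel
        _ = _ := by rw [e4, e6]; module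
    -- Pairing with the line through `w (q - 3)` and `w (q - 1)` kills the right side and leaves an
    -- equation for the coefficient of `w (q - 2)`.
    have e7 := congrArg (fun x => tri (w (q - 3)) (w (q - 1)) x) e3
    simp only [tri_add_right, tri_sub_right, tri_smul_right, tri_self_outer, tri_self_right,
      mul_zero, add_zero] at e7
    have h3 := hΔ (q - 1)
    rw [show q - 1 - 2 = q - 3 by ring, show q - 1 - 1 = q - 2 by ring] at h3
    rw [tri_swap_right (w (q - 3)) (w (q - 2)) (w (q - 1)), ← sub_mul] at e7
    have e8 : b q = t q / γ * δ * (t (q - 2))⁻¹ := by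
      rcases mul_eq_zero.1 e7 with h0 | h0
      · linarith
      · exact absurd (neg_eq_zero.1 h0) h3.ne'
    rw [e1, hv q, hv (q - 2), e8]
    simp only [smul_add, smul_smul]
    have : t q / γ * (γ * (t q)⁻¹) = 1 := by field_simp
    rw [this, one_smul, mul_assoc]
  refine ⟨key, fun q => ?_⟩
  obtain ⟨α, β, hα, hβ, e1⟩ := h.cut j hj (q - 1)
  rw [sub_add_cancel] at e1
  obtain ⟨s, hs, e2⟩ := key q
  obtain ⟨s', hs', e3⟩ := key (q - 1)
  have h1 := ht (q - 1)
  have e4 : w (q - 1) + c q • w (q - 3) =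
      (s * α / s' + s * β / t (q - 1)) • w (q - 1) +
        (s * α / s' * b (q - 1)) • w (q - 3) := by
    have : w (q - 1) + c q • w (q - 3) = w q + b q • w (q - 2) := by rw [hrec q]; abel
    rw [this, e2, e1]
    have e5 : v (j + 1) (q - 1) = s'⁻¹ • (w (q - 1) + b (q - 1) • w (q - 3)) := by
      rw [show q - 3 = q - 1 - 2 by ring, e3, inv_smul_smul₀ hs'.ne']
    rw [e5, hv (q - 1)]
    module
  have h3 := hΔ (q - 1)
  rw [show q - 1 - 2 = q - 3 by ring, show q - 1 - 1 = q - 2 by ring] at h3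
  have e5 : (1 : ℝ) • w (q - 1) - (0 : ℝ) • w (q - 2) + c q • w (q - 3) =
      (s * α / s' + s * β / t (q - 1)) • w (q - 1) - (0 : ℝ) • w (q - 2) +
        (s * α / s' * b (q - 1)) • w (q - 3) := by
    rw [one_smul, zero_smul, sub_zero, sub_zero, e4]
  obtain ⟨f1, -, f3⟩ := recurrence_unique h3.ne' e5
  have hB : 0 < s * β / t (q - 1) := by positivity
  rw [f3, show s * α / s' = 1 - s * β / t (q - 1) by linarith]
  nlinarith [hb (q - 1)]

/-- The normalization of the homogeneous coordinates. -/
theorem exists_normalized (h : PathSystem k v) (hk : 1 ≤ k) {m : ℕ}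
    (hret : ∀ q, ∃ t : ℝ, 0 < t ∧ v k q = t • v 0 (q + m)) :
    ∃ (w : ℕ → ℤ → Vec) (b c : ℕ → ℤ → ℝ) (μ : ℝ), NormalizedSystem k m w b c μ ∧
      ∀ j ≤ k, ∀ q, ∃ t : ℝ, 0 < t ∧ w j q = t • v j q := by
  choose a b c ha hb hc e using fun q => h.recurrence (show 0 < k from hk) q
  -- The scale `l` is chosen so that `l q * a q = l (q - 1)`, which turns the first coefficient into
  -- `1`.
  obtain ⟨l, hl, el⟩ := exists_int_prod (fun q => (a q)⁻¹) (fun q => inv_pos.2 (ha q))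
  set w : ℤ → Vec := fun q => l q • v 0 q with hw
  set B : ℤ → ℝ := fun q => l q * b q / l (q - 2) with hB
  set C : ℤ → ℝ := fun q => l q * c q / l (q - 3) with hC
  have hBp : ∀ q, 0 < B q := fun q => by
    have := hb q; have := hl q; have := hl (q - 2); positivity
  have hCp : ∀ q, 0 < C q := fun q => by
    have := hc q; have := hl q; have := hl (q - 3); positivity
  have hrec : ∀ q, w q = w (q - 1) - B q • w (q - 2) + C q • w (q - 3) := by
    intro q
    have h1 := el (q - 1)
    rw [sub_add_cancel] at h1
    have h2 := (hl (q - 2)).ne'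
    have h3 := (hl (q - 3)).ne'
    have h4 := (ha q).ne'
    have e1 : l q * a q = l (q - 1) := by rw [h1]; field_simp
    have e2 : B q * l (q - 2) = l q * b q := by simp only [hB]; field_simp
    have e3 : C q * l (q - 3) = l q * c q := by simp only [hC]; field_simp
    simp only [hw, smul_smul, e2, e3, ← e1]
    conv_lhs => rw [e q]
    module
  have main : ∀ j ≤ k, (∀ q, ∃ t : ℝ, 0 < t ∧ lev w B C j q = t • v j q) ∧
      (∀ q, 0 < (coef B C j).1 q) ∧ (∀ q, 0 < (coef B C j).2 q) ∧
      ∀ q, lev w B C j q = lev w B C j (q - 1) - (coef B C j).1 q • lev w B C j (q - 2) +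
        (coef B C j).2 q • lev w B C j (q - 3) := by
    intro j
    induction j with
    | zero => exact fun _ => ⟨fun q => ⟨l q, hl q, rfl⟩, hBp, hCp, hrec⟩
    | succ j ih =>
      intro hj
      obtain ⟨i1, i2, i3, i4⟩ := ih (by omega)
      obtain ⟨n1, n2⟩ := h.normalize_succ (show j < k by omega) i1 i2 i4
      have hD : ∀ q, 0 < (coef B C j).1 (q - 1) - (coef B C j).2 q := fun q =>
        sub_pos.2 (n2 q)
      refine ⟨n1, fun q => ?_, fun q => ?_, fun q => ?_⟩
      · exact mul_pos (div_pos (hD q) (hD (q - 2))) (i2 _)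
      · exact mul_pos (div_pos (hD q) (hD (q - 2))) (i3 _)
      · have r0 := i4 q
        have r2 := i4 (q - 2)
        simp only [show q - 2 - 1 = q - 3 by ring, show q - 2 - 2 = q - 4 by ring,
          show q - 2 - 3 = q - 5 by ring] at r2
        have d2 := (hD (q - 2)).ne'
        simp only [lev, coef, show q - 2 - 1 = q - 3 by ring, show q - 1 - 2 = q - 3 by ring,
          show q - 2 - 2 = q - 4 by ring, show q - 3 - 2 = q - 5 by ring] at d2 ⊢
        generalize lev w B C j q = w0 at *
        generalize lev w B C j (q - 1) = w1 at *
        generalize lev w B C j (q - 2) = w2 at *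
        generalize lev w B C j (q - 3) = w3 at *
        generalize lev w B C j (q - 4) = w4 at *
        generalize lev w B C j (q - 5) = w5 at *
        subst r0
        subst r2
        ext i
        simp only [Pi.add_apply, Pi.sub_apply, Pi.smul_apply, smul_eq_mul]
        field_simp
        ring
  have hlt : ∀ j < k, ∀ q, (coef B C j).2 q < (coef B C j).1 (q - 1) := fun j hj =>
    (h.normalize_succ hj (main j hj.le).1 (main j hj.le).2.1 (main j hj.le).2.2.2).2
  have hret' : ∀ q, ∃ t : ℝ, 0 < t ∧ lev w B C k q = t • w (q + m) := by
    intro q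
    obtain ⟨t, ht, e1⟩ := (main k le_rfl).1 q
    obtain ⟨s, hs, e2⟩ := hret q
    have := hl (q + m)
    refine ⟨t * s / l (q + m), by positivity, ?_⟩
    rw [e1, e2, hw]
    simp only [smul_smul]
    congr 1
    field_simp
  choose M hM eM using hret'
  have hΔ : ∀ q, 0 < tri (w (q - 2)) (w (q - 1)) (w q) := by
    intro q
    have h1 := hl q
    have h2 := hl (q - 1)
    have h3 := hl (q - 2)
    have h4 := h.indep 0 hk q
    simp only [hw, tri_smul_left, tri_smul_mid, tri_smul_right]
    positivity
  -- Level `k` and the shifted level `0` trace the same points and both have first coefficient `1`.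
  -- Uniqueness of the recurrence forces the factor `M` to be constant and the coefficients to
  -- agree.
  have hcomp : ∀ q, M (q + 1) = M q ∧ (coef B C k).1 q = M q * B (q + m) / M (q - 2) ∧
      (coef B C k).2 q = M q * C (q + m) / M (q - 3) := by
    intro q
    have aux : ∀ q, M (q - 1) = M q ∧ (coef B C k).1 q * M (q - 2) = M q * B (q + m) ∧
        (coef B C k).2 q * M (q - 3) = M q * C (q + m) := by
      intro q
      have e1 := (main k le_rfl).2.2.2 q
      have h3 := hΔ (q + m - 1)
      have e2 := hrec (q + m)
      rw [show q + m - 1 - 2 = q + m - 3 by ring, show q + m - 1 - 1 = q + m - 2 by ring] at h3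
      rw [eM, eM, eM, eM, e2, show q - 1 + m = q + m - 1 by ring,
        show q - 2 + m = q + m - 2 by ring, show q - 3 + m = q + m - 3 by ring] at e1
      have e3 : M (q - 1) • w (q + m - 1) - ((coef B C k).1 q * M (q - 2)) • w (q + m - 2) +
          ((coef B C k).2 q * M (q - 3)) • w (q + m - 3) = M q • w (q + m - 1) -
          (M q * B (q + m)) • w (q + m - 2) + (M q * C (q + m)) • w (q + m - 3) := by
        rw [← smul_smul, ← smul_smul, ← e1]
        module
      exact recurrence_unique h3.ne' e3
    have a1 := (aux (q + 1)).1
    rw [add_sub_cancel_right] at a1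
    obtain ⟨-, a2, a3⟩ := aux q
    exact ⟨a1.symm, eq_div_of_mul_eq (hM _).ne' a2, eq_div_of_mul_eq (hM _).ne' a3⟩
  have hconst := eq_zero_of_int_succ fun q => (hcomp q).1
  refine ⟨lev w B C, fun j => (coef B C j).1, fun j => (coef B C j).2, M 0,
    ⟨fun j hj => (main j hj).2.2.2, fun _ _ _ => rfl, fun j hj => (main j hj).2.1,
    fun j hj => (main j hj).2.2.1, hlt, fun j hj q => ?_, fun j hj q => ?_, hM 0, fun q => ?_,
    fun q => ?_, fun q => ?_⟩, fun j hj => (main j hj).1⟩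
  · simp only [coef, show q - 2 - 1 = q - 3 by ring]
  · simp only [coef, show q - 2 - 1 = q - 3 by ring]
  · rw [eM, hconst]; rfl
  · have := (hM 0).ne'
    rw [(hcomp q).2.1, hconst q, hconst (q - 2)]
    simp only [coef]
    field_simp
  · have := (hM 0).ne'
    rw [(hcomp q).2.2, hconst q, hconst (q - 3)]
    simp only [coef]
    field_simp

end PathSystem


/-! ### Corner invariants and conserved products -/

theorem prod_le_of_mem {ι : Type*} {s : Finset ι} {f : ι → ℝ} (h0 : ∀ i ∈ s, 0 < f i)
    (h1 : ∀ i ∈ s, f i ≤ 1) {i : ι} (hi : i ∈ s) : ∏ j ∈ s, f j ≤ f i := by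
  classical
  rw [← Finset.mul_prod_erase s f hi]
  refine mul_le_of_le_one_right (h0 i hi).le (Finset.prod_le_one ?_ ?_)
  · exact fun j hj => (h0 j (Finset.mem_of_mem_erase hj)).le
  · exact fun j hj => h1 j (Finset.mem_of_mem_erase hj)

theorem prod_range_shift (x : ℤ → ℝ) (N : ℕ) (r : ℤ) :
    (∏ t ∈ Finset.range N, x (r + 1 + t)) * x r = (∏ t ∈ Finset.range N, x (r + t)) * x (r + N) := by
  rw [← Finset.prod_range_succ (fun t : ℕ => x (r + t)), Finset.prod_range_succ']
  simp only [Nat.cast_succ, Nat.cast_zero, add_zero]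
  congr 1
  exact Finset.prod_congr rfl fun t _ => by rw [add_assoc, add_comm (1 : ℤ)]

theorem exists_uniform_lower_bound {k : ℕ} {p : ℕ → ℝ → Prop}
    (hmono : ∀ j x y, x ≤ y → p j y → p j x) (h : ∀ j < k, ∃ x > 0, p j x) :
    ∃ x > 0, ∀ j < k, p j x := by
  induction k with
  | zero => exact ⟨1, one_pos, fun j hj => absurd hj (Nat.not_lt_zero j)⟩
  | succ k ih =>
    obtain ⟨x, hx, hx'⟩ := ih fun j hj => h j (by omega)
    obtain ⟨y, hy, hy'⟩ := h k (by omega)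
    refine ⟨min x y, lt_min hx hy, fun j hj => ?_⟩
    rcases (Nat.lt_succ_iff.1 hj).eq_or_lt with rfl | hj
    · exact hmono _ _ _ (min_le_right _ _) hy'
    · exact hmono _ _ _ (min_le_left _ _) (hx' j hj)

/-- The dynamics of the corner invariants `x`, `y` under the pentagram map,
with `z = 1 - x y`. If they return after `k` steps and do not exceed `1`, then they
are bounded away from `0`, because of the first integrals `∏ x` and `∏ y`. -/
theorem corner_invariants_bounded {k m : ℕ} {x y z : ℕ → ℤ → ℝ} (hk : 1 ≤ k)
    (hx : ∀ j ≤ k, ∀ q, 0 < x j q) (hy : ∀ j ≤ k, ∀ q, 0 < y j q) (hz : ∀ j < k, ∀ q, 0 < z j q)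
    (hzxy : ∀ j < k, ∀ q, z j q = 1 - x j q * y j q)
    (hx1 : ∀ q, x 0 q ≤ 1) (hy1 : ∀ q, y 0 q ≤ 1)
    (hxn : ∀ j < k, ∀ q, x (j + 1) q * z j (q - 1) = x j (q - 2) * z j (q - 3))
    (hyn : ∀ j < k, ∀ q, y (j + 1) q * z j (q - 2) = y j (q - 1) * z j q)
    (hxr : ∀ q, x k q = x 0 (q + m)) (hyr : ∀ q, y k q = y 0 (q + m)) :
    ∃ ε > 0, ∀ j < k, ∀ q, ε ≤ z j q ∧ ε ≤ 1 - z j q := by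
  have hz1 : ∀ j < k, ∀ q, z j q ≤ 1 := fun j hj q => by
    have := mul_pos (hx j hj.le q) (hy j hj.le q)
    rw [hzxy j hj]; linarith
  -- The slopes `2` and `1` of these products match the label shifts `q - 2` and `q - 1` in the
  -- recursions for `x` and `y`.
  set ζ : ℤ → ℝ := fun r => ∏ i ∈ Finset.range k, z i (r + 2 * i) with hζ
  set η : ℤ → ℝ := fun r => ∏ i ∈ Finset.range k, z i (r + i) with hη
  have hζp : ∀ r, 0 < ζ r := fun r => Finset.prod_pos fun i hi => hz i (Finset.mem_range.1 hi) _
  have hηp : ∀ r, 0 < η r := fun r => Finset.prod_pos fun i hi => hz i (Finset.mem_range.1 hi) _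
  have hζ1 : ∀ r, ζ r ≤ 1 := fun r => Finset.prod_le_one
    (fun i hi => (hz i (Finset.mem_range.1 hi) _).le) fun i hi => hz1 i (Finset.mem_range.1 hi) _
  have hζz : ∀ j < k, ∀ q, ζ (q - 2 * j) ≤ z j q := fun j hj q => by
    have := prod_le_of_mem (f := fun i : ℕ => z i (q - 2 * j + 2 * i))
      (fun i hi => hz i (Finset.mem_range.1 hi) _)
      (fun i hi => hz1 i (Finset.mem_range.1 hi) _) (Finset.mem_range.2 hj)
    simpa using this
  -- The recursion telescopes. At `j = k` the return condition makes it `x 0 (r + N) * ζ (r + 1) = x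
  -- 0 r * ζ (r - 1)` with `N = 2k + m`.
  have hxs : ∀ j ≤ k, ∀ r, x j (r + 2 * j) * ∏ i ∈ Finset.range j, z i (r + 1 + 2 * i) =
      x 0 r * ∏ i ∈ Finset.range j, z i (r - 1 + 2 * i) := by
    intro j
    induction j with
    | zero => intro _ r; simp
    | succ j ih =>
      intro hj r
      have h1 := hxn j (by omega) (r + 2 * (j + 1 : ℕ))
      have h2 := ih (by omega) r
      push_cast at h1 ⊢
      rw [show r + 2 * ((j : ℤ) + 1) - 1 = r + 1 + 2 * j by ring,
        show r + 2 * ((j : ℤ) + 1) - 2 = r + 2 * j by ring,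
        show r + 2 * ((j : ℤ) + 1) - 3 = r - 1 + 2 * j by ring] at h1
      rw [Finset.prod_range_succ, Finset.prod_range_succ, ← mul_assoc (x 0 r), ← h2]
      linear_combination (∏ i ∈ Finset.range j, z i (r + 1 + 2 * i)) * h1
  have hys : ∀ j ≤ k, ∀ r, y j (r + j) * ∏ i ∈ Finset.range j, z i (r - 1 + i) =
      y 0 r * ∏ i ∈ Finset.range j, z i (r + 1 + i) := by
    intro j
    induction j with
    | zero => intro _ r; simp
    | succ j ih =>
      intro hj r
      have h1 := hyn j (by omega) (r + (j + 1 : ℕ))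
      have h2 := ih (by omega) r
      push_cast at h1 ⊢
      rw [show r + ((j : ℤ) + 1) - 1 = r + j by ring,
        show r + ((j : ℤ) + 1) - 2 = r - 1 + j by ring,
        show r + ((j : ℤ) + 1) = r + 1 + j by ring] at h1
      rw [Finset.prod_range_succ, Finset.prod_range_succ, ← mul_assoc (y 0 r), ← h2,
        show r + ((j : ℤ) + 1) = r + 1 + j by ring]
      linear_combination (∏ i ∈ Finset.range j, z i (r - 1 + i)) * h1
  set N : ℕ := 2 * k + m with hN
  set N' : ℕ := k + m with hN'
  have hXp : ∀ r : ℤ, 0 < ∏ t ∈ Finset.range N, x 0 (r + t) := fun r =>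
    Finset.prod_pos fun t _ => hx 0 (Nat.zero_le k) _
  have hYp : ∀ r : ℤ, 0 < ∏ t ∈ Finset.range N', y 0 (r + t) := fun r =>
    Finset.prod_pos fun t _ => hy 0 (Nat.zero_le k) _
  -- Moving the window by one replaces `x 0 r` by `x 0 (r + N)` and `ζ (r - 1)` by `ζ (r + 1)`,
  -- which cancels by the telescoped identity. For `y` the `z`-products go into the denominator.
  have hF : ∀ r, (∏ t ∈ Finset.range N, x 0 (r + t)) * (ζ (r - 1) * ζ r) =
      (∏ t ∈ Finset.range N, x 0 ((0 : ℤ) + t)) * (ζ (0 - 1) * ζ 0) := by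
    refine eq_zero_of_int_succ fun r => ?_
    have h1 := hxs k le_rfl r
    rw [hxr, show r + 2 * (k : ℤ) + m = r + N by push_cast [hN]; ring] at h1
    have h2 := prod_range_shift (x 0) N r
    refine mul_right_cancel₀ (hx 0 (Nat.zero_le k) r).ne' ?_
    rw [add_sub_cancel_right]
    calc _ = ((∏ t ∈ Finset.range N, x 0 (r + 1 + t)) * x 0 r) * (ζ r * ζ (r + 1)) := by ring
      _ = (∏ t ∈ Finset.range N, x 0 (r + t)) * ζ r * (x 0 (r + N) * ζ (r + 1)) := by rw [h2]; ring
      _ = _ := by rw [h1]; ring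
  have hG : ∀ r, (∏ t ∈ Finset.range N', y 0 (r + t)) / (η (r - 1) * η r) =
      (∏ t ∈ Finset.range N', y 0 ((0 : ℤ) + t)) / (η (0 - 1) * η 0) := by
    refine eq_zero_of_int_succ fun r => ?_
    have h1 := hys k le_rfl r
    rw [hyr, show r + (k : ℤ) + m = r + N' by push_cast [hN']; ring] at h1
    have h2 := prod_range_shift (y 0) N' r
    have e1 := hηp r
    have e2 := hηp (r + 1)
    have e3 := hηp (r - 1)
    rw [add_sub_cancel_right, div_eq_div_iff (by positivity) (by positivity)]
    refine mul_right_cancel₀ (hy 0 (Nat.zero_le k) r).ne' ?_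
    calc _ = ((∏ t ∈ Finset.range N', y 0 (r + 1 + t)) * y 0 r) * (η (r - 1) * η r) := by ring
      _ = (∏ t ∈ Finset.range N', y 0 (r + t)) * η r * (y 0 (r + N') * η (r - 1)) := by
        rw [h2]; ring
      _ = _ := by rw [h1]; ring
  set F := (∏ t ∈ Finset.range N, x 0 ((0 : ℤ) + t)) * (ζ (0 - 1) * ζ 0) with hFdef
  set G := (∏ t ∈ Finset.range N', y 0 ((0 : ℤ) + t)) / (η (0 - 1) * η 0) with hGdef
  have hF0 : 0 < F := mul_pos (hXp 0) (mul_pos (hζp _) (hζp _))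
  have hG0 : 0 < G := div_pos (hYp 0) (mul_pos (hηp _) (hηp _))
  have hXle : ∀ r : ℤ, ∏ t ∈ Finset.range N, x 0 (r + t) ≤ 1 := fun r => Finset.prod_le_one
    (fun t _ => (hx 0 (Nat.zero_le k) _).le) fun t _ => hx1 _
  -- All factors of the conserved product `F` are at most `1`, so each of them is at least `F`.
  have hζF : ∀ r, F ≤ ζ r := fun r => by
    rw [← hF r, ← mul_assoc]
    exact mul_le_of_le_one_left (hζp r).le
      (mul_le_one₀ (hXle r) (hζp _).le (hζ1 _))
  have hzF : ∀ j < k, ∀ q, F ≤ z j q := fun j hj q => (hζF _).trans (hζz j hj q)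
  have hxF : ∀ q, F ≤ x 0 q := fun q => by
    have h1 := prod_le_of_mem (s := Finset.range N) (f := fun t : ℕ => x 0 (q + t))
      (fun t _ => hx 0 (Nat.zero_le k) _) (fun t _ => hx1 _) (Finset.mem_range.2 (by omega : 0 < N))
    simp only [Nat.cast_zero, add_zero] at h1
    rw [← hF q]
    refine le_trans ?_ h1
    exact mul_le_of_le_one_right (hXp q).le (mul_le_one₀ (hζ1 _) (hζp _).le (hζ1 _))
  have hηF : ∀ r, F ^ k ≤ η r := fun r => by
    have := Finset.prod_le_prod (s := Finset.range k) (f := fun _ => F)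
      (g := fun i : ℕ => z i (r + i)) (fun _ _ => hF0.le)
      fun i hi => hzF i (Finset.mem_range.1 hi) _
    simpa using this
  -- The second conserved quantity is a quotient, so it bounds `y` from below only after `η` has
  -- been bounded below through `F`.
  have hyG : ∀ q, G * (F ^ k * F ^ k) ≤ y 0 q := fun q => by
    have h1 := prod_le_of_mem (s := Finset.range N') (f := fun t : ℕ => y 0 (q + t))
      (fun t _ => hy 0 (Nat.zero_le k) _) (fun t _ => hy1 _)
      (Finset.mem_range.2 (by omega : 0 < N'))
    simp only [Nat.cast_zero, add_zero] at h1
    refine le_trans ?_ h1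
    have e1 := hηp q
    have e2 := hηp (q - 1)
    rw [← hG q, div_mul_eq_mul_div, div_le_iff₀ (by positivity)]
    refine mul_le_mul_of_nonneg_left ?_ (hYp q).le
    exact mul_le_mul (hηF _) (hηF _) (by positivity) e2.le
  have hxj : ∀ j ≤ k, ∃ c > 0, ∀ q, c ≤ x j q := by
    intro j
    induction j with
    | zero => exact fun _ => ⟨F, hF0, hxF⟩
    | succ j ih =>
      intro hj
      obtain ⟨c, hc, hc'⟩ := ih (by omega)
      refine ⟨c * F, by positivity, fun q => ?_⟩
      have h1 := hxn j (by omega) q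
      calc c * F ≤ x j (q - 2) * z j (q - 3) :=
            mul_le_mul (hc' _) (hzF j (by omega) _) hF0.le (hc.le.trans (hc' _))
        _ = x (j + 1) q * z j (q - 1) := h1.symm
        _ ≤ x (j + 1) q := mul_le_of_le_one_right (hx _ hj _).le (hz1 j (by omega) _)
  have hyj : ∀ j ≤ k, ∃ c > 0, ∀ q, c ≤ y j q := by
    intro j
    induction j with
    | zero => exact fun _ => ⟨_, by positivity, hyG⟩
    | succ j ih =>
      intro hj
      obtain ⟨c, hc, hc'⟩ := ih (by omega)
      refine ⟨c * F, by positivity, fun q => ?_⟩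
      have h1 := hyn j (by omega) q
      calc c * F ≤ y j (q - 1) * z j q :=
            mul_le_mul (hc' _) (hzF j (by omega) _) hF0.le (hc.le.trans (hc' _))
        _ = y (j + 1) q * z j (q - 2) := h1.symm
        _ ≤ y (j + 1) q := mul_le_of_le_one_right (hy _ hj _).le (hz1 j (by omega) _)
  refine exists_uniform_lower_bound (p := fun j ε => ∀ q, ε ≤ z j q ∧ ε ≤ 1 - z j q)
    (fun j x y hxy h q => ⟨hxy.trans (h q).1, hxy.trans (h q).2⟩) fun j hj => ?_
  obtain ⟨c, hc, hc'⟩ := hxj j hj.le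
  obtain ⟨d, hd, hd'⟩ := hyj j hj.le
  refine ⟨min F (c * d), by positivity, fun q => ⟨(min_le_left _ _).trans (hzF j hj q), ?_⟩⟩
  rw [hzxy j hj, sub_sub_cancel]
  exact (min_le_right _ _).trans (mul_le_mul (hc' q) (hd' q) hd.le (hc.le.trans (hc' q)))

namespace NormalizedSystem

variable {k m : ℕ} {v : ℕ → ℤ → Vec} {b c : ℕ → ℤ → ℝ} {μ : ℝ}

/-- The two weights add up to `1`; they are `1 - z` and `z` at the label `q + 1`, which is why
bounds on `z` control the cuts. -/
theorem cut_eq (h : NormalizedSystem k m v b c μ) {j : ℕ} (hj : j < k) (q : ℤ) :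
    v (j + 1) (q + 1) = (c j (q + 1) / b j q) • v (j + 1) q +
      ((b j q - c j (q + 1)) / b j q) • v j q := by
  have h1 := (h.b_pos j hj.le q).ne'
  have h2 := h.recur j hj.le (q + 1)
  rw [h.next j hj (q + 1), h.next j hj q, h2, add_sub_cancel_right,
    show q + 1 - 2 = q - 1 by ring, show q + 1 - 3 = q - 2 by ring]
  ext i
  simp only [Pi.add_apply, Pi.sub_apply, Pi.smul_apply, smul_eq_mul]
  field_simp
  ring

/-- Expanding by the recurrence, the determinants in `hy` and `hx` are `1 - b q` and `b q * b (q -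
1) - c q` times a positive determinant, so they say `y ≤ 1` and `x ≤ 1` at level `0`. The rational
formulas for `b` and `c` become the product recursions required by `corner_invariants_bounded`. -/
theorem cut_bounds (h : NormalizedSystem k m v b c μ) (hk : 1 ≤ k)
    (hpos : ∀ q, 0 < tri (v 0 (q - 2)) (v 0 (q - 1)) (v 0 q))
    (hy : ∀ q, 0 ≤ tri (v 0 (q - 4)) (v 0 (q - 3)) (v 0 q))
    (hx : ∀ q, 0 ≤ tri (v 0 (q - 4)) (v 0 (q - 1)) (v 0 q)) :
    ∃ ε > 0, ∀ j < k, ∀ q, ε ≤ c j (q + 1) / b j q ∧ ε ≤ (b j q - c j (q + 1)) / b j q := by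
  have hrec : ∀ q, v 0 q = v 0 (q - 1) - b 0 q • v 0 (q - 2) + c 0 q • v 0 (q - 3) :=
    h.recur 0 (Nat.zero_le k)
  have hrec1 : ∀ q, v 0 (q - 1) = v 0 (q - 2) - b 0 (q - 1) • v 0 (q - 3) +
      c 0 (q - 1) • v 0 (q - 4) := fun q => by
    have := hrec (q - 1)
    rwa [show q - 1 - 1 = q - 2 by ring, show q - 1 - 2 = q - 3 by ring,
      show q - 1 - 3 = q - 4 by ring] at this
  have hpos' : ∀ q, 0 < tri (v 0 (q - 4)) (v 0 (q - 3)) (v 0 (q - 2)) := fun q => by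
    have := hpos (q - 2)
    rwa [show q - 2 - 2 = q - 4 by ring, show q - 2 - 1 = q - 3 by ring] at this
  have hb1 : ∀ q, b 0 q ≤ 1 := by
    intro q
    have e : tri (v 0 (q - 4)) (v 0 (q - 3)) (v 0 q) =
        (1 - b 0 q) * tri (v 0 (q - 4)) (v 0 (q - 3)) (v 0 (q - 2)) := by
      rw [hrec q, hrec1 q]
      simp only [tri_add_right, tri_sub_right, tri_smul_right, tri_self_right, tri_self_outer]
      ring
    have h1 := hy q
    rw [e] at h1
    linarith [nonneg_of_mul_nonneg_left h1 (hpos' q)]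
  have hc1 : ∀ q, c 0 q ≤ b 0 q * b 0 (q - 1) := by
    intro q
    have e : tri (v 0 (q - 4)) (v 0 (q - 1)) (v 0 q) =
        (b 0 q * b 0 (q - 1) - c 0 q) * tri (v 0 (q - 4)) (v 0 (q - 3)) (v 0 (q - 2)) := by
      rw [hrec q, hrec1 q]
      simp only [tri, Pi.add_apply, Pi.sub_apply, Pi.smul_apply, smul_eq_mul]
      ring
    have h1 := hx q
    rw [e] at h1
    linarith [nonneg_of_mul_nonneg_left h1 (hpos' q)]
  have hD : ∀ j < k, ∀ q, 0 < b j (q - 1) - c j q := fun j hj q => sub_pos.2 (h.c_lt j hj q)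
  obtain ⟨ε, hε, hε'⟩ := corner_invariants_bounded (m := m)
    (x := fun j q => c j q / (b j q * b j (q - 1))) (y := b)
    (z := fun j q => (b j (q - 1) - c j q) / b j (q - 1)) hk
    (fun j hj q => div_pos (h.c_pos j hj q) (mul_pos (h.b_pos j hj q) (h.b_pos j hj _)))
    h.b_pos (fun j hj q => div_pos (hD j hj q) (h.b_pos j hj.le _))
    (fun j hj q => by
      have h1 := (h.b_pos j hj.le q).ne'
      have h2 := (h.b_pos j hj.le (q - 1)).ne'
      field_simp)
    (fun q => (div_le_one (mul_pos (h.b_pos 0 (Nat.zero_le k) q)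
      (h.b_pos 0 (Nat.zero_le k) _))).2 (hc1 q)) hb1
    (fun j hj q => by
      have h1 := (h.b_pos j hj.le (q - 2)).ne'
      have h2 := (h.b_pos j hj.le (q - 3)).ne'
      have h3 := (h.b_pos j hj.le (q - 4)).ne'
      have h4 := (hD j hj q).ne'
      have h5 := (hD j hj (q - 1)).ne'
      have h6 := (hD j hj (q - 2)).ne'
      have h7 := (hD j hj (q - 3)).ne'
      have e1 := h.b_next j hj (q - 1)
      simp only [show q - 1 - 1 = q - 2 by ring, show q - 1 - 3 = q - 4 by ring,
        show q - 1 - 2 = q - 3 by ring, show q - 2 - 1 = q - 3 by ring,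
        show q - 3 - 1 = q - 4 by ring] at e1 h5 h6 h7 ⊢
      rw [h.c_next j hj q, h.b_next j hj q, e1]
      field_simp)
    (fun j hj q => by
      have h2 := (h.b_pos j hj.le (q - 3)).ne'
      have h1 := (h.b_pos j hj.le (q - 1)).ne'
      have h6 := (hD j hj (q - 2)).ne'
      simp only [show q - 2 - 1 = q - 3 by ring] at h6 ⊢
      rw [h.b_next j hj q]
      field_simp)
    (fun q => by rw [h.c_return, h.b_return, h.b_return, show q - 1 + m = q + m - 1 by ring])
    h.b_return
  refine ⟨ε, hε, fun j hj q => ?_⟩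
  have h1 := (h.b_pos j hj.le q).ne'
  have h2 := hε' j hj (q + 1)
  simp only [add_sub_cancel_right] at h2
  refine ⟨h2.2.trans_eq ?_, h2.1⟩
  field_simp
  ring

end NormalizedSystem


/-! ### Uniform bounds for the steps of the polygons -/

namespace ConvexSpiral

variable {n k : ℕ} {a : ℤ → ℕ → Vec}

theorem congr (h : ConvexSpiral n k a) {A : ℤ → ℕ → Vec}
    (hA : ∀ q i, ∃ t : ℝ, 0 < t ∧ A q i = t • a q i) (hper : ∀ q i, A q (i + n) = A q i) :
    ConvexSpiral n k A := by
  choose t ht e using hA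
  have e' : ∀ q i, a q i = (t q i)⁻¹ • A q i := fun q i => by rw [e, inv_smul_smul₀ (ht q i).ne']
  refine ⟨h.four_le, h.one_le, h.lt, hper, fun q i j l hij hjl hl => ?_, fun q i => ?_,
    fun q i hi hin => ?_, fun q i hi => ?_, fun q i hi hin => ?_⟩
  · have h1 := h.pos q i j l hij hjl hl
    have h2 := ht q i
    have h3 := ht q j
    have h4 := ht q l
    rw [e, e, e]
    simp only [tri_smul_left, tri_smul_mid, tri_smul_right]
    positivity
  · obtain ⟨α, β, hα, hβ, e1⟩ := h.step q i
    have h1 := ht q i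
    have h2 := ht q (i + 1)
    have h3 := ht (q + 1) i
    refine ⟨t (q + 1) i * α * (t q i)⁻¹, t (q + 1) i * β * (t q (i + 1))⁻¹, by positivity,
      by positivity, ?_⟩
    rw [e (q + 1) i, e1, e' q i, e' q (i + 1)]
    module
  · obtain ⟨α, β, hα, hβ, e1⟩ := h.cut q i hi hin
    have h1 := ht q i
    have h2 := ht q (i + 1)
    have h3 := ht (q + 1) i
    refine ⟨t (q + 1) i * α * (t q i)⁻¹, t (q + 1) i * β * (t q (i + 1))⁻¹, by positivity,
      by positivity, ?_⟩
    rw [e (q + 1) i, e1, e' q i, e' q (i + 1)]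
    module
  · obtain ⟨β, hβ, e1⟩ := h.shift q i hi
    have h2 := ht q (i + 1)
    have h3 := ht (q + 1) i
    refine ⟨t (q + 1) i * β * (t q (i + 1))⁻¹, by positivity, ?_⟩
    rw [e (q + 1) i, e1, e' q (i + 1)]
    module
  · rw [e, e, e]
    simp only [tri_smul_left, tri_smul_mid, tri_smul_right, h.diag q i hi hin, mul_zero]

/-- Reading the polygons with a fixed vertex index and varying `q` gives the paths: index `n - j`
follows `T^j(P)`. -/
theorem pathSystem (h : ConvexSpiral n k a) : PathSystem k (fun j q => a q (n - j)) where
  cut j hj q := by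
    have hk := h.lt
    obtain ⟨α, β, hα, hβ, e⟩ := h.cut q (n - (j + 1)) (by omega) (by omega)
    rw [show n - (j + 1) + 1 = n - j by omega] at e
    exact ⟨α, β, hα, hβ, e⟩
  diag j hj q := by
    have hk := h.lt
    obtain ⟨-, γ, δ, hγ, hδ, e⟩ := h.diag_pos (q - 2) (i := n - (j + 1)) (by omega) (by omega)
    rw [show n - (j + 1) + 1 = n - j by omega, sub_add_cancel] at e
    exact ⟨γ, δ, hγ, hδ, e⟩
  indep j hj q := by
    have hk := h.lt
    have := (h.diag_pos (q - 2) (i := n - (j + 1)) (by omega) (by omega)).1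
    rwa [show n - (j + 1) + 1 = n - j by omega, sub_add_cancel,
      show q - 2 + 1 = q - 1 by ring] at this

theorem apply_self (h : ConvexSpiral n k a) (q : ℤ) : a q n = a q 0 := by
  simpa using h.periodic q 0

/-- In suitable homogeneous coordinates, each polygon of a spiral is obtained from the previous one
by uniformly bounded convex combinations. -/
theorem exists_bounded (h : ConvexSpiral n k a) :
    ∃ A : ℤ → ℕ → Vec, (∀ q i, ∃ t : ℝ, 0 < t ∧ A q i = t • a q i) ∧ ConvexSpiral n k A ∧
      ∃ ε K : ℝ, 0 < ε ∧ 0 < K ∧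
        (∀ q i, ∃ α β : ℝ, 0 ≤ α ∧ α ≤ K ∧ ε ≤ β ∧ β ≤ K ∧
          A (q + 1) i = α • A q i + β • A q (i + 1)) ∧
        ∀ q, ∃ α β : ℝ, ε ≤ α ∧ 0 ≤ β ∧
          A (q + 1) (n - 1) = α • A q (n - 1) + β • A q n := by
  have hk := h.lt
  have hk1 := h.one_le
  have hret : ∀ q, ∃ t : ℝ, 0 < t ∧ a q (n - k) = t • a (q + ((n - k : ℕ) : ℤ)) (n - 0) := by
    intro q
    obtain ⟨β, hβ, e⟩ := h.shift_iter (n - k) q le_rfl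
    refine ⟨β⁻¹, by positivity, ?_⟩
    rw [Nat.sub_zero, h.apply_self, e, inv_smul_smul₀ hβ.ne']
  obtain ⟨w, b, c, μ, hN, hw⟩ := h.pathSystem.exists_normalized h.one_le hret
  have hw0 : ∀ q, ∃ t : ℝ, 0 < t ∧ w 0 q = t • a q 0 := fun q => by
    have := hw 0 (Nat.zero_le k) q
    rwa [Nat.sub_zero, h.apply_self] at this
  have hbd := hN.cut_bounds h.one_le
    (fun q => by
      obtain ⟨t, ht, e⟩ := hw0 q
      obtain ⟨t1, ht1, e1⟩ := hw0 (q - 1)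
      obtain ⟨t2, ht2, e2⟩ := hw0 (q - 2)
      have := h.pathSystem.indep 0 h.one_le q
      simp only [Nat.sub_zero, h.apply_self] at this
      rw [e, e1, e2, tri_smul_left, tri_smul_mid, tri_smul_right]
      positivity)
    (fun q => by
      obtain ⟨t, ht, e⟩ := hw0 q
      obtain ⟨t1, ht1, e1⟩ := hw0 (q - 3)
      obtain ⟨t2, ht2, e2⟩ := hw0 (q - 4)
      have := h.tri_first_two_nonneg (q - 4) 4
      rw [show q - 4 + 1 = q - 3 by ring, show q - 4 + (4 : ℕ) = q by push_cast; ring] at this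
      rw [e, e1, e2, tri_smul_left, tri_smul_mid, tri_smul_right]
      positivity)
    (fun q => by
      obtain ⟨t, ht, e⟩ := hw0 q
      obtain ⟨t1, ht1, e1⟩ := hw0 (q - 1)
      obtain ⟨t2, ht2, e2⟩ := hw0 (q - 4)
      have := h.tri_last_two_nonneg (q - 4)
      rw [show q - 4 + 3 = q - 1 by ring, show q - 4 + 4 = q by ring] at this
      rw [e, e1, e2, tri_smul_left, tri_smul_mid, tri_smul_right]
      positivity)
  obtain ⟨ε, hε, hbd⟩ := hbd
  -- Vertices with index up to `n - k` lie on `P` itself and use level `0` at a later label; the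
  -- others use their own level. Level `k` is not used, so the factor `μ` enters only at index `n -
  -- k`.
  set A : ℤ → ℕ → Vec := fun q i =>
    if i % n ≤ n - k then w 0 (q + ((i % n : ℕ) : ℤ)) else w (n - i % n) q with hA
  have hper : ∀ q i, A q (i + n) = A q i := fun q i => by simp only [hA, Nat.add_mod_right]
  have hAlow : ∀ q i, i ≤ n - k → A q i = w 0 (q + i) := fun q i hi => by
    simp only [hA, Nat.mod_eq_of_lt (show i < n by omega), if_pos hi]
  have hAhigh : ∀ q i, n - k ≤ i → i < n → A q (i + 1) = w (n - (i + 1)) q := fun q i hi hin => by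
    rcases (Nat.succ_le_of_lt hin).eq_or_lt with h1 | h1
    · rw [Nat.succ_eq_add_one] at h1
      rw [h1, Nat.sub_self, ← Nat.zero_add n, hper, hAlow q 0 (Nat.zero_le _)]
      simp
    · simp only [hA, Nat.mod_eq_of_lt (show i + 1 < n by omega),
        if_neg (show ¬ i + 1 ≤ n - k by omega)]
  have hAa : ∀ q i, ∃ t : ℝ, 0 < t ∧ A q i = t • a q i := by
    intro q i
    rw [← h.apply_mod q i]
    have hi := h.mod_lt i
    by_cases him : i % n ≤ n - k
    · obtain ⟨t, ht, e⟩ := hw0 (q + ((i % n : ℕ) : ℤ))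
      obtain ⟨β, hβ, e1⟩ := h.shift_iter (i % n) q him
      refine ⟨t * β, by positivity, ?_⟩
      simp only [hA, if_pos him]
      rw [e, e1, smul_smul]
    · obtain ⟨t, ht, e⟩ := hw (n - i % n) (by omega) q
      refine ⟨t, ht, ?_⟩
      simp only [hA, if_neg him]
      rw [e, show n - (n - i % n) = i % n by omega]
  have hAS := h.congr hAa hper
  have hμ := hN.μ_pos
  have hsum : ∀ j < k, ∀ q, c j (q + 1) / b j q + (b j q - c j (q + 1)) / b j q = 1 :=
    fun j hj q => by
      have := (hN.b_pos j hj.le q).ne'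
      field_simp
      ring
  have hmax : ∀ i, n - k ≤ i → i < n → ∀ q, ∃ α β : ℝ, ε ≤ α ∧ α ≤ 1 ∧ min ε (ε / μ) ≤ β ∧
      β ≤ max 1 μ⁻¹ ∧ A (q + 1) i = α • A q i + β • A q (i + 1) := by
    intro i hi hin q
    rw [hAhigh q i hi hin]
    have hj : n - (i + 1) < k := by omega
    obtain ⟨h1, h2⟩ := hbd _ hj q
    have h3 := hsum _ hj q
    have h4 := hN.cut_eq hj q
    -- At the seam `i = n - k` the cut relation is written with level `k`. Converting to level `0`
    -- divides the second weight by `μ`.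
    rcases hi.eq_or_lt with rfl | hi
    · rw [show n - (n - k + 1) + 1 = k by omega, hN.return_eq, hN.return_eq] at h4
      refine ⟨_, μ⁻¹ * ((b (n - (n - k + 1)) q - c (n - (n - k + 1)) (q + 1)) /
        b (n - (n - k + 1)) q), h1, by linarith, (min_le_right _ _).trans ?_, ?_, ?_⟩
      · rw [div_eq_inv_mul]
        gcongr
      · refine le_trans ?_ (le_max_right _ _)
        exact mul_le_of_le_one_right (by positivity) (by linarith)
      · rw [hAlow _ _ le_rfl, hAlow _ _ le_rfl, ← inv_smul_smul₀ hμ.ne' (w 0 _), h4,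
          smul_add, mul_smul]
        congr 1
        rw [smul_comm, inv_smul_smul₀ hμ.ne']
    · obtain ⟨i, rfl⟩ : ∃ i', i = i' + 1 := ⟨i - 1, by omega⟩
      rw [hAhigh q i (by omega) (by omega), hAhigh (q + 1) i (by omega) (by omega)]
      rw [show n - (i + 1 + 1) + 1 = n - (i + 1) by omega] at h4
      exact ⟨_, _, h1, by linarith, (min_le_left _ _).trans h2,
        le_trans (by linarith) (le_max_left _ _), h4⟩
  -- The `1` in both constants covers the vertices that are only relabeled, with weights `0` and
  -- `1`; `ε / μ` and `μ⁻¹` cover the seam.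
  refine ⟨A, hAa, hAS, min 1 (min ε (ε / μ)), max 1 μ⁻¹, by positivity, by positivity,
    fun q i => ?_, fun q => ?_⟩
  · have key : ∀ i < n, ∃ α β : ℝ, 0 ≤ α ∧ α ≤ max 1 μ⁻¹ ∧ min 1 (min ε (ε / μ)) ≤ β ∧
        β ≤ max 1 μ⁻¹ ∧ A (q + 1) i = α • A q i + β • A q (i + 1) := by
      intro i hin
      rcases lt_or_ge i (n - k) with hi | hi
      · refine ⟨0, 1, le_rfl, by positivity, min_le_left _ _, le_max_left _ _, ?_⟩
        rw [hAlow _ i hi.le, hAlow _ (i + 1) hi, zero_smul, one_smul, zero_add]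
        congr 1
        push_cast
        ring
      · obtain ⟨α, β, h1, h2, h3, h4, e⟩ := hmax i hi hin q
        exact ⟨α, β, hε.le.trans h1, h2.trans (le_max_left _ _), (min_le_right _ _).trans h3,
          h4, e⟩
    obtain ⟨α, β, h1, h2, h3, h4, e⟩ := key (i % n) (h.mod_lt i)
    rw [hAS.apply_mod, hAS.apply_mod, ← hAS.apply_mod q (i % n + 1), Nat.mod_add_mod,
      hAS.apply_mod] at e
    exact ⟨α, β, h1, h2, h3, h4, e⟩
  · obtain ⟨α, β, h1, h2, h3, h4, e⟩ := hmax (n - 1) (by omega) (by omega) q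
    rw [show n - 1 + 1 = n by omega] at e
    exact ⟨α, β, ((min_le_right _ _).trans (min_le_left _ _)).trans h1,
      (by positivity : 0 ≤ min ε (ε / μ)).trans h3, e⟩

end ConvexSpiral

/-! ### Harnack inequality -/

/-- Functionals that are nonnegative on a polygon of the spiral satisfy a uniform Harnack
inequality on a later polygon. -/
def HarnackBound (n : ℕ) (a : ℤ → ℕ → Vec) (δ K : ℝ) : Prop :=
  ∀ (q : ℤ) (f : Vec →ₗ[ℝ] ℝ), (∀ i, 0 ≤ f (a q i)) → ∀ i,
    δ * ∑ l ∈ Finset.range n, f (a q l) ≤ f (a (q + 2 * n) i) ∧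
    f (a (q + 2 * n) i) ≤ K * ∑ l ∈ Finset.range n, f (a q l)

/-- Values of `f` propagate with a loss of at most `ε` per step from index `i + 1` to `i`, and may
wait at index `n - 1`, which always keeps a definite share of its value. Waiting makes all transfers
between indices take the same time `2n`. -/
theorem ConvexSpiral.harnack {n k : ℕ} {A : ℤ → ℕ → Vec} (h : ConvexSpiral n k A) {ε K : ℝ}
    (hε : 0 < ε) (hK : 0 < K)
    (hstep : ∀ q i, ∃ α β : ℝ, 0 ≤ α ∧ α ≤ K ∧ ε ≤ β ∧ β ≤ K ∧
      A (q + 1) i = α • A q i + β • A q (i + 1))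
    (hlast : ∀ q, ∃ α β : ℝ, ε ≤ α ∧ 0 ≤ β ∧
      A (q + 1) (n - 1) = α • A q (n - 1) + β • A q n) :
    ∃ δ K' : ℝ, 0 < δ ∧ 0 < K' ∧ HarnackBound n A δ K' := by
  have h4 := h.four_le
  refine ⟨ε ^ (2 * n) / n, (2 * K) ^ (2 * n), by positivity, by positivity, fun q f hf i => ?_⟩
  have hf' : ∀ t : ℕ, ∀ i, 0 ≤ f (A (q + t) i) := h.map_nonneg hf
  have hadd : ∀ s : ℕ, q + ((s + 1 : ℕ) : ℤ) = q + s + 1 := fun s => by push_cast; ring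
  have hmove : ∀ (t s : ℕ) (i : ℕ), ε ^ t * f (A (q + s) (i + t)) ≤ f (A (q + (s + t : ℕ)) i) := by
    intro t
    induction t with
    | zero => intro s i; simp
    | succ t ih =>
      intro s i
      have h1 := ih s (i + 1)
      obtain ⟨α, β, hα, -, hβ, -, e⟩ := hstep (q + (s + t : ℕ)) i
      rw [← add_assoc s, hadd, e, map_add, map_smul, map_smul, smul_eq_mul, smul_eq_mul,
        show i + (t + 1) = i + 1 + t by ring, pow_succ]
      have h2 := hf' (s + t) i
      have h3 := hf' (s + t) (i + 1)
      have h5 : ε * f (A (q + (s + t : ℕ)) (i + 1)) ≤ β * f (A (q + (s + t : ℕ)) (i + 1)) := by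
        gcongr
      have h6 := mul_le_mul_of_nonneg_left h1 hε.le
      have h7 : 0 ≤ α * f (A (q + (s + t : ℕ)) i) := by positivity
      linarith
  have hstay : ∀ (t s : ℕ), ε ^ t * f (A (q + s) (n - 1)) ≤ f (A (q + (s + t : ℕ)) (n - 1)) := by
    intro t
    induction t with
    | zero => intro s; simp
    | succ t ih =>
      intro s
      have h1 := ih s
      obtain ⟨α, β, hα, hβ, e⟩ := hlast (q + (s + t : ℕ))
      rw [← add_assoc s, hadd, e, map_add, map_smul, map_smul, smul_eq_mul, smul_eq_mul, pow_succ]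
      have h2 := hf' (s + t) (n - 1)
      have h3 := hf' (s + t) n
      have h5 : ε * f (A (q + (s + t : ℕ)) (n - 1)) ≤ α * f (A (q + (s + t : ℕ)) (n - 1)) := by
        gcongr
      have h6 := mul_le_mul_of_nonneg_left h1 hε.le
      have h7 : 0 ≤ β * f (A (q + (s + t : ℕ)) n) := by positivity
      linarith
  have hlow : ∀ i < n, ∀ l < n, ε ^ (2 * n) * f (A q l) ≤ f (A (q + (2 * n : ℕ)) i) := by
    intro i hi l hl
    have m1 := hmove (l + 1) 0 (n - 1)
    have m2 := hstay (2 * n - (l + 1) - (n - 1 - i)) (0 + (l + 1))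
    have m3 := hmove (n - 1 - i) (0 + (l + 1) + (2 * n - (l + 1) - (n - 1 - i))) i
    rw [show n - 1 + (l + 1) = l + n by omega, h.periodic] at m1
    rw [show i + (n - 1 - i) = n - 1 by omega, show 0 + (l + 1) +
      (2 * n - (l + 1) - (n - 1 - i)) + (n - 1 - i) = 2 * n by omega] at m3
    simp only [Nat.cast_zero, add_zero] at m1
    refine le_trans ?_ m3
    refine le_trans ?_ (mul_le_mul_of_nonneg_left m2 (by positivity))
    refine le_trans ?_ (mul_le_mul_of_nonneg_left (mul_le_mul_of_nonneg_left m1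
      (by positivity)) (by positivity))
    rw [← mul_assoc, ← mul_assoc, ← pow_add, ← pow_add,
      show n - 1 - i + (2 * n - (l + 1) - (n - 1 - i)) + (l + 1) = 2 * n by omega]
  have hsum0 : 0 ≤ ∑ l ∈ Finset.range n, f (A q l) := Finset.sum_nonneg fun l _ => hf l
  have hup : ∀ t : ℕ, ∀ i, f (A (q + t) i) ≤ (2 * K) ^ t * ∑ l ∈ Finset.range n, f (A q l) := by
    intro t
    induction t with
    | zero =>
      intro i
      rw [pow_zero, one_mul, ← h.apply_mod]
      simp only [Nat.cast_zero, add_zero]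
      exact Finset.single_le_sum (f := fun l => f (A q l)) (fun l _ => hf l)
        (Finset.mem_range.2 (h.mod_lt i))
    | succ t ih =>
      intro i
      obtain ⟨α, β, hα, hα', hβ, hβ', e⟩ := hstep (q + t) i
      rw [hadd, e, map_add, map_smul, map_smul, smul_eq_mul, smul_eq_mul, pow_succ]
      have h1 : α * f (A (q + t) i) ≤ K * ((2 * K) ^ t * ∑ l ∈ Finset.range n, f (A q l)) :=
        mul_le_mul hα' (ih i) (hf' t i) hK.le
      have h2 : β * f (A (q + t) (i + 1)) ≤
          K * ((2 * K) ^ t * ∑ l ∈ Finset.range n, f (A q l)) :=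
        mul_le_mul hβ' (ih (i + 1)) (hf' t _) hK.le
      linarith
  have h2n : q + 2 * (n : ℤ) = q + (2 * n : ℕ) := by push_cast; ring
  rw [h2n]
  refine ⟨?_, hup (2 * n) i⟩
  rw [← h.apply_mod _ i]
  have hn : (0 : ℝ) < n := by positivity
  rw [div_mul_eq_mul_div, div_le_iff₀ hn, Finset.mul_sum]
  calc _ ≤ ∑ l ∈ Finset.range n, f (A (q + (2 * n : ℕ)) (i % n)) :=
        Finset.sum_le_sum fun l hl => hlow _ (h.mod_lt i) l (Finset.mem_range.1 hl)
    _ = _ := by rw [Finset.sum_const, Finset.card_range, nsmul_eq_mul, mul_comm]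


/-! ### Contraction, the limit functional and the limit point -/

/-- The functional with coefficient vector `w`. -/
def dotL (w : Vec) : Vec →ₗ[ℝ] ℝ where
  toFun v := w 0 * v 0 + w 1 * v 1 + w 2 * v 2
  map_add' u v := by simp only [Pi.add_apply]; ring
  map_smul' c v := by simp only [Pi.smul_apply, smul_eq_mul, RingHom.id_apply]; ring

theorem dotL_apply (w v : Vec) : dotL w v = w 0 * v 0 + w 1 * v 1 + w 2 * v 2 := rfl

theorem linearMap_eq_dotL (f : Vec →ₗ[ℝ] ℝ) : f = dotL fun c => f (Pi.single c 1) := by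
  refine LinearMap.ext fun v => ?_
  have e : v = v 0 • Pi.single 0 1 + v 1 • Pi.single 1 1 + v 2 • (Pi.single 2 1 : Vec) := by
    ext i
    fin_cases i <;> simp
  conv_lhs => rw [e]
  simp only [map_add, map_smul, smul_eq_mul, dotL_apply]
  ring

theorem dotL_smul (c : ℝ) (w : Vec) : dotL (c • w) = c • dotL w := by
  refine LinearMap.ext fun v => ?_
  simp only [dotL_apply, LinearMap.smul_apply, Pi.smul_apply, smul_eq_mul]
  ring

theorem dotL_ne_zero {w : Vec} (hw : w ≠ 0) : dotL w ≠ 0 := by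
  intro h
  apply hw
  ext c
  have := LinearMap.congr_fun h (Pi.single c 1)
  fin_cases c <;> simpa [dotL_apply] using this

theorem continuous_dotL_left (v : Vec) : Continuous fun w => dotL w v := by
  simp only [dotL_apply]
  fun_prop

/-- The limit functional `g` (whose zero line is the outward limit of the polygons `a q`) and the
inward limit point `p` of a spiral. -/
structure IsLimitPair (a : ℤ → ℕ → Vec) (g : Vec →ₗ[ℝ] ℝ) (p : Vec) : Prop where
  g_pos : ∀ q i, 0 < g (a q i)
  g_p : g p = 1
  tendsto : ∀ (f : Vec →ₗ[ℝ] ℝ) (ε : ℝ), 0 < ε →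
    ∃ N : ℤ, ∀ q ≥ N, ∀ i, |f (a q i) - f p * g (a q i)| ≤ ε * g (a q i)
  pos : ∀ (q : ℤ) (f : Vec →ₗ[ℝ] ℝ), (∀ i, 0 ≤ f (a q i)) → f ≠ 0 → 0 < f p
  exhaust : ∀ x, 0 < g x →
    ∃ N : ℤ, ∀ q ≤ N, ∀ f : Vec →ₗ[ℝ] ℝ, (∀ i, 0 ≤ f (a q i)) → f ≠ 0 → 0 < f x
  later_pos : ∃ M : ℕ, ∀ q (f : Vec →ₗ[ℝ] ℝ), (∀ i, 0 ≤ f (a q i)) → f ≠ 0 →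
    ∀ q' ≥ q + M, ∀ i, 0 < f (a q' i)

namespace ConvexSpiral

variable {n k : ℕ} {a : ℤ → ℕ → Vec} {δ K : ℝ}

theorem sum_pos (h : ConvexSpiral n k a) {q : ℤ} {f : Vec →ₗ[ℝ] ℝ} (hf : ∀ i, 0 ≤ f (a q i))
    (hf0 : f ≠ 0) : 0 < ∑ l ∈ Finset.range n, f (a q l) := by
  have h4 := h.four_le
  refine lt_of_le_of_ne (Finset.sum_nonneg fun l _ => hf l) fun h0 => hf0 ?_
  have hz := (Finset.sum_eq_zero_iff_of_nonneg fun l _ => hf l).1 h0.symm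
  have hz' : ∀ l < n, f (a q l) = (0 : Vec →ₗ[ℝ] ℝ) (a q l) := fun l hl => by
    rw [hz l (Finset.mem_range.2 hl), LinearMap.zero_apply]
  exact linearMap_ext_of_tri (h.pos q 0 1 2 (by omega) (by omega) (by omega)).ne'
    (hz' 0 (by omega)) (hz' 1 (by omega)) (hz' 2 (by omega))

/-- A nonzero functional cannot vanish at three vertices of a polygon, so its sum over the vertices
is positive, and Harnack spreads this to every later vertex. -/
theorem map_pos_of_add_le (h : ConvexSpiral n k a) (hδ : 0 < δ) (hH : HarnackBound n a δ K)
    {q q' : ℤ} (hq : q + 2 * n ≤ q') {f : Vec →ₗ[ℝ] ℝ} (hf : ∀ i, 0 ≤ f (a q i)) (hf0 : f ≠ 0)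
    (i : ℕ) : 0 < f (a q' i) := by
  have h1 := h.map_nonneg_of_le (show q ≤ q' - 2 * n by omega) hf
  have h2 := (hH (q' - 2 * n) f h1 i).1
  rw [sub_add_cancel] at h2
  exact (mul_pos hδ (h.sum_pos h1 hf0)).trans_le h2

theorem map_pos_of_le (h : ConvexSpiral n k a) {q q' : ℤ} (hq : q ≤ q') {g : Vec →ₗ[ℝ] ℝ}
    (hg : ∀ i, 0 < g (a q i)) (i : ℕ) : 0 < g (a q' i) := by
  obtain ⟨t, rfl⟩ := Int.le.dest hq
  clear hq
  induction t generalizing i with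
  | zero => simpa using hg i
  | succ t ih =>
    obtain ⟨α, β, hα, hβ, e⟩ := h.step (q + t) i
    rw [Nat.cast_succ, ← add_assoc, e, map_add, map_smul, map_smul, smul_eq_mul, smul_eq_mul]
    have h1 := ih i
    have h2 := ih (i + 1)
    positivity

/-- `f / g` takes values in `[s, S]` on the polygon `a q`. -/
def RatioIn (a : ℤ → ℕ → Vec) (f g : Vec →ₗ[ℝ] ℝ) (q : ℤ) (s S : ℝ) : Prop :=
  ∀ i, s * g (a q i) ≤ f (a q i) ∧ f (a q i) ≤ S * g (a q i)

/-- Maximum principle: nesting is applied to `f - s • g` and `S • g - f`. -/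
theorem ratioIn_of_le (h : ConvexSpiral n k a) {f g : Vec →ₗ[ℝ] ℝ} {q q' : ℤ} (hq : q ≤ q')
    {s S : ℝ} (hr : RatioIn a f g q s S) : RatioIn a f g q' s S := by
  have h1 := h.map_nonneg_of_le hq (f := f - s • g) fun i => by
    simpa using (hr i).1
  have h2 := h.map_nonneg_of_le hq (f := S • g - f) fun i => by
    simpa using (hr i).2
  intro i
  have h1' := h1 i
  have h2' := h2 i
  simp only [LinearMap.sub_apply, LinearMap.smul_apply, smul_eq_mul, sub_nonneg] at h1' h2'
  exact ⟨h1', h2'⟩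

theorem exists_ratioIn (h : ConvexSpiral n k a) {g : Vec →ₗ[ℝ] ℝ} {q : ℤ}
    (hg : ∀ i, 0 < g (a q i)) (f : Vec →ₗ[ℝ] ℝ) : ∃ C : ℝ, RatioIn a f g q (-C) C := by
  refine ⟨∑ l ∈ Finset.range n, |f (a q l)| / g (a q l), fun i => ?_⟩
  have h1 := Finset.single_le_sum (s := Finset.range n)
    (f := fun l => |f (a q l)| / g (a q l)) (fun l _ => div_nonneg (abs_nonneg _) (hg l).le)
    (Finset.mem_range.2 (h.mod_lt i))
  simp only [h.apply_mod] at h1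
  rw [div_le_iff₀ (hg i)] at h1
  have := abs_le.1 h1
  exact ⟨by linarith, this.2⟩

/-- Let `R` be the ratio of the sums of `f` and `g`. The lower Harnack bound for `f - s • g` and `S
• g - f`, against the upper one for `g`, moves the ends of `[s, S]` inward by `δ / K` times `R - s`
and `S - R`, which add up to `S - s`. -/
theorem ratioIn_contract (h : ConvexSpiral n k a) (hδ : 0 < δ) (hK : 0 < K)
    (hH : HarnackBound n a δ K) {f g : Vec →ₗ[ℝ] ℝ} {q : ℤ} (hg : ∀ i, 0 < g (a q i)) {s S : ℝ}
    (hr : RatioIn a f g q s S) :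
    ∃ s' S', S' - s' = (1 - δ / K) * (S - s) ∧ RatioIn a f g (q + 2 * n) s' S' := by
  have hg0 : g ≠ 0 := fun h0 => by simpa [h0] using hg 0
  have hG := h.sum_pos (fun i => (hg i).le) hg0
  set G := ∑ l ∈ Finset.range n, g (a q l)
  set R := (∑ l ∈ Finset.range n, f (a q l)) / G with hR
  have hRG : ∑ l ∈ Finset.range n, f (a q l) = R * G := by rw [hR]; field_simp
  have e1 : ∑ l ∈ Finset.range n, (f - s • g) (a q l) = (R - s) * G := by
    simp only [LinearMap.sub_apply, LinearMap.smul_apply, smul_eq_mul, Finset.sum_sub_distrib,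
      ← Finset.mul_sum, hRG]
    ring
  have e2 : ∑ l ∈ Finset.range n, (S • g - f) (a q l) = (S - R) * G := by
    simp only [LinearMap.sub_apply, LinearMap.smul_apply, smul_eq_mul, Finset.sum_sub_distrib,
      ← Finset.mul_sum, hRG]
    ring
  have f1 : ∀ i, 0 ≤ (f - s • g) (a q i) := fun i => by simpa using (hr i).1
  have f2 : ∀ i, 0 ≤ (S • g - f) (a q i) := fun i => by simpa using (hr i).2
  have hRs : 0 ≤ R - s := by
    have := Finset.sum_nonneg fun l (_ : l ∈ Finset.range n) => f1 l
    rw [e1] at this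
    exact nonneg_of_mul_nonneg_left this hG
  have hSR : 0 ≤ S - R := by
    have := Finset.sum_nonneg fun l (_ : l ∈ Finset.range n) => f2 l
    rw [e2] at this
    exact nonneg_of_mul_nonneg_left this hG
  refine ⟨s + δ / K * (R - s), S - δ / K * (S - R), by ring, fun i => ?_⟩
  have g1 := (hH q g (fun i => (hg i).le) i).2
  have h1 := (hH q _ f1 i).1
  have h2 := (hH q _ f2 i).1
  rw [e1, LinearMap.sub_apply, LinearMap.smul_apply, smul_eq_mul] at h1
  rw [e2, LinearMap.sub_apply, LinearMap.smul_apply, smul_eq_mul] at h2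
  have k1 : δ / K * (R - s) * g (a (q + 2 * n) i) ≤ δ * ((R - s) * G) := by
    calc _ ≤ δ / K * (R - s) * (K * G) := by gcongr
      _ = _ := by field_simp
  have k2 : δ / K * (S - R) * g (a (q + 2 * n) i) ≤ δ * ((S - R) * G) := by
    calc _ ≤ δ / K * (S - R) * (K * G) := by gcongr
      _ = _ := by field_simp
  constructor <;> linarith

theorem harnack_const_le (h : ConvexSpiral n k a) (hH : HarnackBound n a δ K)
    {g : Vec →ₗ[ℝ] ℝ} {q : ℤ} (hg : ∀ i, 0 < g (a q i)) : δ ≤ K := by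
  have hg0 : g ≠ 0 := fun h0 => by simpa [h0] using hg 0
  have hG := h.sum_pos (fun i => (hg i).le) hg0
  obtain ⟨h1, h2⟩ := hH q g (fun i => (hg i).le) 0
  exact le_of_mul_le_mul_right (h1.trans h2) hG

theorem ratioIn_contract_iter (h : ConvexSpiral n k a) (hδ : 0 < δ) (hK : 0 < K)
    (hH : HarnackBound n a δ K) {f g : Vec →ₗ[ℝ] ℝ} {q : ℤ} (hg : ∀ i, 0 < g (a q i)) {s S : ℝ}
    (hr : RatioIn a f g q s S) (t : ℕ) :
    ∃ s' S', S' - s' = (1 - δ / K) ^ t * (S - s) ∧ RatioIn a f g (q + 2 * n * t) s' S' := by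
  induction t with
  | zero => exact ⟨s, S, by simp, by simpa using hr⟩
  | succ t ih =>
    obtain ⟨s', S', e, hr'⟩ := ih
    obtain ⟨s'', S'', e', hr''⟩ := h.ratioIn_contract hδ hK hH
      (h.map_pos_of_le (le_add_of_nonneg_right (by positivity)) hg) hr' (q := q + 2 * n * t)
    refine ⟨s'', S'', by rw [e', e]; ring, ?_⟩
    rwa [show q + 2 * (n : ℤ) * ((t + 1 : ℕ) : ℤ) = q + 2 * n * t + 2 * n by push_cast; ring]

theorem exists_pow_mul_le (hδ : 0 < δ) (hδK : δ ≤ K) (C : ℝ) {ε : ℝ} (hε : 0 < ε) :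
    ∃ t : ℕ, (1 - δ / K) ^ t * C ≤ ε := by
  have hK := hδ.trans_le hδK
  have h0 : 0 ≤ 1 - δ / K := sub_nonneg.2 ((div_le_one hK).2 hδK)
  have h1 : 1 - δ / K < 1 := sub_lt_self 1 (by positivity)
  obtain ⟨t, ht⟩ := exists_pow_lt_of_lt_one (show 0 < ε / (|C| + 1) by positivity) h1
  refine ⟨t, ?_⟩
  have hC : 0 < |C| + 1 := by positivity
  calc (1 - δ / K) ^ t * C ≤ (1 - δ / K) ^ t * (|C| + 1) := by
        gcongr
        linarith [le_abs_self C]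
    _ ≤ ε / (|C| + 1) * (|C| + 1) := by gcongr
    _ = ε := by field_simp

/-- The supremum of all lower bounds of `f / g` lies in every interval that contains the ratio on
some polygon, and contraction makes these intervals arbitrarily short. -/
theorem exists_ratio_limit (h : ConvexSpiral n k a) (hδ : 0 < δ) (hK : 0 < K)
    (hH : HarnackBound n a δ K) {g : Vec →ₗ[ℝ] ℝ} (hg : ∀ q i, 0 < g (a q i))
    (f : Vec →ₗ[ℝ] ℝ) :
    ∃ L : ℝ, ∀ ε > 0, ∃ N : ℤ, ∀ q ≥ N, ∀ i, |f (a q i) - L * g (a q i)| ≤ ε * g (a q i) := by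
  set T : Set ℝ := {s | ∃ q, ∀ i, s * g (a q i) ≤ f (a q i)} with hT
  have hub : ∀ q s S, RatioIn a f g q s S → ∀ s' ∈ T, s' ≤ S := by
    rintro q s S hr s' ⟨q', hs'⟩
    have h1 := h.ratioIn_of_le (le_max_left q q') hr 0
    have h2 := h.map_nonneg_of_le (le_max_right q q') (f := f - s' • g)
      (fun i => by simpa using hs' i) 0
    simp only [LinearMap.sub_apply, LinearMap.smul_apply, smul_eq_mul, sub_nonneg] at h2
    exact le_of_mul_le_mul_right (h2.trans h1.2) (hg _ 0)
  obtain ⟨C, hC⟩ := h.exists_ratioIn (hg 0) f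
  have hbdd : BddAbove T := ⟨C, hub 0 _ _ hC⟩
  have hmem : ∀ q s S, RatioIn a f g q s S → s ∈ T := fun q s S hr => ⟨q, fun i => (hr i).1⟩
  have hne : T.Nonempty := ⟨-C, hmem 0 _ _ hC⟩
  refine ⟨sSup T, fun ε hε => ?_⟩
  obtain ⟨t, ht⟩ := exists_pow_mul_le hδ (h.harnack_const_le hH (hg 0)) (C - -C) hε
  obtain ⟨s, S, e, hr⟩ := h.ratioIn_contract_iter hδ hK hH (hg 0) hC t
  have h1 : s ≤ sSup T := le_csSup hbdd (hmem _ _ _ hr)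
  have h2 : sSup T ≤ S := csSup_le hne (hub _ _ _ hr)
  refine ⟨0 + 2 * n * t, fun q hq i => ?_⟩
  have hr' := h.ratioIn_of_le hq hr i
  have hgi := hg q i
  have hS : S - s ≤ ε := e.trans_le ht
  rw [abs_le]
  constructor
  · nlinarith [hr'.1]
  · nlinarith [hr'.2]

/-- Up to scaling, only one functional is nonnegative on all polygons of the spiral. -/
theorem exists_eq_smul (h : ConvexSpiral n k a) (hδ : 0 < δ) (hK : 0 < K)
    (hH : HarnackBound n a δ K) {f g : Vec →ₗ[ℝ] ℝ} (hf : ∀ q i, 0 ≤ f (a q i))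
    (hg : ∀ q i, 0 < g (a q i)) (hf0 : f ≠ 0) : ∃ ρ : ℝ, 0 < ρ ∧ f = ρ • g := by
  have h4 := h.four_le
  have hg0 : g ≠ 0 := fun h0 => by simpa [h0] using hg 0 0
  have hfp : ∀ q i, 0 < f (a q i) := fun q i =>
    h.map_pos_of_add_le hδ hH (show q - 2 * n + 2 * n ≤ q by omega) (hf _) hf0 i
  have hδK := h.harnack_const_le hH (hg 0)
  set ρ := f (a 0 0) / g (a 0 0) with hρ
  have hρ0 : 0 < ρ := div_pos (hfp 0 0) (hg 0 0)
  -- The oscillation of `f / g` is bounded independently of how early the polygon is: Harnack bounds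
  -- `S` by a multiple of `s`, and `s ≤ ρ`. Contracting from ever earlier polygons to label `0` then
  -- leaves no oscillation.
  have hrat : ∀ q ≤ 0, ∃ s S, S - s ≤ K ^ 2 / δ ^ 2 * ρ ∧ RatioIn a f g q s S := by
    intro q hq
    have hF := h.sum_pos (fun i => (hfp (q - 2 * n) i).le) hf0
    have hG := h.sum_pos (fun i => (hg (q - 2 * n) i).le) hg0
    set F := ∑ l ∈ Finset.range n, f (a (q - 2 * n) l)
    set G := ∑ l ∈ Finset.range n, g (a (q - 2 * n) l)
    have hr : RatioIn a f g q (δ * F / (K * G)) (K * F / (δ * G)) := by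
      intro i
      have f1 := hH (q - 2 * n) f (hf _) i
      have g1 := hH (q - 2 * n) g (fun i => (hg _ i).le) i
      rw [sub_add_cancel] at f1 g1
      constructor
      · calc _ ≤ δ * F / (K * G) * (K * G) := by gcongr; exact g1.2
          _ = δ * F := by field_simp
          _ ≤ _ := f1.1
      · calc _ ≤ K * F := f1.2
          _ = K * F / (δ * G) * (δ * G) := by field_simp
          _ ≤ _ := by gcongr; exact g1.1
    refine ⟨_, _, ?_, hr⟩
    have h1 := (h.ratioIn_of_le hq hr 0).1
    rw [← le_div_iff₀ (hg 0 0)] at h1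
    have h2 : 0 < δ * F / (K * G) := by positivity
    calc _ ≤ K * F / (δ * G) := by linarith
      _ = K ^ 2 / δ ^ 2 * (δ * F / (K * G)) := by field_simp
      _ ≤ _ := by gcongr
  have key : ∀ i, f (a 0 i) = (ρ • g) (a 0 i) := by
    intro i
    rw [LinearMap.smul_apply, smul_eq_mul, ← sub_eq_zero, ← abs_nonpos_iff]
    refine le_of_forall_pos_le_add fun ε hε => ?_
    rw [zero_add]
    have hgi := hg 0 i
    obtain ⟨t, ht⟩ := exists_pow_mul_le hδ hδK (K ^ 2 / δ ^ 2 * ρ)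
      (show 0 < ε / g (a 0 i) by positivity)
    obtain ⟨s, S, hsS, hr⟩ := hrat (0 - 2 * n * t) (by
      have : (0 : ℤ) ≤ 2 * n * t := by positivity
      omega)
    obtain ⟨s', S', e, hr'⟩ := h.ratioIn_contract_iter hδ hK hH (hg _) hr t
    rw [sub_add_cancel] at hr'
    have h0 : 0 ≤ 1 - δ / K := sub_nonneg.2 ((div_le_one hK).2 hδK)
    have hle : S' - s' ≤ ε / g (a 0 i) := by
      rw [e]
      exact (mul_le_mul_of_nonneg_left hsS (pow_nonneg h0 t)).trans ht
    rw [le_div_iff₀ hgi] at hle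
    have r1 : s' ≤ ρ := (le_div_iff₀ (hg 0 0)).2 (hr' 0).1
    have r2 : ρ ≤ S' := (div_le_iff₀ (hg 0 0)).2 (hr' 0).2
    rw [abs_le]
    constructor
    · nlinarith [(hr' i).1]
    · nlinarith [(hr' i).2]
  exact ⟨ρ, hρ0, linearMap_ext_of_tri (h.pos 0 0 1 2 (by omega) (by omega) (by omega)).ne'
    (key 0) (key 1) (key 2)⟩

/-- Compactness: for coefficient vectors of norm one, the admissible functionals form closed
nonempty sets that decrease as the label goes to `-∞`. With `x = 0` this yields the limit
functional; with other `x` it reduces `exhaust` to uniqueness. -/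
theorem exists_functional (h : ConvexSpiral n k a) (x : Vec)
    (hx : ∀ N : ℤ, ∃ q ≤ N, ∃ f : Vec →ₗ[ℝ] ℝ, (∀ i, 0 ≤ f (a q i)) ∧ f ≠ 0 ∧ f x ≤ 0) :
    ∃ f : Vec →ₗ[ℝ] ℝ, (∀ q i, 0 ≤ f (a q i)) ∧ f ≠ 0 ∧ f x ≤ 0 := by
  set S : ℕ → Set Vec := fun t =>
    Metric.sphere 0 1 ∩ ((⋂ i, {w | 0 ≤ dotL w (a (-(t : ℤ)) i)}) ∩ {w | dotL w x ≤ 0}) with hS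
  have hcl : ∀ t, IsClosed ((⋂ i, {w | 0 ≤ dotL w (a (-(t : ℤ)) i)}) ∩ {w | dotL w x ≤ 0}) :=
    fun t => (isClosed_iInter fun i => isClosed_le continuous_const (continuous_dotL_left _)).inter
      (isClosed_le (continuous_dotL_left _) continuous_const)
  have hne : (⋂ t, S t).Nonempty := by
    refine IsCompact.nonempty_iInter_of_sequence_nonempty_isCompact_isClosed S (fun t w hw => ?_)
      (fun t => ?_) ((isCompact_sphere 0 1).inter_right (hcl 0))
      (fun t => Metric.isClosed_sphere.inter (hcl t))
    · refine ⟨hw.1, Set.mem_iInter.2 fun i => ?_, hw.2.2⟩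
      exact h.map_nonneg_of_le (by omega) (fun i => Set.mem_iInter.1 hw.2.1 i) i
    · obtain ⟨q, hq, f, hf, hf0, hfx⟩ := hx (-(t : ℤ))
      set w : Vec := fun c => f (Pi.single c 1) with hw
      have hfw : f = dotL w := linearMap_eq_dotL f
      have hw0 : w ≠ 0 := by
        rintro e
        apply hf0
        rw [hfw, e]
        refine LinearMap.ext fun v => ?_
        simp [dotL_apply]
      have hn : 0 < ‖w‖ := norm_pos_iff.2 hw0
      refine ⟨‖w‖⁻¹ • w, ?_, Set.mem_iInter.2 fun i => ?_, ?_⟩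
      · rw [mem_sphere_zero_iff_norm, norm_smul, norm_inv, norm_norm, inv_mul_cancel₀ hn.ne']
      · have := h.map_nonneg_of_le hq hf i
        rw [hfw] at this
        rw [Set.mem_ofPred_eq, dotL_smul, LinearMap.smul_apply, smul_eq_mul]
        positivity
      · rw [Set.mem_ofPred_eq, dotL_smul, LinearMap.smul_apply, smul_eq_mul, ← hfw]
        exact mul_nonpos_of_nonneg_of_nonpos (by positivity) hfx
  obtain ⟨w, hw⟩ := hne
  rw [Set.mem_iInter] at hw
  refine ⟨dotL w, fun q => ?_, dotL_ne_zero fun e => ?_, (hw 0).2.2⟩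
  · exact h.map_nonneg_of_le (show -((-q).toNat : ℤ) ≤ q by omega)
      fun i => Set.mem_iInter.1 (hw (-q).toNat).2.1 i
  · have := (hw 0).1
    rw [e, mem_sphere_zero_iff_norm, norm_zero] at this
    exact zero_ne_one this

theorem exists_isLimitPair (h : ConvexSpiral n k a) (hδ : 0 < δ) (hK : 0 < K)
    (hH : HarnackBound n a δ K)
    (hne : ∀ q, ∃ f : Vec →ₗ[ℝ] ℝ, ∀ i, 0 < f (a q i)) :
    ∃ g p, IsLimitPair a g p := by
  have hall : ∀ f : Vec →ₗ[ℝ] ℝ, (∀ q i, 0 ≤ f (a q i)) → f ≠ 0 → ∀ q i, 0 < f (a q i) :=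
    fun f hf hf0 q i =>
      h.map_pos_of_add_le hδ hH (show q - 2 * n + 2 * n ≤ q by omega) (hf _) hf0 i
  obtain ⟨g, hg', hg0, -⟩ := h.exists_functional 0 fun N => by
    obtain ⟨f, hf⟩ := hne N
    exact ⟨N, le_rfl, f, fun i => (hf i).le, fun h0 => by simpa [h0] using hf 0, by simp⟩
  have hg := hall g hg' hg0
  choose L hL using h.exists_ratio_limit hδ hK hH hg
  -- The coordinates of `p` are the limits of the coordinate functionals divided by `g`; general
  -- functionals follow by linearity.
  set p : Vec := fun c => L (dotL (Pi.single c 1)) with hp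
  have ht : ∀ (f : Vec →ₗ[ℝ] ℝ) (ε : ℝ), 0 < ε →
      ∃ N : ℤ, ∀ q ≥ N, ∀ i, |f (a q i) - f p * g (a q i)| ≤ ε * g (a q i) := by
    intro f ε hε
    set w : Vec := fun c => f (Pi.single c 1) with hw
    have hfw : f = dotL w := linearMap_eq_dotL f
    set W := |w 0| + |w 1| + |w 2| + 1 with hW
    have hWp : 0 < W := by positivity
    choose N hN using fun c : Fin 3 => hL (dotL (Pi.single c 1)) (ε / W) (by positivity)
    refine ⟨max (N 0) (max (N 1) (N 2)), fun q hq i => ?_⟩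
    have b0 := hN 0 q (by omega) i
    have b1 := hN 1 q (by omega) i
    have b2 := hN 2 q (by omega) i
    have c0 : dotL (Pi.single 0 1) (a q i) = a q i 0 := by simp [dotL_apply]
    have c1 : dotL (Pi.single 1 1) (a q i) = a q i 1 := by simp [dotL_apply]
    have c2 : dotL (Pi.single 2 1) (a q i) = a q i 2 := by simp [dotL_apply]
    rw [c0] at b0
    rw [c1] at b1
    rw [c2] at b2
    change |a q i 0 - p 0 * _| ≤ _ at b0
    change |a q i 1 - p 1 * _| ≤ _ at b1
    change |a q i 2 - p 2 * _| ≤ _ at b2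
    have hgi := hg q i
    rw [hfw, dotL_apply, dotL_apply]
    calc _ = |w 0 * (a q i 0 - p 0 * g (a q i)) + w 1 * (a q i 1 - p 1 * g (a q i)) +
          w 2 * (a q i 2 - p 2 * g (a q i))| := by congr 1; ring
      _ ≤ |w 0| * |a q i 0 - p 0 * g (a q i)| + |w 1| * |a q i 1 - p 1 * g (a q i)| +
          |w 2| * |a q i 2 - p 2 * g (a q i)| := by
        rw [← abs_mul, ← abs_mul, ← abs_mul]
        exact abs_add_three _ _ _
      _ ≤ |w 0| * (ε / W * g (a q i)) + |w 1| * (ε / W * g (a q i)) +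
          |w 2| * (ε / W * g (a q i)) := by gcongr
      _ = (|w 0| + |w 1| + |w 2|) * (ε / W * g (a q i)) := by ring
      _ ≤ W * (ε / W * g (a q i)) := by
        gcongr
        linarith
      _ = ε * g (a q i) := by field_simp
  refine ⟨g, p, hg, ?_, ht, fun q f hf hf0 => ?_, fun x hx => ?_, 2 * n,
    fun q f hf hf0 q' hq' => h.map_pos_of_add_le hδ hH (by push_cast at hq'; exact hq') hf hf0⟩
  · rw [← sub_eq_zero, ← abs_nonpos_iff]
    refine le_of_forall_pos_le_add fun ε hε => ?_
    obtain ⟨N, hN⟩ := ht g ε hε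
    have h1 := hN N le_rfl 0
    have hgi := hg N 0
    rw [show g (a N 0) - g p * g (a N 0) = -((g p - 1) * g (a N 0)) by ring, abs_neg, abs_mul,
      abs_of_pos hgi] at h1
    linarith [le_of_mul_le_mul_right h1 hgi]
  · have hfp := h.map_pos_of_add_le hδ hH (le_refl (q + 2 * (n : ℤ))) hf hf0
    -- From `g ≤ C f` on all later polygons the limit ratio `f p` is at least `1 / C`; approximation
    -- within `1 / (2 * C)` already gives positivity.
    obtain ⟨C, hC⟩ := h.exists_ratioIn hfp g
    have hC0 : 0 < C := by
      have := (hC 0).2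
      exact pos_of_mul_pos_left ((hg _ 0).trans_le this) (hfp 0).le
    obtain ⟨N, hN⟩ := ht f (1 / (2 * C)) (by positivity)
    have h1 := hN (max N (q + 2 * n)) (le_max_left _ _) 0
    have h2 := (h.ratioIn_of_le (le_max_right N (q + 2 * n)) hC 0).2
    have hgi := hg (max N (q + 2 * n)) 0
    set G := g (a (max N (q + 2 * n)) 0)
    have h3 : 1 / C * G ≤ f (a (max N (q + 2 * n)) 0) := by
      rw [one_div, inv_mul_le_iff₀ hC0]
      exact h2
    have h4 := (abs_le.1 h1).2
    have h5 : 1 / C * G = 1 / (2 * C) * G + 1 / (2 * C) * G := by field_simp; ring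
    have h6 : 0 < 1 / (2 * C) * G := by positivity
    have h7 : 0 < f p * G := by linarith
    exact pos_of_mul_pos_left h7 hgi.le
  -- A failure for arbitrarily early labels produces a functional nonnegative on all polygons and
  -- nonpositive at `x`; by uniqueness it is a positive multiple of `g`.
  · by_contra! hcon
    obtain ⟨f, hf, hf0, hfx⟩ := h.exists_functional x hcon
    obtain ⟨ρ, hρ, rfl⟩ := h.exists_eq_smul hδ hK hH hf hg hf0
    rw [LinearMap.smul_apply, smul_eq_mul] at hfx
    exact absurd hfx (not_le.2 (mul_pos hρ hx))

end ConvexSpiral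


/-! ### Homogeneous lifts of points -/

open Projectivization

/-- `v` is a vector of homogeneous coordinates of `x`. -/
def IsLift (x : RP2) (v : Vec) : Prop := ∃ hv : v ≠ 0, x = Projectivization.mk ℝ v hv

theorem isLift_rep (x : RP2) : IsLift x x.rep := ⟨x.rep_nonzero, (mk_rep x).symm⟩

theorem isLift_mk (v : Vec) (hv : v ≠ 0) : IsLift (Projectivization.mk ℝ v hv) v := ⟨hv, rfl⟩

theorem IsLift.ne_zero {x : RP2} {v : Vec} (h : IsLift x v) : v ≠ 0 := h.1

theorem IsLift.smul {x : RP2} {v : Vec} (h : IsLift x v) {c : ℝ} (hc : c ≠ 0) :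
    IsLift x (c • v) := by
  obtain ⟨hv, rfl⟩ := h
  exact ⟨smul_ne_zero hc hv, (mk_eq_mk_iff' ℝ _ _ _ _).2 ⟨c⁻¹, inv_smul_smul₀ hc v⟩⟩

theorem IsLift.exists_smul {x : RP2} {v w : Vec} (hv : IsLift x v) (hw : IsLift x w) :
    ∃ c : ℝ, c ≠ 0 ∧ v = c • w := by
  obtain ⟨hv0, rfl⟩ := hv
  obtain ⟨hw0, e⟩ := hw
  obtain ⟨c, hc⟩ := (mk_eq_mk_iff' ℝ _ _ _ _).1 e
  refine ⟨c, ?_, hc.symm⟩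
  rintro rfl
  exact hv0 (by rw [← hc, zero_smul])

theorem IsLift.eq {x y : RP2} {v : Vec} (hx : IsLift x v) (hy : IsLift y v) : x = y := by
  obtain ⟨_, rfl⟩ := hx
  obtain ⟨_, rfl⟩ := hy
  rfl

theorem IsLift.map_rep_ne_zero_iff {x : RP2} {v : Vec} (h : IsLift x v) (φ : Vec →ₗ[ℝ] ℝ) :
    φ x.rep ≠ 0 ↔ φ v ≠ 0 := by
  obtain ⟨c, hc, e⟩ := h.exists_smul (isLift_rep x)
  simp [e, hc]

theorem isLift_aff {x : RP2} {φ : Vec →ₗ[ℝ] ℝ} (h : φ x.rep ≠ 0) : IsLift x (aff φ x) :=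
  (isLift_rep x).smul (inv_ne_zero h)

theorem map_aff {x : RP2} {φ : Vec →ₗ[ℝ] ℝ} (h : φ x.rep ≠ 0) : φ (aff φ x) = 1 := by
  simp [aff, h]

theorem IsLift.aff_eq {x : RP2} {v : Vec} (h : IsLift x v) (φ : Vec →ₗ[ℝ] ℝ) :
    aff φ x = (φ v)⁻¹ • v := by
  obtain ⟨c, hc, e⟩ := h.exists_smul (isLift_rep x)
  rw [aff, e, map_smul, smul_eq_mul, smul_smul, mul_inv_rev, mul_assoc, inv_mul_cancel₀ hc,
    mul_one]

theorem tri_eq_zero_of_orthogonal_cross {x y z : RP2} {u v w : Vec} (hu : IsLift x u)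
    (hv : IsLift y v) (hw : IsLift z w) (hxy : x ≠ y) (h : orthogonal z (x.cross y)) :
    tri u v w = 0 := by
  obtain ⟨hu0, rfl⟩ := hu
  obtain ⟨hv0, rfl⟩ := hv
  obtain ⟨hw0, rfl⟩ := hw
  rw [cross_mk_of_ne hu0 hv0 hxy, orthogonal_mk] at h
  rw [← h, crossProduct]
  simp only [tri, dotProduct, Fin.sum_univ_three, LinearMap.mk₂_apply, Matrix.cons_val]
  ring

/-- Reducing indices modulo `n` permutes a triple cyclically, which preserves the sign of a `3 × 3`
determinant. -/
theorem tri_pos_of_periodic {n : ℕ} {A : ℕ → Vec} (hper : ∀ i, A (i + n) = A i)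
    (h : ∀ i j l, i < j → j < l → l < n → 0 < tri (A i) (A j) (A l)) :
    ∀ i j l, i < j → j < l → l < i + n → 0 < tri (A i) (A j) (A l) := by
  intro i
  induction i using Nat.strong_induction_on with
  | _ i ih =>
    intro j l hij hjl hl
    rcases le_or_gt n i with hi | hi
    · obtain ⟨i, rfl⟩ := Nat.exists_eq_add_of_le' hi
      obtain ⟨j, rfl⟩ := Nat.exists_eq_add_of_le' (hi.trans hij.le)
      obtain ⟨l, rfl⟩ := Nat.exists_eq_add_of_le' (hi.trans (hij.trans hjl).le)
      rw [hper, hper, hper]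
      exact ih i (by omega) j l (by omega) (by omega) (by omega)
    rcases lt_or_ge l n with hln | hln
    · exact h i j l hij hjl hln
    obtain ⟨l, rfl⟩ := Nat.exists_eq_add_of_le' hln
    rcases lt_or_ge j n with hjn | hjn
    · rw [hper, ← tri_cycle, ← tri_cycle]
      exact h l i j (by omega) hij hjn
    · obtain ⟨j, rfl⟩ := Nat.exists_eq_add_of_le' hjn
      rw [hper, hper, ← tri_cycle]
      exact h j l i (by omega) (by omega) hi

/-- The product of the three hypotheses is `a ^ 3` times a square. This is where four vertices
matter: with three, two of the scale factors could be negative. -/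
theorem pos_of_triple_products {a b c d : ℝ} (h1 : 0 < a * b * c) (h2 : 0 < a * b * d)
    (h3 : 0 < a * c * d) : 0 < a := by
  have h : 0 < a ^ 3 * (b * c * d) ^ 2 := by
    have := mul_pos (mul_pos h1 h2) h3
    calc 0 < a * b * c * (a * b * d) * (a * c * d) := this
      _ = _ := by ring
  exact (Odd.pow_pos_iff (by decide : Odd 3)).1 (pos_of_mul_pos_left h (sq_nonneg _))

/-- Proportional positively oriented polygons with at least four vertices have positive ratios. -/
theorem scale_pos {n : ℕ} (hn : 4 ≤ n) {u w : ℕ → Vec} {s : ℕ → ℝ}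
    (e : ∀ i < n, u i = s i • w i)
    (hu : ∀ i j l, i < j → j < l → l < n → 0 < tri (u i) (u j) (u l))
    (hw : ∀ i j l, i < j → j < l → l < n → 0 < tri (w i) (w j) (w l)) :
    ∀ i < n, 0 < s i := by
  have key : ∀ i j l, i < j → j < l → l < n → 0 < s i * s j * s l := by
    intro i j l hij hjl hl
    have h1 := hu i j l hij hjl hl
    have h2 := hw i j l hij hjl hl
    rw [e i (by omega), e j (by omega), e l hl, tri_smul_left, tri_smul_mid, tri_smul_right] at h1
    refine pos_of_mul_pos_left (b := tri (w i) (w j) (w l)) ?_ h2.le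
    linarith
  have k012 := key 0 1 2 (by omega) (by omega) (by omega)
  have k013 := key 0 1 3 (by omega) (by omega) (by omega)
  have k023 := key 0 2 3 (by omega) (by omega) (by omega)
  have k123 := key 1 2 3 (by omega) (by omega) (by omega)
  have p0 : 0 < s 0 := pos_of_triple_products k012 k013 k023
  have p1 : 0 < s 1 := pos_of_triple_products (b := s 0) (c := s 2) (d := s 3)
    (by linarith) (by linarith) k123
  intro i hi
  rcases i with _ | _ | i
  · exact p0
  · exact p1
  · exact pos_of_mul_pos_right (key 0 1 (i + 2) (by omega) (by omega) hi) (mul_pos p0 p1).le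

/-! ### Coherent lifts of the seeds -/

section Seed

variable {n k : ℕ} {P : ℤ → RP2}

/-- The vertices of the polygon of the seed at `P q` in the chart `φ`, continued periodically. -/
noncomputable def seedVec (n k : ℕ) (P : ℤ → RP2) (φ : Vec →ₗ[ℝ] ℝ) (q : ℤ) (i : ℕ) : Vec :=
  aff φ (seedA n k P q (i % n + 1))

theorem seedVec_periodic (φ : Vec →ₗ[ℝ] ℝ) (q : ℤ) (i : ℕ) :
    seedVec n k P φ q (i + n) = seedVec n k P φ q i := by
  simp only [seedVec, Nat.add_mod_right]

theorem seedVec_mod (φ : Vec →ₗ[ℝ] ℝ) (q : ℤ) (i : ℕ) :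
    seedVec n k P φ q (i % n) = seedVec n k P φ q i := by
  simp only [seedVec, Nat.mod_mod]

variable {φ : Vec →ₗ[ℝ] ℝ} {q : ℤ}

theorem seedVec_isLift (hn : 0 < n)
    (h : IsSeedChart φ n k (seedA n k P q) (seedB n P q)) (i : ℕ) :
    IsLift (seedA n k P q (i % n + 1)) (seedVec n k P φ q i) :=
  isLift_aff (h.1 _ (Nat.le_add_left 1 _) (Nat.mod_lt i hn))

theorem map_seedVec (hn : 0 < n)
    (h : IsSeedChart φ n k (seedA n k P q) (seedB n P q)) (i : ℕ) :
    φ (seedVec n k P φ q i) = 1 :=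
  map_aff (h.1 _ (Nat.le_add_left 1 _) (Nat.mod_lt i hn))

theorem seedVec_pos_of_lt
    (h : IsSeedChart φ n k (seedA n k P q) (seedB n P q)) (i j l : ℕ) (hij : i < j) (hjl : j < l)
    (hl : l < n) :
    0 < tri (seedVec n k P φ q i) (seedVec n k P φ q j) (seedVec n k P φ q l) := by
  have := h.2.1 (i + 1) (j + 1) (l + 1) (by omega) (by omega) (by omega) (by omega)
  rw [det_eq_tri] at this
  simpa only [seedVec, Nat.mod_eq_of_lt hl, Nat.mod_eq_of_lt (hjl.trans hl),
    Nat.mod_eq_of_lt (hij.trans (hjl.trans hl))] using this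

theorem seedVec_pos
    (h : IsSeedChart φ n k (seedA n k P q) (seedB n P q)) (i j l : ℕ) (hij : i < j) (hjl : j < l)
    (hl : l < i + n) :
    0 < tri (seedVec n k P φ q i) (seedVec n k P φ q j) (seedVec n k P φ q l) :=
  tri_pos_of_periodic (seedVec_periodic φ q) (seedVec_pos_of_lt h) i j l hij hjl hl

theorem IsPLCSpiral.seedA_succ_of_lt {i : ℕ} (hi : i < n - k) :
    seedA n k P (q + 1) (i + 1) = seedA n k P q (i + 1 + 1) := by
  rw [seedA, seedA, if_pos (by omega), if_pos (by omega)]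
  congr 1
  push_cast
  ring

theorem IsPLCSpiral.seedA_succ_of_ge (hP : IsPLCSpiral n k P) {i : ℕ} (hi : n - k ≤ i)
    (hin : i < n) : seedA n k P (q + 1) (i + 1) = seedB n P q (i + 1) := by
  have hk := hP.lt
  rw [seedA, seedB]
  rcases hi.eq_or_lt with rfl | hi
  · rw [if_pos le_rfl, show n + 1 - (n - k + 1) = k by omega, hP.periodic]
    congr 1
    rw [Nat.cast_succ, Nat.cast_sub hk.le]
    ring
  · rw [if_neg (by omega)]

/-- The polygon at `P (q+1)` in a chart of the seed at `P q`. -/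
theorem IsPLCSpiral.exists_next_coeff (hP : IsPLCSpiral n k P)
    (h : IsSeedChart φ n k (seedA n k P q) (seedB n P q)) {i : ℕ} (hin : i < n) :
    ∃ α β : ℝ, 0 ≤ α ∧ 0 < β ∧ (i < n - k → α = 0) ∧ (n - k ≤ i → 0 < α) ∧
      IsLift (seedA n k P (q + 1) (i + 1))
        (α • seedVec n k P φ q i + β • seedVec n k P φ q (i + 1)) := by
  have hk := hP.lt
  have hk1 := hP.one_le
  rcases lt_or_ge i (n - k) with hi | hi
  · refine ⟨0, 1, le_rfl, one_pos, fun _ => rfl, fun h => absurd h (by omega), ?_⟩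
    rw [zero_smul, one_smul, zero_add, IsPLCSpiral.seedA_succ_of_lt hi]
    have := seedVec_isLift (by omega) h (i + 1)
    rwa [Nat.mod_eq_of_lt (show i + 1 < n by omega)] at this
  · obtain ⟨hB, α, β, hα, hβ, -, e⟩ := h.2.2 (i + 1) (by omega) (by omega)
    refine ⟨α, β, hα.le, hβ, fun h => absurd h (by omega), fun _ => hα, ?_⟩
    rw [hP.seedA_succ_of_ge hi hin]
    have e1 : seedVec n k P φ q i = aff φ (seedA n k P q (i + 1)) := by
      rw [seedVec, Nat.mod_eq_of_lt hin]
    have e2 : seedVec n k P φ q (i + 1) =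
        aff φ (seedA n k P q (if i + 1 = n then 1 else i + 1 + 1)) := by
      rw [seedVec]
      split_ifs with h1
      · rw [h1, Nat.mod_self]
      · rw [Nat.mod_eq_of_lt (by omega)]
    rw [e1, e2, e]
    exact isLift_aff hB

/-- The seeds at `P q` and `P (q+1)` are positive combinations with respect to
any charts. -/
theorem IsPLCSpiral.exists_step (hP : IsPLCSpiral n k P)
    (h : IsSeedChart φ n k (seedA n k P q) (seedB n P q)) {ψ : Vec →ₗ[ℝ] ℝ}
    (h' : IsSeedChart ψ n k (seedA n k P (q + 1)) (seedB n P (q + 1))) {i : ℕ} (hin : i < n) :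
    ∃ α β : ℝ, 0 ≤ α ∧ 0 < β ∧ (i < n - k → α = 0) ∧ (n - k ≤ i → 0 < α) ∧
      seedVec n k P ψ (q + 1) i =
        α • seedVec n k P φ q i + β • seedVec n k P φ q (i + 1) := by
  have hn := hP.four_le
  choose! α β hα hβ hα0 hαp hl using fun i (hi : i < n) => hP.exists_next_coeff h hi
  set A := seedVec n k P φ q with hA
  have hlift : ∀ i < n, IsLift (seedA n k P (q + 1) (i + 1)) (seedVec n k P ψ (q + 1) i) :=
    fun i hi => by
      have := seedVec_isLift (by omega) h' i
      rwa [Nat.mod_eq_of_lt hi] at this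
  choose! s hs e using fun i hi => (hlift i hi).exists_smul (hl i hi)
  have hweak : ∀ i j l, i ≤ j → j ≤ l → l ≤ i + n → 0 ≤ tri (A i) (A j) (A l) := by
    intro i j l hij hjl hl
    rcases hij.eq_or_lt with rfl | hij
    · simp
    rcases hjl.eq_or_lt with rfl | hjl
    · simp
    rcases hl.eq_or_lt with rfl | hl
    · simp [hA, seedVec_periodic]
    exact (seedVec_pos h i j l hij hjl hl).le
  have hpos := scale_pos hn e (seedVec_pos_of_lt h') fun i j l hij hjl hl => by
    have a1 := hα i (by omega)
    have a2 := hα j (by omega)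
    have a3 := hα l hl
    have b1 := hβ i (by omega)
    have b2 := hβ j (by omega)
    have b3 := hβ l hl
    have t1 := hweak i j l (by omega) (by omega) (by omega)
    have t2 := hweak i j (l + 1) (by omega) (by omega) (by omega)
    have t3 := hweak i (j + 1) l (by omega) (by omega) (by omega)
    have t4 := hweak i (j + 1) (l + 1) (by omega) (by omega) (by omega)
    have t5 := hweak (i + 1) j l (by omega) (by omega) (by omega)
    have t6 := hweak (i + 1) j (l + 1) (by omega) (by omega) (by omega)
    have t7 := hweak (i + 1) (j + 1) l (by omega) (by omega) (by omega)
    -- Of the eight terms of the expanded determinant only this one has to be strictly positive: its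
    -- three weights `β` never vanish.
    have t8 := seedVec_pos h (i + 1) (j + 1) (l + 1) (by omega) (by omega) (by omega)
    rw [← hA] at t8
    simp only [tri_add_left, tri_add_mid, tri_add_right, tri_smul_left, tri_smul_mid,
      tri_smul_right]
    positivity
  have hsi := hpos i hin
  refine ⟨s i * α i, s i * β i, mul_nonneg hsi.le (hα i hin), mul_pos hsi (hβ i hin),
    fun hi => by rw [hα0 i hin hi, mul_zero], fun hi => mul_pos hsi (hαp i hin hi), ?_⟩
  rw [e i hin]
  module

theorem IsPLCSpiral.seedVec_chart_pos (hP : IsPLCSpiral n k P)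
    (h : IsSeedChart φ n k (seedA n k P q) (seedB n P q)) {ψ : Vec →ₗ[ℝ] ℝ}
    (h' : IsSeedChart ψ n k (seedA n k P q) (seedB n P q)) (i : ℕ) :
    0 < ψ (seedVec n k P φ q i) := by
  have hn := hP.four_le
  choose s hs e using fun i =>
    (seedVec_isLift (by omega) h i).exists_smul (seedVec_isLift (by omega) h' i)
  have hpos := scale_pos hn (fun i _ => e i) (seedVec_pos_of_lt h) (seedVec_pos_of_lt h')
  rw [← seedVec_mod, e, map_smul, map_seedVec (by omega) h', smul_eq_mul, mul_one]
  exact hpos _ (Nat.mod_lt i (by omega))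

theorem IsPLCSpiral.seedVec_isLift_iter (hP : IsPLCSpiral n k P)
    (h : IsSeedChart φ n k (seedA n k P q) (seedB n P q)) {j : ℕ} (hj : j ≤ k) :
    IsLift (iter P j q) (seedVec n k P φ q (n - j)) := by
  have hk := hP.lt
  have h1 := seedVec_isLift (by omega) h (n - j)
  convert h1 using 1
  rcases Nat.eq_zero_or_pos j with rfl | hj0
  · rw [Nat.sub_zero, Nat.mod_self, seedA, if_pos (by omega)]
    simp [iter]
  rw [Nat.mod_eq_of_lt (by omega), seedA]
  rcases hj.eq_or_lt with rfl | hj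
  · rw [if_pos le_rfl, hP.periodic]
    simp only
    congr 1
    rw [Nat.cast_succ, Nat.cast_sub hk.le]
    ring
  · rw [if_neg (by omega), show n + 1 - (n - j + 1) = j by omega]

end Seed

/-- Homogeneous coordinates with coherent signs for the seeds of a spiral. -/
structure SpiralLift (n k : ℕ) (P : ℤ → RP2) (a : ℤ → ℕ → Vec) : Prop where
  convex : ConvexSpiral n k a
  lift_iter : ∀ q, ∀ j ≤ k, IsLift (iter P j q) (a q (n - j))
  lift_succ : ∀ q, IsLift (P (q + 1)) (a q 1)
  exists_chart : ∀ q, ∃ φ, IsSeedChart φ n k (seedA n k P q) (seedB n P q)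
  chart_pos : ∀ q φ, IsSeedChart φ n k (seedA n k P q) (seedB n P q) → ∀ i, 0 < φ (a q i)

theorem SpiralLift.congr {n k : ℕ} {P : ℤ → RP2} {a A : ℤ → ℕ → Vec} (h : SpiralLift n k P a)
    (hA : ConvexSpiral n k A) (e : ∀ q i, ∃ t : ℝ, 0 < t ∧ A q i = t • a q i) :
    SpiralLift n k P A where
  convex := hA
  lift_iter q j hj := by
    obtain ⟨t, ht, e⟩ := e q (n - j)
    rw [e]
    exact (h.lift_iter q j hj).smul ht.ne'
  lift_succ q := by
    obtain ⟨t, ht, e⟩ := e q 1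
    rw [e]
    exact (h.lift_succ q).smul ht.ne'
  exists_chart := h.exists_chart
  chart_pos q φ hφ i := by
    obtain ⟨t, ht, e⟩ := e q i
    rw [e, map_smul, smul_eq_mul]
    exact mul_pos ht (h.chart_pos q φ hφ i)

theorem IsPLCSpiral.exists_spiralLift {n k : ℕ} {P : ℤ → RP2} (hP : IsPLCSpiral n k P) :
    ∃ a, SpiralLift n k P a := by
  have hn := hP.four_le
  have hk := hP.lt
  have hk1 := hP.one_le
  choose φ hφ using hP.seed
  have hstep : ∀ q, ∀ i < n, ∃ α β : ℝ, 0 ≤ α ∧ 0 < β ∧ (i < n - k → α = 0) ∧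
      (n - k ≤ i → 0 < α) ∧ seedVec n k P (φ (q + 1)) (q + 1) i =
        α • seedVec n k P (φ q) q i + β • seedVec n k P (φ q) q (i + 1) :=
    fun q i hi => hP.exists_step (hφ q) (hφ (q + 1)) hi
  refine ⟨fun q => seedVec n k P (φ q) q, ⟨hn, hk1, hk, fun q => seedVec_periodic _ q,
    fun q => seedVec_pos (hφ q), fun q i => ?_, fun q i hi hin => ?_, fun q i hi => ?_,
    fun q i hi hin => ?_⟩, fun q j hj => hP.seedVec_isLift_iter (hφ q) hj, fun q => ?_,
    hP.seed, fun q ψ hψ i => hP.seedVec_chart_pos (hφ q) hψ i⟩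
  · obtain ⟨α, β, hα, hβ, -, -, e⟩ := hstep q (i % n) (Nat.mod_lt i (by omega))
    refine ⟨α, β, hα, hβ, ?_⟩
    rwa [seedVec_mod, seedVec_mod, ← seedVec_mod _ q (i % n + 1), Nat.mod_add_mod,
      seedVec_mod] at e
  · obtain ⟨α, β, hα, hβ, -, hαp, e⟩ := hstep q i hin
    exact ⟨α, β, hαp hi, hβ, e⟩
  · obtain ⟨α, β, hα, hβ, hα0, -, e⟩ := hstep q i (by omega)
    rw [hα0 hi, zero_smul, zero_add] at e
    exact ⟨β, hβ, e⟩
  -- By definition of the pentagram map, the new point at label `q + 2` lies on the diagonal from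
  -- label `q` to label `q + 2` of the path `T^j(P)`.
  · obtain ⟨j, hj, rfl⟩ : ∃ j < k, i = n - (j + 1) := ⟨n - i - 1, by omega, by omega⟩
    have hdef := hP.defined j hj (q + 2)
    rw [show q + 2 - 2 = q by ring] at hdef
    rw [show n - (j + 1) + 1 = n - j by omega]
    refine tri_eq_zero_of_orthogonal_cross (hP.seedVec_isLift_iter (hφ q) hj.le)
      (hP.seedVec_isLift_iter (hφ (q + 2)) hj.le)
      (hP.seedVec_isLift_iter (hφ (q + 2)) (j := j + 1) hj) hdef.1 ?_
    have e : iter P (j + 1) (q + 2) = ((iter P j (q + 2 - 3)).cross (iter P j (q + 2 - 1))).cross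
        ((iter P j q).cross (iter P j (q + 2))) := by
      rw [iter, Function.iterate_succ_apply', pentagramMap, show q + 2 - 2 = q by ring]
    rw [e]
    exact cross_orthogonal_right hdef.2
  · have := seedVec_isLift (by omega) (hφ q) 1
    rw [Nat.mod_eq_of_lt (by omega), seedA, if_pos (by omega)] at this
    convert this using 1
    congr 1
    push_cast
    ring


open Projectivization Filter Topology

/-! ### Topology of the projective plane -/

theorem isOpen_setOf_rep {F : Vec → ℝ} (hF : Continuous F)
    (hs : ∀ c : ℝ, c ≠ 0 → ∀ v, 0 < F v → 0 < F (c • v)) : IsOpen {x : RP2 | 0 < F x.rep} := by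
  have e : (fun v : {v : Vec // v ≠ 0} => Projectivization.mk ℝ v.1 v.2) ⁻¹'
      {x : RP2 | 0 < F x.rep} = {v | 0 < F v.1} := by
    ext v
    obtain ⟨c, hc, e⟩ := (isLift_mk v.1 v.2).exists_smul (isLift_rep _)
    obtain ⟨c', hc', e'⟩ := (isLift_rep _).exists_smul (isLift_mk v.1 v.2)
    constructor
    · intro h
      change 0 < F v.1
      rw [e]
      exact hs c hc _ h
    · intro h
      change 0 < F _
      rw [e']
      exact hs c' hc' _ h
  rw [isOpen_coinduced, e]
  exact isOpen_lt continuous_const (hF.comp continuous_subtype_val)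

theorem IsLift.pos_rep_iff {x : RP2} {v : Vec} (h : IsLift x v) {F : Vec → ℝ}
    (hs : ∀ c : ℝ, c ≠ 0 → ∀ v, 0 < F v → 0 < F (c • v)) : 0 < F x.rep ↔ 0 < F v := by
  obtain ⟨c, hc, e⟩ := h.exists_smul (isLift_rep x)
  obtain ⟨c', hc', e'⟩ := (isLift_rep x).exists_smul h
  constructor
  · intro h
    rw [e]
    exact hs c hc _ h
  · intro h
    rw [e']
    exact hs c' hc' _ h

/-- Open sets of the quotient pull back to open sets of vectors, so approximation can be checked on
lifts. -/
theorem IsLift.mem_closure {x : RP2} {v : Vec} (h : IsLift x v) {s : Set RP2}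
    (hs : ∃ᶠ w in 𝓝 v, ∃ y ∈ s, IsLift y w) : x ∈ closure s := by
  rw [mem_closure_iff]
  intro U hU hx
  obtain ⟨hv, rfl⟩ := h
  obtain ⟨O, hO, e⟩ := isOpen_induced_iff.1 (isOpen_coinduced.1 hU)
  have hvO : v ∈ O := by
    have : (⟨v, hv⟩ : {v : Vec // v ≠ 0}) ∈ Subtype.val ⁻¹' O := by rw [e]; exact hx
    exact this
  obtain ⟨w, ⟨y, hy, hw, rfl⟩, hwO⟩ := (hs.and_eventually (hO.mem_nhds hvO)).exists
  refine ⟨_, ?_, hy⟩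
  have : (⟨w, hw⟩ : {v : Vec // v ≠ 0}) ∈ Subtype.val ⁻¹' O := hwO
  rw [e] at this
  exact this

/-! ### Convex hulls in homogeneous coordinates -/

/-- When the chart is positive on the lifts, the hull is the projectivized cone over them. The
description no longer mentions `φ`, so the chart drops out of edges and triangles. -/
theorem mem_hullIn_triple {φ : Vec →ₗ[ℝ] ℝ} {x y z : RP2} {u v w : Vec} (hx : IsLift x u)
    (hy : IsLift y v) (hz : IsLift z w) (hu : 0 < φ u) (hv : 0 < φ v) (hw : 0 < φ w) (o : RP2) :
    o ∈ hullIn φ {x, y, z} ↔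
      ∃ r s t : ℝ, 0 ≤ r ∧ 0 ≤ s ∧ 0 ≤ t ∧ IsLift o (r • u + s • v + t • w) := by
  have himg : aff φ '' {x, y, z} = {(φ u)⁻¹ • u, (φ v)⁻¹ • v, (φ w)⁻¹ • w} := by
    rw [Set.image_insert_eq, Set.image_pair, hx.aff_eq, hy.aff_eq, hz.aff_eq]
  constructor
  · rintro ⟨h0, h⟩
    rw [himg, convexHull_insert (Set.insert_nonempty _ _), convexHull_pair, mem_convexJoin] at h
    obtain ⟨_, rfl, m, ⟨b, c, hb, hc, -, rfl⟩, ⟨d, e, hd, he, -, hde⟩⟩ := h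
    refine ⟨d * (φ u)⁻¹, e * (b * (φ v)⁻¹), e * (c * (φ w)⁻¹), by positivity, by positivity,
      by positivity, ?_⟩
    convert isLift_aff h0 using 1
    rw [← hde]
    module
  · rintro ⟨r, s, t, hr, hs, ht, ho⟩
    have hm : φ (r • u + s • v + t • w) = r * φ u + s * φ v + t * φ w := by simp
    have hpos : 0 < r * φ u + s * φ v + t * φ w := by
      have h1 : 0 ≤ r * φ u := by positivity
      have h2 : 0 ≤ s * φ v := by positivity
      have h3 : 0 ≤ t * φ w := by positivity
      refine lt_of_le_of_ne (by positivity) fun h => ho.ne_zero ?_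
      have r0 : r = 0 := (mul_eq_zero.1 (by linarith : r * φ u = 0)).resolve_right hu.ne'
      have s0 : s = 0 := (mul_eq_zero.1 (by linarith : s * φ v = 0)).resolve_right hv.ne'
      have t0 : t = 0 := (mul_eq_zero.1 (by linarith : t * φ w = 0)).resolve_right hw.ne'
      simp [r0, s0, t0]
    refine ⟨(ho.map_rep_ne_zero_iff φ).2 (by rw [hm]; exact hpos.ne'), ?_⟩
    rw [himg, ho.aff_eq, hm]
    set m := r * φ u + s * φ v + t * φ w
    set S : Set Vec := {(φ u)⁻¹ • u, (φ v)⁻¹ • v, (φ w)⁻¹ • w}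
    have key := (convex_convexHull ℝ S).sum_mem (t := Finset.univ)
      (w := ![r * φ u / m, s * φ v / m, t * φ w / m])
      (z := ![(φ u)⁻¹ • u, (φ v)⁻¹ • v, (φ w)⁻¹ • w])
      (fun i _ => by fin_cases i <;> simp <;> positivity)
      (by
        simp only [Fin.sum_univ_three, Matrix.cons_val]
        rw [← add_div, ← add_div]
        exact div_self hpos.ne')
      (fun i _ => subset_convexHull ℝ S (by fin_cases i <;> simp [S]))
    convert key using 1
    simp only [Fin.sum_univ_three, Matrix.cons_val, smul_add, smul_smul]
    rw [show m⁻¹ * r = r * φ u / m * (φ u)⁻¹ by field_simp,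
      show m⁻¹ * s = s * φ v / m * (φ v)⁻¹ by field_simp,
      show m⁻¹ * t = t * φ w / m * (φ w)⁻¹ by field_simp]

theorem mem_hullIn_pair {φ : Vec →ₗ[ℝ] ℝ} {x y : RP2} {u v : Vec} (hx : IsLift x u)
    (hy : IsLift y v) (hu : 0 < φ u) (hv : 0 < φ v) (o : RP2) :
    o ∈ hullIn φ {x, y} ↔ ∃ r s : ℝ, 0 ≤ r ∧ 0 ≤ s ∧ IsLift o (r • u + s • v) := by
  have := mem_hullIn_triple hx hy hy hu hv hv o
  rw [Set.pair_eq_singleton] at this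
  rw [this]
  constructor
  · rintro ⟨r, s, t, hr, hs, ht, h⟩
    refine ⟨r, s + t, hr, add_nonneg hs ht, ?_⟩
    rwa [add_smul, ← add_assoc]
  · rintro ⟨r, s, hr, hs, h⟩
    exact ⟨r, s, 0, hr, hs, le_rfl, by rwa [zero_smul, add_zero]⟩

/-! ### Polygons as intersections of half planes -/

namespace ConvexSpiral

variable {n k : ℕ} {a : ℤ → ℕ → Vec}

/-- A vector on the inner side of all edges of a polygon is in the cone over the polygon. -/
theorem map_nonneg_of_inside (h : ConvexSpiral n k a) {q : ℤ} {x : Vec}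
    (hx : ∀ i < n, 0 ≤ tri (a q i) (a q (i + 1)) x) {f : Vec →ₗ[ℝ] ℝ}
    (hf : ∀ i, 0 ≤ f (a q i)) : 0 ≤ f x := by
  have h4 := h.four_le
  have hlast : tri (a q 0) (a q (n - 1)) x ≤ 0 := by
    have := hx (n - 1) (by omega)
    rw [show n - 1 + 1 = n by omega, h.apply_self, tri_swap] at this
    linarith
  -- The polygon is cut into a fan of triangles at vertex `0`; a sign change of `tri (a q 0) (a q l)
  -- x` in `l` selects the triangle containing `x`.
  obtain ⟨l, hl1, hl2, e1, e2⟩ : ∃ l, 1 ≤ l ∧ l + 1 < n ∧ 0 ≤ tri (a q 0) (a q l) x ∧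
      tri (a q 0) (a q (l + 1)) x ≤ 0 := by
    by_contra! hcon
    have : ∀ l, 1 ≤ l → l < n → 0 ≤ tri (a q 0) (a q l) x ∧
        (1 < l → 0 < tri (a q 0) (a q l) x) := by
      intro l hl
      induction l, hl using Nat.le_induction with
      | base => exact fun _ => ⟨hx 0 (by omega), fun h => absurd h (by omega)⟩
      | succ l hl ih =>
        intro hln
        have := hcon l hl hln (ih (by omega)).1
        exact ⟨this.le, fun _ => this⟩
    have := (this (n - 1) (by omega) (by omega)).2 (by omega)
    linarith
  have hΔ := h.pos q 0 l (l + 1) (by omega) (by omega) (by omega)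
  have e3 : 0 ≤ tri x (a q l) (a q (l + 1)) := by
    rw [← tri_cycle]
    exact hx l (by omega)
  have e4 : 0 ≤ tri (a q 0) x (a q (l + 1)) := by
    rw [tri_swap_right]
    linarith
  rw [eq_of_tri_ne_zero hΔ.ne' x]
  simp only [map_add, map_smul, smul_eq_mul]
  have f1 := hf 0
  have f2 := hf l
  have f3 := hf (l + 1)
  positivity

/-- The part of a polygon outside the next polygon consists of the corners that are cut off. -/
theorem exists_corner (h : ConvexSpiral n k a) {q : ℤ} {x : Vec}
    (hx : ∀ i < n, 0 ≤ tri (a q i) (a q (i + 1)) x)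
    (hx' : ∃ i < n, tri (a (q + 1) i) (a (q + 1) (i + 1)) x < 0) :
    ∃ i, n - k ≤ i ∧ i < n ∧ ∃ r s t : ℝ, 0 ≤ r ∧ 0 ≤ s ∧ 0 ≤ t ∧
      x = r • a (q + 1) i + s • a q (i + 1) + t • a (q + 1) (i + 1) := by
  have h4 := h.four_le
  have hk := h.one_le
  obtain ⟨i, hin, hi⟩ := hx'
  obtain ⟨α', β', hα', hβ', e2⟩ := h.step q (i + 1)
  have hx2 : 0 ≤ tri (a q (i + 1)) (a q (i + 2)) x := by
    have := hx ((i + 1) % n) (h.mod_lt _)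
    rwa [h.apply_mod, ← h.apply_mod q ((i + 1) % n + 1), Nat.mod_add_mod, h.apply_mod] at this
  rcases lt_or_ge i (n - k) with hik | hik
  -- Here the new edge lies along the old edge from `i + 1` to `i + 2`, so `x` cannot be on its
  -- outer side.
  · exfalso
    obtain ⟨β, hβ, e1⟩ := h.shift q i hik
    rw [e2, e1, tri_smul_left, tri_add_mid, tri_smul_mid, tri_smul_mid, tri_self_left] at hi
    have : 0 ≤ β * (α' * 0 + β' * tri (a q (i + 1)) (a q (i + 2)) x) := by positivity
    exact absurd hi (not_lt.2 this)
  · obtain ⟨α, β, hα, hβ, e1⟩ := h.cut q i hik hin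
    refine ⟨i, hik, hin, ?_⟩
    have p012 := h.pos q i (i + 1) (i + 2) (by omega) (by omega) (by omega)
    have hΔ : 0 < tri (a (q + 1) i) (a q (i + 1)) (a (q + 1) (i + 1)) := by
      rw [e1, e2]
      simp only [tri_add_left, tri_add_right, tri_smul_left, tri_smul_right, tri_self_left,
        tri_self_right]
      have : 0 < α * β' * tri (a q i) (a q (i + 1)) (a q (i + 2)) := by positivity
      linarith
    refine ⟨_, _, _, ?_, ?_, ?_, eq_of_tri_ne_zero hΔ.ne' x⟩
    · refine div_nonneg ?_ hΔ.le
      rw [← tri_cycle, e2, tri_add_mid, tri_smul_mid, tri_smul_mid, tri_self_left, mul_zero,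
        zero_add]
      exact mul_nonneg hβ'.le hx2
    · refine div_nonneg ?_ hΔ.le
      rw [tri_swap_right]
      linarith
    · refine div_nonneg ?_ hΔ.le
      have := hx i hin
      rw [e1, tri_add_left, tri_smul_left, tri_smul_left, tri_self_left, mul_zero, add_zero]
      positivity

end ConvexSpiral


/-! ### Inward and outward limit sets -/

theorem mem_limitSet {f : Filter ℤ} {n k : ℕ} {P : ℤ → RP2} {x : RP2} :
    x ∈ limitSet f n k P ↔ ∀ u ∈ f, x ∈ closure (⋃ q ∈ u, edge n k P q) := by
  simp only [limitSet, Set.mem_iInter]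

theorem limitSet_sup (f f' : Filter ℤ) (n k : ℕ) (P : ℤ → RP2) :
    limitSet (f ⊔ f') n k P = limitSet f n k P ∪ limitSet f' n k P := by
  ext x
  simp only [Set.mem_union, mem_limitSet]
  constructor
  · intro h
    by_contra! hcon
    obtain ⟨⟨u, hu, hxu⟩, u', hu', hxu'⟩ := hcon
    have := h (u ∪ u') ⟨mem_of_superset hu Set.subset_union_left,
      mem_of_superset hu' Set.subset_union_right⟩
    rw [Set.biUnion_union, closure_union] at this
    exact this.elim hxu hxu'
  · rintro (h | h) u hu
    · exact h u hu.1
    · exact h u hu.2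

theorem mul_pos_smul_of_linear {f g : Vec →ₗ[ℝ] ℝ} (c : ℝ) (hc : c ≠ 0) (v : Vec)
    (h : 0 < f v * g v) : 0 < f (c • v) * g (c • v) := by
  rw [map_smul, map_smul, smul_eq_mul, smul_eq_mul,
    show c * f v * (c * g v) = c ^ 2 * (f v * g v) by ring]
  exact mul_pos (by positivity) h

namespace SpiralLift

variable {n k : ℕ} {P : ℤ → RP2} {a : ℤ → ℕ → Vec}

theorem lift_zero (h : SpiralLift n k P a) (q : ℤ) : IsLift (P q) (a q 0) := by
  have := h.lift_iter q 0 (Nat.zero_le k)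
  rwa [Nat.sub_zero, h.convex.apply_self] at this

theorem mem_edge (h : SpiralLift n k P a) (q : ℤ) (x : RP2) :
    x ∈ edge n k P q ↔
      ∃ r s : ℝ, 0 ≤ r ∧ 0 ≤ s ∧ IsLift x (r • a q 0 + s • a q 1) := by
  constructor
  · rintro ⟨φ, hφ, hx⟩
    have := h.chart_pos q φ hφ
    exact (mem_hullIn_pair (h.lift_zero q) (h.lift_succ q) (this 0) (this 1) x).1 hx
  · intro hx
    obtain ⟨φ, hφ⟩ := h.exists_chart q
    have := h.chart_pos q φ hφ
    exact ⟨φ, hφ, (mem_hullIn_pair (h.lift_zero q) (h.lift_succ q) (this 0) (this 1) x).2 hx⟩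

variable {g : Vec →ₗ[ℝ] ℝ} {p : Vec}

theorem limitSet_atTop (h : SpiralLift n k P a) (hL : IsLimitPair a g p) (hp : p ≠ 0) :
    limitSet atTop n k P = {Projectivization.mk ℝ p hp} := by
  refine Set.Subset.antisymm (fun x hx => ?_) ?_
  · by_contra hxp
    obtain ⟨f, hf⟩ : ∃ f : Vec →ₗ[ℝ] ℝ, f x.rep ≠ f p * g x.rep := by
      by_contra! hcon
      apply hxp
      have e : x.rep = g x.rep • p := by
        ext c
        simpa [mul_comm] using hcon (LinearMap.proj c)
      rw [Set.mem_singleton_iff, ← mk_rep x, mk_eq_mk_iff']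
      exact ⟨_, e.symm⟩
    set f' := f - f p • g with hf'
    have hf'x : f' x.rep ≠ 0 := by simpa [hf', sub_eq_zero] using hf
    set ε := |f' x.rep| / (2 * (|g x.rep| + 1)) with hε
    have hε0 : 0 < ε := by positivity
    obtain ⟨N, hN⟩ := hL.tendsto f ε hε0
    -- `F > 0` means `|f'| > ε |g|`. Squaring makes the condition independent of the lift, so it
    -- defines an open neighbourhood of `x`, which the edges from label `N` on avoid.
    set F : Vec → ℝ := fun w => (f' w) ^ 2 - ε ^ 2 * (g w) ^ 2 with hF
    have hFs : ∀ c : ℝ, c ≠ 0 → ∀ v, 0 < F v → 0 < F (c • v) := by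
      intro c hc v hv
      have e : F (c • v) = c ^ 2 * F v := by
        simp only [hF, map_smul, smul_eq_mul]
        ring
      rw [e]
      exact mul_pos (by positivity) hv
    have hFc : Continuous F := by
      have h1 := f'.continuous_of_finiteDimensional
      have h2 := g.continuous_of_finiteDimensional
      fun_prop
    have hxF : 0 < F x.rep := by
      have h1 : ε * |g x.rep| < |f' x.rep| := by
        rw [hε, div_mul_eq_mul_div, div_lt_iff₀ (by positivity)]
        have := abs_pos.2 hf'x
        nlinarith [abs_nonneg (g x.rep)]
      have h2 : (ε * |g x.rep|) ^ 2 < |f' x.rep| ^ 2 := by gcongr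
      rw [mul_pow, sq_abs, sq_abs] at h2
      exact sub_pos.2 h2
    have hx' := mem_limitSet.1 hx (Set.Ici N) (Ici_mem_atTop N)
    obtain ⟨y, hyF, hy⟩ := mem_closure_iff.1 hx' _ (isOpen_setOf_rep hFc hFs) hxF
    simp only [Set.mem_iUnion, Set.mem_Ici] at hy
    obtain ⟨q, hq, hy⟩ := hy
    obtain ⟨r, s, hr, hs, hl⟩ := (h.mem_edge q y).1 hy
    have hyF' : 0 < F (r • a q 0 + s • a q 1) := (hl.pos_rep_iff hFs).1 hyF
    have b0 := hN q hq 0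
    have b1 := hN q hq 1
    have g0 := hL.g_pos q 0
    have g1 := hL.g_pos q 1
    have hle : |f' (r • a q 0 + s • a q 1)| ≤ ε * g (r • a q 0 + s • a q 1) := by
      calc _ = |r * (f (a q 0) - f p * g (a q 0)) + s * (f (a q 1) - f p * g (a q 1))| := by
            congr 1
            simp [hf']
            ring
        _ ≤ r * |f (a q 0) - f p * g (a q 0)| + s * |f (a q 1) - f p * g (a q 1)| := by
          refine (abs_add_le _ _).trans ?_
          rw [abs_mul, abs_mul, abs_of_nonneg hr, abs_of_nonneg hs]
        _ ≤ r * (ε * g (a q 0)) + s * (ε * g (a q 1)) := by gcongr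
        _ = _ := by
          simp
          ring
    have h2 := pow_le_pow_left₀ (abs_nonneg _) hle 2
    rw [mul_pow, sq_abs] at h2
    exact absurd hyF' (not_lt.2 (sub_nonpos.2 h2))
  · rw [Set.singleton_subset_iff, mem_limitSet]
    intro u hu
    refine (isLift_mk p hp).mem_closure ?_
    have ht : Tendsto (fun q => (g (a q 0))⁻¹ • a q 0) atTop (𝓝 p) := by
      rw [tendsto_pi_nhds]
      intro c
      rw [Metric.tendsto_atTop]
      intro ε hε
      obtain ⟨N, hN⟩ := hL.tendsto (LinearMap.proj c) (ε / 2) (by positivity)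
      refine ⟨N, fun q hq => ?_⟩
      have h1 := hN q hq 0
      have h2 := hL.g_pos q 0
      simp only [LinearMap.proj_apply] at h1
      rw [Real.dist_eq, Pi.smul_apply, smul_eq_mul,
        show (g (a q 0))⁻¹ * a q 0 c - p c = (g (a q 0))⁻¹ * (a q 0 c - p c * g (a q 0)) by
          field_simp, abs_mul, abs_of_pos (inv_pos.2 h2), inv_mul_lt_iff₀ h2]
      nlinarith
    refine ht.frequently (Eventually.frequently ?_)
    filter_upwards [hu] with q hq
    refine ⟨P q, ?_, (h.lift_zero q).smul (inv_ne_zero (hL.g_pos q 0).ne')⟩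
    simp only [Set.mem_iUnion]
    refine ⟨q, hq, (h.mem_edge q _).2 ⟨1, 0, zero_le_one, le_rfl, ?_⟩⟩
    rw [one_smul, zero_smul, add_zero]
    exact h.lift_zero q

theorem edge_functional_ne_zero (h : SpiralLift n k P a) (q : ℤ) (i : ℕ) :
    triL (a q i) (a q (i + 1)) ≠ 0 := fun e => by
  have h4 := h.convex.four_le
  have := h.convex.pos q i (i + 1) (i + 2) (by omega) (by omega) (by omega)
  rw [← triL_apply, e] at this
  exact lt_irrefl _ this

/-- A point off the line is interior to some polygon `N`, and edges at sufficiently early labels lie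
outside that polygon. -/
theorem limitSet_atBot_subset (h : SpiralLift n k P a) (hL : IsLimitPair a g p) :
    limitSet atBot n k P ⊆ {x | g x.rep = 0} := by
  intro x hx
  by_contra hgx
  obtain ⟨v, hv, hgv⟩ : ∃ v, IsLift x v ∧ 0 < g v := by
    refine ⟨(g x.rep)⁻¹ • x.rep, (isLift_rep x).smul (inv_ne_zero hgx), ?_⟩
    rw [map_smul, smul_eq_mul, inv_mul_cancel₀ hgx]
    exact one_pos
  obtain ⟨N, hN⟩ := hL.exhaust v hgv
  obtain ⟨M, hM⟩ := hL.later_pos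
  have hs : ∀ i, ∀ c : ℝ, c ≠ 0 → ∀ v, 0 < triL (a N i) (a N (i + 1)) v * g v →
      0 < triL (a N i) (a N (i + 1)) (c • v) * g (c • v) :=
    fun i c hc v hv => mul_pos_smul_of_linear c hc v hv
  have hU : IsOpen (⋂ i : Fin n, {y : RP2 | 0 < (fun w => triL (a N i) (a N (i + 1)) w * g w)
      y.rep}) := by
    refine isOpen_iInter_of_finite fun i => isOpen_setOf_rep ?_ (hs i)
    have h1 := (triL (a N i) (a N (i + 1))).continuous_of_finiteDimensional
    have h2 := g.continuous_of_finiteDimensional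
    fun_prop
  have hxU : x ∈ ⋂ i : Fin n, {y : RP2 | 0 < (fun w => triL (a N i) (a N (i + 1)) w * g w)
      y.rep} := by
    refine Set.mem_iInter.2 fun i => (hv.pos_rep_iff (hs i)).2 (mul_pos ?_ hgv)
    exact hN N le_rfl _ (fun l => h.convex.edge_nonneg N i l) (h.edge_functional_ne_zero N i)
  have hx' := mem_limitSet.1 hx (Set.Iic (N - M)) (Iic_mem_atBot _)
  obtain ⟨y, hyU, hy⟩ := mem_closure_iff.1 hx' _ hU hxU
  simp only [Set.mem_iUnion, Set.mem_Iic] at hy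
  obtain ⟨q, hq, hy⟩ := hy
  obtain ⟨r, s, hr, hs', hl⟩ := (h.mem_edge q y).1 hy
  set w := r • a q 0 + s • a q 1 with hw
  have hgw : 0 ≤ g w := by
    have g0 := hL.g_pos q 0
    have g1 := hL.g_pos q 1
    rw [hw, map_add, map_smul, map_smul, smul_eq_mul, smul_eq_mul]
    positivity
  have hwU : ∀ i < n, 0 < tri (a N i) (a N (i + 1)) w * g w := fun i hi =>
    (hl.pos_rep_iff (hs i)).1 (Set.mem_iInter.1 hyU ⟨i, hi⟩)
  have h4 := h.convex.four_le
  have hgw' : 0 < g w := lt_of_le_of_ne hgw fun e => by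
    have := hwU 0 (by omega)
    rw [← e, mul_zero] at this
    exact lt_irrefl _ this
  have hin : ∀ i < n, 0 ≤ tri (a N i) (a N (i + 1)) w := fun i hi =>
    (pos_of_mul_pos_left (hwU i hi) hgw).le
  -- `H` vanishes on the early edge but is strictly positive on polygon `N`, so `g ≤ C • H` there.
  -- For `w` both on the edge and in the cone over the polygon this gives `g w ≤ 0`.
  set H := triL (a q 0) (a q 1) with hH
  have hHN : ∀ i, 0 < H (a N i) := hM q H (fun i => h.convex.edge_nonneg q 0 i)
    (h.edge_functional_ne_zero q 0) N (by omega)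
  obtain ⟨C, hC⟩ := h.convex.exists_ratioIn hHN g
  have h1 := h.convex.map_nonneg_of_inside hin (f := C • H - g) fun i => by
    simpa using (hC i).2
  have h2 : H w = 0 := by simp [hH, hw]
  rw [LinearMap.sub_apply, LinearMap.smul_apply, h2, smul_zero, zero_sub] at h1
  linarith

/-- The spiral winds around its center infinitely often. -/
theorem exists_crossing (h : SpiralLift n k P a) (hL : IsLimitPair a g p) {x : Vec} (hx : x ≠ 0)
    (hgx : g x = 0) (N : ℤ) :
    ∃ q ≤ N, tri p x (a q 0) ≤ 0 ∧ 0 < tri p x (a q 1) := by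
  have hk := h.convex.lt
  have hk1 := h.convex.one_le
  have hpx : triL p x ≠ 0 := by
    intro e
    have hz : ∀ w, tri p x w = 0 := fun w => LinearMap.congr_fun e w
    apply hx
    have e0 := hz (Pi.single 0 1)
    have e1 := hz (Pi.single 1 1)
    have e2 := hz (Pi.single 2 1)
    simp only [tri, Pi.single_apply] at e0 e1 e2
    norm_num [Fin.ext_iff] at e0 e1 e2
    have e3 : g x • p = x := by
      have e4 : ∀ c d : Fin 3, p c * x d = p d * x c := by
        intro c d
        fin_cases c <;> fin_cases d <;> simp <;> linarith
      have e5 : ∀ d, x d • p = p d • x := fun d => by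
        ext c
        simp only [Pi.smul_apply, smul_eq_mul]
        linarith [e4 c d]
      have e6 : ∀ d, x d = p d * g x := fun d => by
        have := congrArg g (e5 d)
        rwa [map_smul, map_smul, hL.g_p, smul_eq_mul, mul_one, smul_eq_mul] at this
      ext d
      rw [Pi.smul_apply, smul_eq_mul, e6 d]
      ring
    rw [← e3, hgx, zero_smul]
  -- Nonnegativity on the far outward part of `P` passes to all its images, because `diag` only
  -- refers to labels `q` and `q - 2`. It then holds on a whole polygon and forces `f p > 0`.
  have key : ∀ f : Vec →ₗ[ℝ] ℝ, f ≠ 0 → f p = 0 → ¬ ∃ N : ℤ, ∀ q ≤ N, 0 ≤ f (a q 0) := by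
    rintro f hf0 hfp ⟨N, hN⟩
    have hlev : ∀ j ≤ k, ∀ q ≤ N, 0 ≤ f (a q (n - j)) := by
      intro j
      induction j with
      | zero =>
        intro _ q hq
        rw [Nat.sub_zero, h.convex.apply_self]
        exact hN q hq
      | succ j ih =>
        intro hj q hq
        obtain ⟨γ, δ, hγ, hδ, e⟩ := h.convex.pathSystem.diag j hj q
        rw [e, map_add, map_smul, map_smul, smul_eq_mul, smul_eq_mul]
        have h1 := ih (by omega) q hq
        have h2 := ih (by omega) (q - 2) (by omega)
        positivity
    have hall : ∀ i, 0 ≤ f (a (N - n) i) := by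
      intro i
      rw [← h.convex.apply_mod]
      have hi := h.convex.mod_lt i
      rcases le_or_gt (i % n) (n - k) with him | him
      · obtain ⟨β, hβ, e⟩ := h.convex.shift_iter (i % n) (N - n) him
        have := hN (N - n + (i % n : ℕ)) (by omega)
        rw [e, map_smul, smul_eq_mul] at this
        exact nonneg_of_mul_nonneg_right this hβ
      · have := hlev (n - i % n) (by omega) (N - n) (by omega)
        rwa [show n - (n - i % n) = i % n by omega] at this
    exact (hL.pos _ f hall hf0).ne' hfp
  have hnext : ∀ q, ∃ β : ℝ, 0 < β ∧ a (q + 1) 0 = β • a q 1 := fun q => by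
    obtain ⟨β, hβ, e⟩ := h.convex.shift_iter 1 q (by omega)
    exact ⟨β, hβ, by simpa using e⟩
  by_contra! hcon
  have hstep : ∀ q ≤ N, tri p x (a q 0) ≤ 0 → tri p x (a (q + 1) 0) ≤ 0 := by
    intro q hq h0
    obtain ⟨β, hβ, e⟩ := hnext q
    rw [e, tri_smul_right]
    exact mul_nonpos_of_nonneg_of_nonpos hβ.le (hcon q hq h0)
  by_cases hneg : ∃ N' : ℤ, ∀ q ≤ N', 0 < tri p x (a q 0)
  · obtain ⟨N', hN'⟩ := hneg
    exact key (triL p x) hpx (by simp) ⟨N', fun q hq => (hN' q hq).le⟩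
  · push Not at hneg
    refine key (-triL p x) (neg_ne_zero.2 hpx) (by simp) ⟨N, fun q hq => ?_⟩
    obtain ⟨q', hq', h0⟩ := hneg q
    have : ∀ t : ℕ, q' + t ≤ N → tri p x (a (q' + t) 0) ≤ 0 := by
      intro t
      induction t with
      | zero => exact fun _ => by simpa using h0
      | succ t ih =>
        intro ht
        push_cast at ht ⊢
        rw [← add_assoc]
        exact hstep _ (by omega) (ih (by omega))
    obtain ⟨t, rfl⟩ := Int.le.dest hq'
    simpa using this t hq

theorem subset_limitSet_atBot (h : SpiralLift n k P a) (hL : IsLimitPair a g p) :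
    {x | g x.rep = 0} ⊆ limitSet atBot n k P := by
  intro z hz
  rw [mem_limitSet]
  intro u hu
  set x := z.rep with hxdef
  have hgx : g x = 0 := hz
  have hx : x ≠ 0 := z.rep_nonzero
  refine (isLift_rep z).mem_closure ?_
  have hlim : Tendsto (fun θ : ℝ => x + θ • p) (𝓝[≥] 0) (𝓝 x) := by
    have : Continuous fun θ : ℝ => x + θ • p := by fun_prop
    have h0 := (this.tendsto 0).mono_left (nhdsWithin_le_nhds (s := Set.Ici 0))
    simpa using h0
  refine hlim.frequently ?_
  rw [Filter.frequently_iff]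
  intro U hU
  obtain ⟨ε, hε, hεU⟩ := (mem_nhdsGE_iff_exists_Ico_subset).1 hU
  replace hε : 0 < ε := hε
  obtain ⟨N₁, hN₁⟩ := mem_atBot_sets.1 hu
  -- The test point `p + (1 / ε) • x` is a multiple of `x + ε • p`. Once it is strictly inside the
  -- polygon, the crossing of the edge with the plane of `p` and `x` must occur at a parameter `θ <
  -- ε`.
  have hgy : 0 < g (p + (1 / ε) • x) := by simp [hL.g_p, hgx]
  obtain ⟨N₂, hN₂⟩ := hL.exhaust _ hgy
  obtain ⟨q, hq, h0, h1⟩ := h.exists_crossing hL hx hgx (min N₁ N₂)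
  set σ₀ := tri p x (a q 0)
  set σ₁ := tri p x (a q 1)
  set w := σ₁ • a q 0 + (-σ₀) • a q 1 with hw
  set H := triL (a q 0) (a q 1) with hH
  have hH0 : H ≠ 0 := h.edge_functional_ne_zero q 0
  have hHa : ∀ i, 0 ≤ H (a q i) := fun i => h.convex.edge_nonneg q 0 i
  have hHp : 0 < H p := hL.pos q H hHa hH0
  have hHy := hN₂ q (hq.trans (min_le_right _ _)) H hHa hH0
  have hwH : H w = 0 := by
    rw [hw, map_add, map_smul, map_smul]
    simp [hH]
  have g0 := hL.g_pos q 0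
  have g1 := hL.g_pos q 1
  have hgw : 0 < g w := by
    rw [hw, map_add, map_smul, map_smul, smul_eq_mul, smul_eq_mul]
    have : 0 ≤ -σ₀ * g (a q 1) := mul_nonneg (neg_nonneg.2 h0) g1.le
    have : 0 < σ₁ * g (a q 0) := by positivity
    linarith
  -- The weights `σ₁` and `-σ₀` place `w` in the plane of `p` and `x`; its coordinates there give
  -- the parameter `g w / H p`.
  have hwe : w = g w • p + H p • x := by
    have e1 : w = (-tri x (a q 0) (a q 1)) • p + H p • x := by
      ext c
      simp only [hw, hH, σ₀, σ₁, triL_apply, tri, Pi.add_apply, Pi.smul_apply, smul_eq_mul]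
      fin_cases c <;> simp <;> ring
    have e2 : g w = -tri x (a q 0) (a q 1) := (congrArg g e1).trans (by
      rw [map_add, map_smul, map_smul, hL.g_p, hgx, smul_eq_mul, smul_zero, mul_one, add_zero])
    rw [e2]
    exact e1
  have hw0 : w ≠ 0 := fun e => by simp [e] at hgw
  refine ⟨g w / H p, hεU ⟨by positivity, ?_⟩, Projectivization.mk ℝ w hw0, ?_, ?_⟩
  · have e1 : H w = g w * H p + H p * H x := by
      conv_lhs => rw [hwe]
      simp
    rw [map_add, map_smul, smul_eq_mul] at hHy
    rw [div_lt_iff₀ hHp]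
    have e2 : H x = -g w := by
      have : H p * (g w + H x) = 0 := by rw [← hwH, e1]; ring
      have := (mul_eq_zero.1 this).resolve_left hHp.ne'
      linarith
    rw [e2] at hHy
    have : ε * (H p + 1 / ε * -g w) = ε * H p - g w := by field_simp; ring
    have h5 := mul_pos hε hHy
    linarith
  · simp only [Set.mem_iUnion]
    exact ⟨q, hN₁ q (hq.trans (min_le_left _ _)),
      (h.mem_edge q _).2 ⟨σ₁, -σ₀, h1.le, neg_nonneg.2 h0, isLift_mk w _⟩⟩
  · have e : x + (g w / H p) • p = (H p)⁻¹ • w := by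
      rw [hwe, smul_add, smul_smul, smul_smul, inv_mul_cancel₀ hHp.ne', one_smul, ← hwe,
        add_comm, div_eq_inv_mul]
    rw [e]
    exact (isLift_mk w hw0).smul (inv_ne_zero hHp.ne')

end SpiralLift


/-! ### Support of the triangulation -/

namespace SpiralLift

variable {n k : ℕ} {P : ℤ → RP2} {a : ℤ → ℕ → Vec}

theorem mem_triangulationSupport (h : SpiralLift n k P a) (x : RP2) :
    x ∈ triangulationSupport n k P ↔ ∃ q i, n - k ≤ i ∧ i < n ∧ ∃ r s t : ℝ,
      0 ≤ r ∧ 0 ≤ s ∧ 0 ≤ t ∧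
        (IsLift x (r • a q (i + 1) + s • a (q + 1) (i + 1) + t • a (q + 2) i) ∨
          IsLift x (r • a q (i + 1) + s • a (q + 1) i + t • a (q + 2) i)) := by
  have hk := h.convex.lt
  have hlift : ∀ j, 1 ≤ j → j ≤ k → ∀ q, IsLift (iter P (j - 1) q) (a q (n - j + 1)) :=
    fun j hj hjk q => by
      have := h.lift_iter q (j - 1) (by omega)
      rwa [show n - (j - 1) = n - j + 1 by omega] at this
  constructor
  · rintro ⟨q, φ, hφ, j, hj, hjk, hx⟩
    have h0 := h.chart_pos q φ hφ
    have h1 := h.convex.map_pos_of_le (show q ≤ q + 1 by omega) h0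
    have h2 := h.convex.map_pos_of_le (show q ≤ q + 2 by omega) h0
    refine ⟨q, n - j, by omega, by omega, ?_⟩
    rcases hx with hx | hx
    · obtain ⟨r, s, t, hr, hs, ht, hl⟩ := (mem_hullIn_triple (hlift j hj hjk q)
        (hlift j hj hjk (q + 1)) (h.lift_iter (q + 2) j hjk) (h0 _) (h1 _) (h2 _) x).1 hx
      exact ⟨r, s, t, hr, hs, ht, Or.inl hl⟩
    · obtain ⟨r, s, t, hr, hs, ht, hl⟩ := (mem_hullIn_triple (hlift j hj hjk q)
        (h.lift_iter (q + 1) j hjk) (h.lift_iter (q + 2) j hjk) (h0 _) (h1 _) (h2 _) x).1 hx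
      exact ⟨r, s, t, hr, hs, ht, Or.inr hl⟩
  · rintro ⟨q, i, hi, hin, r, s, t, hr, hs, ht, hx⟩
    obtain ⟨φ, hφ⟩ := h.exists_chart q
    have h0 := h.chart_pos q φ hφ
    have h1 := h.convex.map_pos_of_le (show q ≤ q + 1 by omega) h0
    have h2 := h.convex.map_pos_of_le (show q ≤ q + 2 by omega) h0
    obtain ⟨j, hj, hjk, rfl⟩ : ∃ j, 1 ≤ j ∧ j ≤ k ∧ i = n - j :=
      ⟨n - i, by omega, by omega, by omega⟩
    refine ⟨q, φ, hφ, j, hj, hjk, ?_⟩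
    rcases hx with hl | hl
    · exact Or.inl ((mem_hullIn_triple (hlift j hj hjk q)
        (hlift j hj hjk (q + 1)) (h.lift_iter (q + 2) j hjk) (h0 _) (h1 _) (h2 _) x).2
          ⟨r, s, t, hr, hs, ht, hl⟩)
    · exact Or.inr ((mem_hullIn_triple (hlift j hj hjk q)
        (h.lift_iter (q + 1) j hjk) (h.lift_iter (q + 2) j hjk) (h0 _) (h1 _) (h2 _) x).2
          ⟨r, s, t, hr, hs, ht, hl⟩)

end SpiralLift

theorem map_combination_pos {g : Vec →ₗ[ℝ] ℝ} {u v w : Vec} (hu : 0 < g u) (hv : 0 < g v)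
    (hw : 0 < g w) {r s t : ℝ} (hr : 0 ≤ r) (hs : 0 ≤ s) (ht : 0 ≤ t)
    (h : r • u + s • v + t • w ≠ 0) : 0 < g (r • u + s • v + t • w) := by
  simp only [map_add, map_smul, smul_eq_mul]
  have h1 := mul_nonneg hr hu.le
  have h2 := mul_nonneg hs hv.le
  have h3 := mul_nonneg ht hw.le
  refine lt_of_le_of_ne (by positivity) fun e => h ?_
  have e1 : r = 0 := (mul_eq_zero.1 (by linarith : r * g u = 0)).resolve_right hu.ne'
  have e2 : s = 0 := (mul_eq_zero.1 (by linarith : s * g v = 0)).resolve_right hv.ne'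
  have e3 : t = 0 := (mul_eq_zero.1 (by linarith : t * g w = 0)).resolve_right hw.ne'
  simp [e1, e2, e3]

theorem ConvexSpiral.tri_corner_nonpos {n k : ℕ} {a : ℤ → ℕ → Vec} (h : ConvexSpiral n k a)
    (q : ℤ) (i : ℕ) : tri (a (q + 1) i) (a (q + 1) (i + 1)) (a q (i + 1)) ≤ 0 := by
  have h4 := h.four_le
  obtain ⟨α, β, hα, hβ, e⟩ := h.step q i
  obtain ⟨α', β', hα', hβ', e'⟩ := h.step q (i + 1)
  have h1 := h.nonneg q (show i ≤ i + 1 by omega) (show i + 1 ≤ i + 2 by omega)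
    (show i + 2 ≤ i + n by omega)
  have e2 : tri (a (q + 1) i) (a (q + 1) (i + 1)) (a q (i + 1)) =
      -(α * β' * tri (a q i) (a q (i + 1)) (a q (i + 2))) := by
    rw [e, e']
    simp only [tri, Pi.add_apply, Pi.smul_apply, smul_eq_mul, add_assoc]
    ring
  rw [e2]
  exact neg_nonpos.2 (by positivity)

namespace SpiralLift

variable {n k : ℕ} {P : ℤ → RP2} {a : ℤ → ℕ → Vec} {g : Vec →ₗ[ℝ] ℝ} {p : Vec}

/-- All triangle vertices have `g > 0`, which keeps the triangles off the line. The line of the new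
edge separates them weakly from `p`, which is strictly on its inner side. -/
theorem triangulationSupport_subset (h : SpiralLift n k P a) (hL : IsLimitPair a g p)
    (hp : p ≠ 0) :
    triangulationSupport n k P ⊆ ({Projectivization.mk ℝ p hp} ∪ {x | g x.rep = 0})ᶜ := by
  intro x hx
  obtain ⟨q, i, hi, hin, r, s, t, hr, hs, ht, hx⟩ := (h.mem_triangulationSupport x).1 hx
  set H := triL (a (q + 1) i) (a (q + 1) (i + 1)) with hH
  have hc : H (a q (i + 1)) ≤ 0 := h.convex.tri_corner_nonpos q i
  have hc' : H (a (q + 2) i) = 0 := by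
    obtain ⟨α, β, -, -, e⟩ := h.convex.step (q + 1) i
    rw [show q + 2 = q + 1 + 1 by ring, e, map_add, map_smul, map_smul]
    simp [hH]
  have hHp : 0 < H p := hL.pos (q + 1) H (fun l => h.convex.edge_nonneg _ i l)
    (h.edge_functional_ne_zero _ i)
  obtain ⟨w, hxw, hgw, hHw⟩ : ∃ w, IsLift x w ∧ 0 < g w ∧ H w ≤ 0 := by
    have hrc := mul_nonpos_of_nonneg_of_nonpos hr hc
    rcases hx with hx | hx
    · refine ⟨_, hx, map_combination_pos (hL.g_pos _ _) (hL.g_pos _ _) (hL.g_pos _ _)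
        hr hs ht hx.ne_zero, ?_⟩
      have : H (a (q + 1) (i + 1)) = 0 := by simp [hH]
      simpa only [map_add, map_smul, smul_eq_mul, hc', this, mul_zero, add_zero] using hrc
    · refine ⟨_, hx, map_combination_pos (hL.g_pos _ _) (hL.g_pos _ _) (hL.g_pos _ _)
        hr hs ht hx.ne_zero, ?_⟩
      have : H (a (q + 1) i) = 0 := by simp [hH]
      simpa only [map_add, map_smul, smul_eq_mul, hc', this, mul_zero, add_zero] using hrc
  rintro (hxp | hxg)
  · rw [Set.mem_singleton_iff] at hxp
    subst hxp
    obtain ⟨c, hc0, e⟩ := hxw.exists_smul (isLift_mk p hp)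
    subst e
    rw [map_smul, hL.g_p, smul_eq_mul, mul_one] at hgw
    rw [map_smul, smul_eq_mul] at hHw
    exact absurd (mul_pos hgw hHp) (not_lt.2 hHw)
  · exact (hxw.map_rep_ne_zero_iff g).2 hgw.ne' hxg

/-- A vector in all late cones satisfies `f v ≤ f p * g v` for every functional, hence with
equality, and so is a multiple of `p`. -/
theorem exists_not_inside (h : SpiralLift n k P a) (hL : IsLimitPair a g p) {v : Vec}
    (hgv : 0 < g v) (hv : v ≠ g v • p) (N : ℤ) :
    ∃ q ≥ N, ∃ i < n, tri (a q i) (a q (i + 1)) v < 0 := by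
  by_contra! hcon
  have hle : ∀ f : Vec →ₗ[ℝ] ℝ, f v ≤ f p * g v := by
    intro f
    refine le_of_forall_pos_le_add fun ε hε => ?_
    obtain ⟨N', hN'⟩ := hL.tendsto f (ε / g v) (by positivity)
    have h1 := h.convex.map_nonneg_of_inside (hcon (max N N') (le_max_left _ _))
      (f := (ε / g v) • g - (f - f p • g)) fun i => by
        have := (le_abs_self _).trans (hN' (max N N') (le_max_right _ _) i)
        simpa using this
    simp only [LinearMap.sub_apply, LinearMap.smul_apply, smul_eq_mul,
      div_mul_cancel₀ _ hgv.ne'] at h1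
    linarith
  apply hv
  ext c
  refine le_antisymm ?_ ?_
  · simpa [mul_comm] using hle (LinearMap.proj c)
  · simpa [mul_comm] using hle (-LinearMap.proj c)

/-- The point is inside an early polygon and outside a later one, so at some single step it is lost.
It then lies in a corner cut off at that step. -/
theorem subset_triangulationSupport (h : SpiralLift n k P a) (hL : IsLimitPair a g p)
    (hp : p ≠ 0) :
    ({Projectivization.mk ℝ p hp} ∪ {x | g x.rep = 0})ᶜ ⊆ triangulationSupport n k P := by
  intro x hx
  have hxp : x ≠ Projectivization.mk ℝ p hp := fun e => hx (Or.inl e)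
  have hgx : g x.rep ≠ 0 := fun e => hx (Or.inr e)
  obtain ⟨v, hv, hgv⟩ : ∃ v, IsLift x v ∧ 0 < g v := by
    refine ⟨(g x.rep)⁻¹ • x.rep, (isLift_rep x).smul (inv_ne_zero hgx), ?_⟩
    rw [map_smul, smul_eq_mul, inv_mul_cancel₀ hgx]
    exact one_pos
  have hvp : v ≠ g v • p := fun e => hxp <| by
    have := (isLift_mk p hp).smul hgv.ne'
    rw [← e] at this
    exact hv.eq this
  obtain ⟨N, hN⟩ := hL.exhaust v hgv
  obtain ⟨q', hq', i', hi', hneg⟩ := h.exists_not_inside hL hgv hvp N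
  obtain ⟨q, hin, hout⟩ : ∃ q, (∀ i < n, 0 ≤ tri (a q i) (a q (i + 1)) v) ∧
      ∃ i < n, tri (a (q + 1) i) (a (q + 1) (i + 1)) v < 0 := by
    by_contra! hcon
    have hall : ∀ q ≥ N, ∀ i < n, 0 ≤ tri (a q i) (a q (i + 1)) v := fun q hq =>
      Int.leInduction
        (fun i _ => (hN N le_rfl _ (fun l => h.convex.edge_nonneg N i l)
          (h.edge_functional_ne_zero N i)).le)
        (fun q _ ih => hcon q ih) q hq
    exact absurd hneg (not_lt.2 (hall q' hq' i' hi'))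
  obtain ⟨i, hi, hin', r, s, t, hr, hs, ht, e⟩ := h.convex.exists_corner hin hout
  obtain ⟨α, β, hα, hβ, ec⟩ := h.convex.cut (q + 1) i hi hin'
  rw [show q + 1 + 1 = q + 2 by ring] at ec
  refine (h.mem_triangulationSupport x).2 ⟨q, i, hi, hin', ?_⟩
  -- The vertex `a (q + 2) i` lies on the new edge; the segment from it to the cut corner `a q (i +
  -- 1)` divides the corner into the two triangles, and the comparison tells which side contains the
  -- point.
  rcases le_total (t * α) (r * β) with hle | hle
  · refine ⟨s, r - t / β * α, t / β, hs, ?_, by positivity, Or.inr ?_⟩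
    · rw [div_mul_eq_mul_div, sub_nonneg, div_le_iff₀ hβ]
      exact hle
    · convert hv using 1
      rw [e, ec, smul_add, smul_smul, smul_smul, div_mul_cancel₀ _ hβ.ne']
      module
  · refine ⟨s, t - r / α * β, r / α, hs, ?_, by positivity, Or.inl ?_⟩
    · rw [div_mul_eq_mul_div, sub_nonneg, div_le_iff₀ hα]
      exact hle
    · convert hv using 1
      rw [e, ec, smul_add, smul_smul, smul_smul, div_mul_cancel₀ _ hα.ne']
      module

end SpiralLift

/-! ### Normal form and conclusion -/

/-- A projective transformation that sends a given line to the line at infinity and a given point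
off that line to the origin. -/
theorem exists_linearEquiv {g : Vec →ₗ[ℝ] ℝ} {p : Vec} (hgp : g p = 1) :
    ∃ G : Vec ≃ₗ[ℝ] Vec, (∀ v, G v 2 = g v) ∧ G p = ![0, 0, 1] := by
  obtain ⟨w, hw⟩ : ∃ w, g = dotL w := ⟨_, linearMap_eq_dotL g⟩
  have hsum : w 0 * p 0 + w 1 * p 1 + w 2 * p 2 = 1 := by rw [← dotL_apply, ← hw, hgp]
  -- Since `w c ≠ 0`, the functional `g` and the two coordinates other than `c` are independent.
  -- Subtracting `p d • g` from those coordinates makes them vanish at `p`.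
  obtain ⟨c, hc⟩ : ∃ c : Fin 3, w c * p c ≠ 0 := by
    by_contra! hcon
    rw [hcon 0, hcon 1, hcon 2] at hsum
    norm_num at hsum
  let e (d : Fin 3) : Vec →ₗ[ℝ] ℝ := LinearMap.proj d - p d • g
  let G : Vec →ₗ[ℝ] Vec := LinearMap.pi ![e (c + 1), e (c + 2), g]
  have hG0 : ∀ v, G v 0 = v (c + 1) - p (c + 1) * g v := fun v => by simp [G, e]
  have hG1 : ∀ v, G v 1 = v (c + 2) - p (c + 2) * g v := fun v => by simp [G, e]
  have hG2 : ∀ v, G v 2 = g v := fun v => by simp [G]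
  have hinj : Function.Injective G := by
    rw [← LinearMap.ker_eq_bot, LinearMap.ker_eq_bot']
    intro v hv
    have h2 : g v = 0 := by rw [← hG2, hv]; rfl
    have h0 : v (c + 1) = 0 := by
      have := hG0 v
      rw [hv, h2] at this
      simpa using this.symm
    have h1 : v (c + 2) = 0 := by
      have := hG1 v
      rw [hv, h2] at this
      simpa using this.symm
    have h3 : w c * v c = 0 := by
      rw [hw, dotL_apply] at h2
      fin_cases c <;> simp at h0 h1 ⊢ <;> simpa [h0, h1] using h2
    have h4 : v c = 0 := (mul_eq_zero.1 h3).resolve_left (left_ne_zero_of_mul hc)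
    ext d
    fin_cases c <;> fin_cases d <;> simp_all
  refine ⟨LinearEquiv.ofInjectiveEndo G hinj, hG2, ?_⟩
  ext d
  rw [LinearEquiv.coe_ofInjectiveEndo]
  fin_cases d
  · simpa [hgp] using hG0 p
  · simpa [hgp] using hG1 p
  · simpa [hgp] using hG2 p

theorem isLift_projTransformation {x : RP2} {v : Vec} (h : IsLift x v) (G : Vec ≃ₗ[ℝ] Vec) :
    IsLift (projTransformation G x) (G v) := by
  obtain ⟨hv, rfl⟩ := h
  exact ⟨G.map_ne_zero_iff.2 hv, by rw [projTransformation, Projectivization.map_mk]; rfl⟩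

theorem exists_image_eq_puncturedPlane {g : Vec →ₗ[ℝ] ℝ} {p : Vec} (hgp : g p = 1) (hp : p ≠ 0) :
    ∃ G : Vec ≃ₗ[ℝ] Vec, projTransformation G ''
      ({Projectivization.mk ℝ p hp} ∪ {x | g x.rep = 0})ᶜ = puncturedPlane := by
  obtain ⟨G, hG2, hGp⟩ := exists_linearEquiv hgp
  refine ⟨G, Set.Subset.antisymm ?_ ?_⟩
  · rintro _ ⟨x, hx, rfl⟩
    have hxp : x ≠ Projectivization.mk ℝ p hp := fun e => hx (Or.inl e)
    have hgx : g x.rep ≠ 0 := fun e => hx (Or.inr e)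
    have hv := (isLift_rep x).smul (inv_ne_zero hgx)
    set v := (g x.rep)⁻¹ • x.rep with hvdef
    have hgv : g v = 1 := by rw [hvdef, map_smul, smul_eq_mul, inv_mul_cancel₀ hgx]
    have e : G v = ![G v 0, G v 1, 1] := by
      ext d
      fin_cases d
      · rfl
      · rfl
      · exact (hG2 v).trans hgv
    refine ⟨G v 0, G v 1, fun h0 => hxp ?_, ?_⟩
    · rw [Prod.mk.injEq] at h0
      rw [h0.1, h0.2, ← hGp] at e
      rw [G.injective e] at hv
      exact hv.eq (isLift_mk p hp)
    · have := isLift_projTransformation hv G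
      rw [e] at this
      exact this.eq (isLift_mk _ _)
  · rintro _ ⟨s, t, hst, rfl⟩
    set u : Vec := ![s, t, 1] with hu
    have hu0 : u ≠ 0 := fun h => one_ne_zero (α := ℝ) (congrFun h 2)
    have hgu : g (G.symm u) = 1 := by
      rw [← hG2, G.apply_symm_apply]
      rfl
    have hv0 : G.symm u ≠ 0 := G.symm.map_ne_zero_iff.2 hu0
    have hl := isLift_mk (G.symm u) hv0
    refine ⟨Projectivization.mk ℝ (G.symm u) hv0, ?_, ?_⟩
    · rintro (hxp | hxg)
      · rw [Set.mem_singleton_iff] at hxp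
        rw [hxp] at hl
        obtain ⟨c, hc0, e⟩ := hl.exists_smul (isLift_mk p hp)
        have hc1 : c = 1 := by rw [e, map_smul, hgp, smul_eq_mul, mul_one] at hgu; exact hgu
        rw [hc1, one_smul] at e
        have e' : u = ![0, 0, 1] := by rw [← hGp, ← e, G.apply_symm_apply]
        exact hst (Prod.ext (congrFun e' 0) (congrFun e' 1))
      · exact (hl.map_rep_ne_zero_iff g).2 (by rw [hgu]; exact one_ne_zero) hxg
    · have := isLift_projTransformation hl G
      rw [G.apply_symm_apply] at this
      exact this.eq (isLift_mk _ _)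

end Pentagram

theorem theorem1p3 (n k : ℕ) (P : ℤ → Pentagram.RP2) (hP : Pentagram.IsPLCSpiral n k P) :
    ∃ (p : Pentagram.RP2) (L : Set Pentagram.RP2),
      Pentagram.IsLine L ∧ p ∉ L ∧
      Pentagram.limitSet Filter.atTop n k P = {p} ∧
      Pentagram.limitSet Filter.atBot n k P = L ∧
      Pentagram.omegaLimitSet n k P = {p} ∪ L ∧
      Pentagram.triangulationSupport n k P = ({p} ∪ L)ᶜ ∧
      ∃ g : Pentagram.Vec ≃ₗ[ℝ] Pentagram.Vec,
        Pentagram.projTransformation g '' Pentagram.triangulationSupport n k P =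
          Pentagram.puncturedPlane := by
  obtain ⟨a₀, h₀⟩ := hP.exists_spiralLift
  obtain ⟨a, hpos, hconv, ε, K, hε, hK, hstep, hlast⟩ := h₀.convex.exists_bounded
  have h := h₀.congr hconv hpos
  obtain ⟨δ, K', hδ, hK', hH⟩ := hconv.harnack hε hK hstep hlast
  obtain ⟨g, p, hL⟩ := hconv.exists_isLimitPair hδ hK' hH fun q => by
    obtain ⟨φ, hφ⟩ := h.exists_chart q
    exact ⟨φ, h.chart_pos q φ hφ⟩
  have hp : p ≠ 0 := fun e => by
    have := hL.g_p
    rw [e, map_zero] at this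
    exact zero_ne_one this
  have hg : g ≠ 0 := fun e => by
    have := hL.g_p
    rw [e, LinearMap.zero_apply] at this
    exact zero_ne_one this
  have htop := h.limitSet_atTop hL hp
  have hbot := (h.limitSet_atBot_subset hL).antisymm (h.subset_limitSet_atBot hL)
  have hsupp := (h.triangulationSupport_subset hL hp).antisymm
    (h.subset_triangulationSupport hL hp)
  refine ⟨Projectivization.mk ℝ p hp, {x | g x.rep = 0}, ⟨g, hg, rfl⟩, fun hm => ?_, htop, hbot,
    ?_, hsupp, ?_⟩
  · refine ((Pentagram.isLift_mk p hp).map_rep_ne_zero_iff g).2 ?_ hm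
    rw [hL.g_p]
    exact one_ne_zero
  · rw [Pentagram.omegaLimitSet, Int.cofinite_eq, Pentagram.limitSet_sup, htop, hbot,
      Set.union_comm]
  · rw [hsupp]
    exact Pentagram.exists_image_eq_puncturedPlane hL.g_p hp
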